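/- Let $\mathcal B$ be a unital C*-algebra, let $\mathcal B\langle X\rangle$ be the unital free product over $\mathbb C$ of $\mathcal B$ and the polynomial algebra $\mathbb C[X]$, with the involution extending that of $\mathcal B$ and with $X^*=X$, and let $\mathcal B_0\langle X\rangle$ be the span of the monomials $b_0Xb_1\cdots Xb_n$ with $n\ge 1$. A linear map $\mu:\mathcal B\langle X\rangle\to\mathcal B$ is called completely positive if for all $n$ and $P_1,\dots,P_n\in\mathcal B\langle X\rangle$ the matrix $[\mu(P_iP_j^*)]_{i,j}$ is positive in $M_n(\mathcal B)$. Below, "bimodule map $\mathcal B\langle X\rangle\to\mathcal B$" means a linear $\mathcal B$-bimodule map which is the identity on $\mathcal B$. For a $\mathcal B$-bimodule map $K:\mathcal B_0\langle X\rangle\to\mathcal B$ and a non-crossing partition $\pi$ of $\{1,\dots,n\}$, let $K_\pi[b_0Xb_1\cdots Xb_n]$ be the element of $\mathcal B$ obtained by applying $K$ in the nested way along the blocks of $\pi$ (with $K_\emptyset[b_0]=b_0$). Order the blocks of $\pi$ by $U\prec V$ if there are $i,j\in U$ with $i<v<j$ for all $v\in V$, and let $o(\pi)$ be the number of order-preserving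 bijections from the blocks of $\pi$ onto $\{1,\dots,|\pi|\}$. The map $K$ is the monotone cumulant functional $K^\mu$ of a bimodule map $\mu$ if, for all $n\ge 0$ and $b_0,\dots,b_n\in\mathcal B$, $$\mu[b_0Xb_1\cdots Xb_n]=\sum_{\pi\in NC(n)}\frac{o(\pi)}{|\pi|!}\,K_\pi[b_0Xb_1\cdots Xb_n],$$ and it is the Boolean cumulant functional of $\mu$ if $\mu[b_0Xb_1\cdots Xb_n]=\sum_\pi K_\pi[b_0Xb_1\cdots Xb_n]$, the sum being over all partitions $\pi$ of $\{1,\dots,n\}$ into intervals. For $i\in\mathbb N$, the monotone power $\mu^{\rhd i}$ is the bimodule map whose monotone cumulant functional is $iK^\mu$. Let $\gamma\in\mathcal B$ be self-adjoint, and let $\sigma:\mathcal B\langle X\rangle\to\mathcal B$ be a completely positive linear map, not necessarily a bimodule map. Let $\nu_\rhd^{\gamma,\sigma}$, respectively $\nu_\uplus^{\gamma,\sigma}$, be the bimodule map whose monotone, respectively Boolean, cumulant functional $K$ is given by $$K[b_0Xb_1]=b_0\gamma b_1,\qquad K[b_0Xb_1X\cdots b_{n-1}Xb_n]=b_0\,\sigma[b_1X\cdots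 Xb_{n-1}]\,b_n\quad(n\ge 2).$$ Then $\nu_\rhd^{\gamma,\sigma}$ exists, is unique and is completely positive. Moreover, for every $i\ge 1$ the map $\mu_i=\nu_\uplus^{\gamma/i,\sigma/i}$ exists, is unique and is completely positive; its monotone power $\mu_i^{\rhd i}$ exists, is unique and is completely positive; and $\mu_i^{\rhd i}(P)\to\nu_\rhd^{\gamma,\sigma}(P)$ in norm for every $P\in\mathcal B\langle X\rangle$. -/

import Mathlib

open Filter Topology

noncomputable section

namespace OpValued

/-! ### The algebra `B⟨X⟩` of noncommutative polynomials

`B⟨X⟩` is the unital free product, over `ℂ`, of the C*-algebra `B` with the polynomial algebra in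
one symbol `X`, presented by generators and relations. It carries the involution
that extends the one of `B` and fixes `X`. -/

section Poly

variable (B : Type*) [CStarAlgebra B]

/-- The relations that make `b ↦ ι (some b)` a unital `ℂ`-algebra homomorphism. The generator
`ι none` is the free symbol `X`. -/
inductive PolyRel : FreeAlgebra ℂ (Option B) → FreeAlgebra ℂ (Option B) → Prop
  | add (a b : B) : PolyRel (FreeAlgebra.ι ℂ (some (a + b)))
      (FreeAlgebra.ι ℂ (some a) + FreeAlgebra.ι ℂ (some b))
  | mul (a b : B) : PolyRel (FreeAlgebra.ι ℂ (some (a * b)))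
      (FreeAlgebra.ι ℂ (some a) * FreeAlgebra.ι ℂ (some b))
  | scalar (z : ℂ) : PolyRel (FreeAlgebra.ι ℂ (some (algebraMap ℂ B z)))
      (algebraMap ℂ (FreeAlgebra ℂ (Option B)) z)

/-- The algebra `B⟨X⟩`. -/
def NCPoly : Type _ := RingQuot (PolyRel B)

instance : Ring (NCPoly B) := inferInstanceAs (Ring (RingQuot (PolyRel B)))

instance : Algebra ℂ (NCPoly B) := inferInstanceAs (Algebra ℂ (RingQuot (PolyRel B)))

variable {B}

namespace NCPoly

/-- The quotient map from the free algebra. -/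
def mk : FreeAlgebra ℂ (Option B) →ₐ[ℂ] NCPoly B := RingQuot.mkAlgHom ℂ (PolyRel B)

/-- The symbol `X`. -/
def X : NCPoly B := mk (FreeAlgebra.ι ℂ none)

/-- The inclusion `B → B⟨X⟩` of the coefficients. -/
def C : B →ₐ[ℂ] NCPoly B :=
  AlgHom.ofLinearMap
    { toFun := fun b => mk (FreeAlgebra.ι ℂ (some b))
      map_add' := fun a b => by
        rw [← map_add]; exact RingQuot.mkAlgHom_rel ℂ (PolyRel.add a b)
      map_smul' := fun z b => by
        have h1 : mk (FreeAlgebra.ι ℂ (some (algebraMap ℂ B z * b)))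
            = mk (FreeAlgebra.ι ℂ (some (algebraMap ℂ B z)) * FreeAlgebra.ι ℂ (some b)) :=
          RingQuot.mkAlgHom_rel ℂ (PolyRel.mul _ b)
        have h2 : mk (FreeAlgebra.ι ℂ (some (algebraMap ℂ B z)))
            = mk (algebraMap ℂ (FreeAlgebra ℂ (Option B)) z) :=
          RingQuot.mkAlgHom_rel ℂ (PolyRel.scalar z)
        rw [Algebra.smul_def, h1, map_mul, h2, AlgHom.commutes, RingHom.id_apply,
          Algebra.smul_def] }
    (by
      have h2 : mk (FreeAlgebra.ι ℂ (some (algebraMap ℂ B 1)))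
          = mk (algebraMap ℂ (FreeAlgebra ℂ (Option B)) 1) :=
        RingQuot.mkAlgHom_rel ℂ (PolyRel.scalar 1)
      simpa using h2)
    (fun a b => by
      have h1 : mk (FreeAlgebra.ι ℂ (some (a * b)))
          = mk (FreeAlgebra.ι ℂ (some a) * FreeAlgebra.ι ℂ (some b)) :=
        RingQuot.mkAlgHom_rel ℂ (PolyRel.mul a b)
      simpa using h1)

/-- The universal property: a unital algebra homomorphism on `B` and an image of `X` determine a
unital algebra homomorphism on `B⟨X⟩`. -/
def lift {A : Type*} [Ring A] [Algebra ℂ A] (f : B →ₐ[ℂ] A) (x : A) : NCPoly B →ₐ[ℂ] A :=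
  RingQuot.liftAlgHom ℂ ⟨FreeAlgebra.lift ℂ (fun o => o.elim x f), by
    intro p q h
    induction h with
    | add a b => simp
    | mul a b => simp
    | scalar z => simp⟩

theorem lift_mk {A : Type*} [Ring A] [Algebra ℂ A] (f : B →ₐ[ℂ] A) (x : A)
    (p : FreeAlgebra ℂ (Option B)) :
    lift f x (mk p) = FreeAlgebra.lift ℂ (fun o => o.elim x f) p :=
  RingQuot.liftAlgHom_mkAlgHom_apply ℂ _ _ p

@[simp] theorem lift_X {A : Type*} [Ring A] [Algebra ℂ A] (f : B →ₐ[ℂ] A) (x : A) :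
    lift f x X = x := by
  simp [X, lift_mk]

@[simp] theorem lift_C {A : Type*} [Ring A] [Algebra ℂ A] (f : B →ₐ[ℂ] A) (x : A) (b : B) :
    lift f x (C b) = f b := by
  change lift f x (mk _) = _
  simp [lift_mk]

theorem mk_surjective : Function.Surjective (mk (B := B)) :=
  RingQuot.mkAlgHom_surjective ℂ (PolyRel B)

/-- Every polynomial is obtained from coefficients and `X` by sums and products. -/
theorem induction {motive : NCPoly B → Prop} (coeff : ∀ b, motive (C b)) (var : motive X)
    (add : ∀ p q, motive p → motive q → motive (p + q))
    (mul : ∀ p q, motive p → motive q → motive (p * q)) (p : NCPoly B) : motive p := by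
  obtain ⟨p, rfl⟩ := mk_surjective p
  induction p with
  | grade0 z =>
    rw [AlgHom.commutes, ← AlgHom.commutes (C (B := B))]
    exact coeff _
  | grade1 o =>
    cases o with
    | none => exact var
    | some b => exact coeff b
  | mul p q hp hq => rw [map_mul]; exact mul _ _ hp hq
  | add p q hp hq => rw [map_add]; exact add _ _ hp hq

/-- The opposite ring of `B⟨X⟩` with the conjugate `ℂ`-algebra structure. It only serves to define
the involution of `B⟨X⟩` by the universal property. -/
def ConjOp (B : Type*) [CStarAlgebra B] : Type _ := (NCPoly B)ᵐᵒᵖ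

instance : Ring (ConjOp B) := inferInstanceAs (Ring (NCPoly B)ᵐᵒᵖ)

instance : Algebra ℂ (ConjOp B) :=
  RingHom.toAlgebra' ((algebraMap ℂ (NCPoly B)ᵐᵒᵖ).comp (starRingEnd ℂ))
    (fun z x => Algebra.commutes (A := (NCPoly B)ᵐᵒᵖ) (starRingEnd ℂ z) x)

/-- The conjugate-linear anti-homomorphism with `b ↦ star b` and `X ↦ X`. -/
def starHom : NCPoly B →ₐ[ℂ] ConjOp B :=
  lift (A := ConjOp B)
    { toFun := fun b => (MulOpposite.op (C (star b)) : (NCPoly B)ᵐᵒᵖ)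
      map_one' := by simp; rfl
      map_mul' := fun a b => by simp; rfl
      map_zero' := by simp; rfl
      map_add' := fun a b => by simp; rfl
      commutes' := fun z => by
        change _ = algebraMap ℂ (NCPoly B)ᵐᵒᵖ (starRingEnd ℂ z)
        rw [← algebraMap_star_comm, AlgHom.commutes]; rfl }
    (MulOpposite.op X : (NCPoly B)ᵐᵒᵖ)

instance : Star (NCPoly B) := ⟨fun p => MulOpposite.unop (α := NCPoly B) (starHom p)⟩

theorem star_def (p : NCPoly B) : star p = MulOpposite.unop (α := NCPoly B) (starHom p) := rfl

theorem star_mul' (p q : NCPoly B) : star (p * q) = star q * star p := by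
  simp only [star_def, map_mul]; rfl

theorem star_add' (p q : NCPoly B) : star (p + q) = star p + star q := by
  simp only [star_def, map_add]; rfl

@[simp] theorem star_C (b : B) : star (C b) = C (star b) :=
  congrArg (MulOpposite.unop (α := NCPoly B)) (lift_C (A := ConjOp B) _ _ b)

@[simp] theorem star_X : star (X : NCPoly B) = X :=
  congrArg (MulOpposite.unop (α := NCPoly B)) (lift_X (A := ConjOp B) _ _)

instance : StarRing (NCPoly B) where
  star_involutive p := by
    induction p using NCPoly.induction with
    | coeff b => simp
    | var => simp
    | add p q hp hq => rw [star_add', star_add', hp, hq]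
    | mul p q hp hq => rw [star_mul', star_mul', hp, hq]
  star_mul := star_mul'
  star_add := star_add'

/-- `mono b c` is the monomial `b X c₀ X c₁ ⋯ X cₙ₋₁`, of degree `n` in `X`. -/
def mono (b : B) {n : ℕ} (c : Fin n → B) : NCPoly B :=
  C b * (List.ofFn fun i => X * C (c i)).prod

end NCPoly

open NCPoly

variable (B) in
/-- `B₀⟨X⟩`: the polynomials with zero constant term, that is, the linear span of the monomials of
positive degree in `X`. -/
def NCPoly₀ : Submodule ℂ (NCPoly B) :=
  Submodule.span ℂ {p | ∃ (n : ℕ) (b : B) (c : Fin n → B), 0 < n ∧ p = mono b c}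

theorem mono_mem {n : ℕ} (hn : 0 < n) (b : B) (c : Fin n → B) : mono b c ∈ NCPoly₀ B :=
  Submodule.subset_span ⟨n, b, c, hn, rfl⟩

/-- A monomial of positive degree, as an element of `B₀⟨X⟩`. -/
def mono₀ (b : B) {n : ℕ} (hn : 0 < n) (c : Fin n → B) : NCPoly₀ B := ⟨mono b c, mono_mem hn b c⟩

/-- `μ : B⟨X⟩ → B` is a `B`-bimodule map which restricts to the identity on `B`. -/
structure IsBimoduleMap (μ : NCPoly B →ₗ[ℂ] B) : Prop where
  map_coeff : ∀ b, μ (C b) = b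
  map_bimod : ∀ (b c : B) (p : NCPoly B), μ (C b * p * C c) = b * μ p * c

/-- `K : B₀⟨X⟩ → B` is a `B`-bimodule map. -/
def IsBimoduleMap₀ (K : NCPoly₀ B →ₗ[ℂ] B) : Prop :=
  ∀ (b c : B) (p q : NCPoly₀ B), (q : NCPoly B) = C b * (p : NCPoly B) * C c → K q = b * K p * c

/-- Complete positivity: for every finite family `P` of polynomials, the matrix with
entries `μ (Pᵢ Pⱼ*)` is a positive element of the C*-algebra of matrices over `B`. -/
def IsCompletelyPositive [PartialOrder B] [StarOrderedRing B] (μ : NCPoly B →ₗ[ℂ] B) : Prop :=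
  ∀ (n : ℕ) (P : Fin n → NCPoly B),
    0 ≤ CStarMatrix.ofMatrix (Matrix.of fun i j : Fin n => μ (P i * star (P j)))

end Poly

/-! ### Non-crossing partitions of `{0, …, n - 1}` -/

section Partitions

/-- No `i < j < k < l` with `i, k` in one block and `j, l` in another block. -/
def IsNonCrossing {n : ℕ} (π : Finpartition (Finset.range n)) : Prop :=
  ∀ i j k l : ℕ, i < j → j < k → k < l → l < n →
    π.part i = π.part k → π.part j = π.part l → π.part i = π.part j

/-- Every block is an interval. -/
def IsIntervalPartition {n : ℕ} (π : Finpartition (Finset.range n)) : Prop :=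
  ∀ i j k : ℕ, i < j → j < k → k < n → π.part i = π.part k → π.part j = π.part i

/-- `U` covers `V`: there are `i, j ∈ U` with `i < v < j` for all `v ∈ V`. This is the strict
partial order `U ≺ V` on the blocks of a non-crossing partition. -/
def Covers (U V : Finset ℕ) : Prop := ∃ i ∈ U, ∃ j ∈ U, ∀ v ∈ V, i < v ∧ v < j

/-- `o(π)`: the number of order-preserving bijections from the poset of blocks of `π` onto a chain
with `|π|` elements. -/
def orderCount {n : ℕ} (π : Finpartition (Finset.range n)) : ℕ :=
  Nat.card {f : π.parts ≃ Fin π.parts.card //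
    ∀ U V : π.parts, Covers (U : Finset ℕ) (V : Finset ℕ) → f U < f V}

open scoped Classical in
/-- `NC(n)`. -/
def ncPartitions (n : ℕ) : Finset (Finpartition (Finset.range n)) :=
  Finset.univ.filter IsNonCrossing

open scoped Classical in
/-- The interval partitions of `{0, …, n - 1}`. -/
def intervalPartitions (n : ℕ) : Finset (Finpartition (Finset.range n)) :=
  Finset.univ.filter IsIntervalPartition

/-- The elements of the block of `l` that lie in `{l, …, r - 1}`. -/
def blockFrom {n : ℕ} (π : Finpartition (Finset.range n)) (l r : ℕ) : Finset ℕ :=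
  (Finset.Ico l r).filter fun v => π.part v = π.part l

theorem blockFrom_card_pos {n : ℕ} (π : Finpartition (Finset.range n)) {l r : ℕ} (h : l < r) :
    0 < (blockFrom π l r).card :=
  Finset.card_pos.2 ⟨l, by simp [blockFrom, h]⟩

/-- The elements of `blockFrom π l r` in increasing order. -/
def blockElem {n : ℕ} (π : Finpartition (Finset.range n)) (l r : ℕ)
    (i : Fin (blockFrom π l r).card) : ℕ :=
  (blockFrom π l r).orderEmbOfFin rfl i

/-- The successor, within `blockFrom π l r`, of its `i`-th element, or `r` if that element is
the last one. -/
def blockNext {n : ℕ} (π : Finpartition (Finset.range n)) (l r : ℕ)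
    (i : Fin (blockFrom π l r).card) : ℕ :=
  if h : (i : ℕ) + 1 < (blockFrom π l r).card then blockElem π l r ⟨i + 1, h⟩ else r

theorem blockElem_mem {n : ℕ} (π : Finpartition (Finset.range n)) (l r : ℕ)
    (i : Fin (blockFrom π l r).card) : l ≤ blockElem π l r i ∧ blockElem π l r i < r := by
  have h := Finset.orderEmbOfFin_mem (blockFrom π l r) rfl i
  exact Finset.mem_Ico.1 (Finset.mem_filter.1 h).1

theorem blockNext_le {n : ℕ} (π : Finpartition (Finset.range n)) (l r : ℕ)
    (i : Fin (blockFrom π l r).card) : blockNext π l r i ≤ r := by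
  unfold blockNext
  split_ifs with h
  · exact (blockElem_mem π l r _).2.le
  · exact le_rfl

end Partitions

/-! ### Moments and cumulants -/

section Cumulants

variable {B : Type*} [CStarAlgebra B]

open NCPoly

/-- `nested K π b l r` is `K_ρ[b_l X b_{l+1} X ⋯ X b_r]`, where `ρ` is the restriction of `π` to
`{l, …, r - 1}` (meant for a non-crossing `π` and an interval that is a union of blocks; the symbol
`X` at position `v` stands between `b_v` and `b_{v+1}`). If `v₀ = l < v₁ < ⋯ < v_{k-1}` is the
block of `l`, then
`K_ρ[b_l X ⋯ X b_r] = K[b_l X c₀ X c₁ ⋯ X c_{k-1}]`, where `c_i` is the value of `K` nested along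
the blocks strictly between `v_i` and `v_{i+1}`, and `c_{k-1}` is its value along the blocks to the
right of `v_{k-1}`. Since `K` is a right `B`-module map, the last
value may equally be written as a factor on the right. -/
def nested (K : NCPoly₀ B →ₗ[ℂ] B) {n : ℕ} (π : Finpartition (Finset.range n)) (b : ℕ → B)
    (l r : ℕ) : B :=
  if h : l < r then
    K (mono₀ (b l) (blockFrom_card_pos π h) fun i =>
      nested K π b (blockElem π l r i + 1) (blockNext π l r i))
  else b l
termination_by r - l
decreasing_by
  have h1 := blockElem_mem π l r i
  have h2 := blockNext_le π l r i
  omega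

/-- `K_π[b₀ X b₁ X ⋯ X bₙ]` for a non-crossing partition `π` of the `n` symbols `X`. -/
def partitioned (K : NCPoly₀ B →ₗ[ℂ] B) {n : ℕ} (π : Finpartition (Finset.range n))
    (b : ℕ → B) : B := nested K π b 0 n

/-- `K` is the monotone cumulant functional of the bimodule map `μ`. -/
structure IsMonotoneCumulant (μ : NCPoly B →ₗ[ℂ] B) (K : NCPoly₀ B →ₗ[ℂ] B) : Prop where
  bimod : IsBimoduleMap μ
  bimod₀ : IsBimoduleMap₀ K
  moment : ∀ (n : ℕ) (b : ℕ → B),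
    μ (mono (b 0) fun i : Fin n => b (i + 1)) =
      ∑ π ∈ ncPartitions n,
        ((orderCount π : ℂ) / (Nat.factorial π.parts.card : ℂ)) • partitioned K π b

/-- `K` is the Boolean cumulant functional of the bimodule map `μ`. -/
structure IsBooleanCumulant (μ : NCPoly B →ₗ[ℂ] B) (K : NCPoly₀ B →ₗ[ℂ] B) : Prop where
  bimod : IsBimoduleMap μ
  bimod₀ : IsBimoduleMap₀ K
  moment : ∀ (n : ℕ) (b : ℕ → B),
    μ (mono (b 0) fun i : Fin n => b (i + 1)) = ∑ π ∈ intervalPartitions n, partitioned K π b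

/-- The cumulants prescribed by `γ` and `σ`: `K[b₀ X b₁] = b₀ γ b₁` and
`K[b₀ X b₁ X ⋯ b_{n-1} X bₙ] = b₀ σ[b₁ X ⋯ X b_{n-1}] bₙ` for `n = m + 2 ≥ 2`. -/
structure HasCumulantPair (γ : B) (σ : NCPoly B →ₗ[ℂ] B) (K : NCPoly₀ B →ₗ[ℂ] B) : Prop where
  first : ∀ b₀ b₁ : B, K (mono₀ b₀ Nat.one_pos fun _ : Fin 1 => b₁) = b₀ * γ * b₁
  higher : ∀ (m : ℕ) (b : ℕ → B),
    K (mono₀ (b 0) (Nat.succ_pos (m + 1)) fun i : Fin (m + 2) => b (i + 1)) =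
      b 0 * σ (mono (b 1) fun i : Fin m => b (i + 2)) * b (m + 2)

/-- `ν` is the map `ν_▷^{γ,σ}`. -/
def IsMonotonePair (γ : B) (σ ν : NCPoly B →ₗ[ℂ] B) : Prop :=
  ∃ K : NCPoly₀ B →ₗ[ℂ] B, IsMonotoneCumulant ν K ∧ HasCumulantPair γ σ K

/-- `ν` is the map `ν_⊎^{γ,σ}`. -/
def IsBooleanPair (γ : B) (σ ν : NCPoly B →ₗ[ℂ] B) : Prop :=
  ∃ K : NCPoly₀ B →ₗ[ℂ] B, IsBooleanCumulant ν K ∧ HasCumulantPair γ σ K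

/-- `ρ` is the monotone convolution power `μ^{▷ η}`, for a linear map `η : B → B`: the monotone
cumulants satisfy `K^ρ[b₀ X b₁ ⋯ X bₙ] = b₀ η(K^μ[X b₁ ⋯ b_{n-1} X]) bₙ` for `n = m + 1 ≥ 1`. -/
def IsMonotonePower (μ : NCPoly B →ₗ[ℂ] B) (η : B →ₗ[ℂ] B) (ρ : NCPoly B →ₗ[ℂ] B) : Prop :=
  ∃ K L : NCPoly₀ B →ₗ[ℂ] B, IsMonotoneCumulant μ K ∧ IsMonotoneCumulant ρ L ∧
    ∀ (m : ℕ) (b : ℕ → B),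
      L (mono₀ (b 0) (Nat.succ_pos m) fun i : Fin (m + 1) => b (i + 1)) =
        b 0 * η (K (mono₀ 1 (Nat.succ_pos m)
          (Fin.snoc (α := fun _ => B) (fun i : Fin m => b (i + 1)) 1))) * b (m + 1)

end Cumulants

end OpValued

end

/-! The algebra of polynomials carries a coassociative coproduct, the free difference quotient
`del`, which cuts a word at one occurrence of X and deletes it. A pair (g, s) gives two operators.
`transfer g s`, written T, sums over all ways to replace disjoint factors of a word by coefficients,
X by g and X a X by s(a). `gen g s`, written D, replaces exactly one factor. Let ε be `eps`, the
evaluation at X = 0. Then ε∘D is the functional with cumulants (g, s), and ε∘T has it as Boolean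
cumulant functional. T is a morphism of the coproduct (`del_transfer`) and D is a coderivation
(`del_gen`). Both T - 1 and D lower the degree, so their power series are finite sums on each
polynomial.

Combinatorics. Scale the pair by t. Then ε∘T^N on a word is the sum over non-crossing π of t^|π| K_π
times the number of labellings of the blocks by N labels that decrease strictly from a block to the
blocks it covers (`nestedSum_eq_transfer_pow`, `eps_transfer_pow_mono`). The label of a block is the
round of T in which it is removed. For N = 1 only interval partitions contribute, which is the
Boolean formula. For t = 1/N and N → ∞ the weight tends to o(π)/|π|! (`tendsto_card_labellings`).
The same operators satisfy T^N = (1 + D/N + O(1/N²))^N, so ε∘T^N tends to ε∘exp D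
(`tendsto_eps_transfer_pow`). Comparing the limits shows that ε∘exp D has the monotone cumulants (g,
s), and gives the stated convergence.

Monotone powers. The logarithm of T is again a coderivation that commutes with coefficients, hence a
generator D' (`exists_gen_transfer`), and T^n = exp(nD'). So ε∘T has the monotone cumulants ε∘D',
and its i-th monotone power is ε∘T^i. The cumulants are unique because D is recovered from ε∘exp D
by induction on the degree (`gen_eq_of_eps_expGen_eq`).

Positivity. In T(pq) either no replaced factor straddles the border, or one does, and then it
contributes s(p₂q₁), where p₂ and q₁ come from the coproducts of p and q (`transfer_mul`). For q =
p* and s completely positive, factoring the matrix of s writes T(P_i P_j*) as a sum of terms R_i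
R_j* (`isSquareSum_transfer`). This property survives composition, ε is a *-homomorphism, and
positivity is closed under limits. -/

open scoped TensorProduct

noncomputable section

namespace OpValued

open NCPoly

/-! ### The free difference quotient -/

section Algebra

variable {B : Type*} [CStarAlgebra B]

namespace NCPoly

/-- Induction on polynomials by left multiplication with coefficients and the symbol. -/
theorem left_induction {motive : NCPoly B → Prop} (one : motive 1)
    (add : ∀ p q, motive p → motive q → motive (p + q))
    (coeff_mul : ∀ b p, motive p → motive (C b * p))
    (X_mul : ∀ p, motive p → motive (X * p)) (p : NCPoly B) : motive p := by
  have h : ∀ p : NCPoly B, ∀ q, motive q → motive (p * q) := by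
    intro p
    induction p using NCPoly.induction with
    | coeff b => exact coeff_mul b
    | var => exact X_mul
    | add p q hp hq => intro r hr; rw [add_mul]; exact add _ _ (hp r hr) (hq r hr)
    | mul p q hp hq => intro r hr; rw [mul_assoc]; exact hp _ (hq r hr)
  simpa using h p 1 one

/-- The linear map determined by its value at `1` and its behaviour under left multiplication. -/
def leftRec {V : Type*} [AddCommGroup V] [Module ℂ V] (β : B →ₐ[ℂ] Module.End ℂ V)
    (ξ : Module.End ℂ V) (v : V) : NCPoly B →ₗ[ℂ] V :=
  (LinearMap.applyₗ v).comp (lift β ξ).toLinearMap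

section leftRec

variable {V : Type*} [AddCommGroup V] [Module ℂ V] (β : B →ₐ[ℂ] Module.End ℂ V)
    (ξ : Module.End ℂ V) (v : V)

@[simp] theorem leftRec_one : leftRec β ξ v 1 = v := by simp [leftRec]

@[simp] theorem leftRec_coeff_mul (b : B) (p : NCPoly B) :
    leftRec β ξ v (C b * p) = β b (leftRec β ξ v p) := by simp [leftRec]

@[simp] theorem leftRec_X_mul (p : NCPoly B) :
    leftRec β ξ v (X * p) = ξ (leftRec β ξ v p) := by simp [leftRec]

end leftRec

/-- Left multiplication by coefficients on a `B⟨X⟩`-module. -/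
def coeffAct (V : Type*) [AddCommGroup V] [Module ℂ V] [Module (NCPoly B) V]
    [IsScalarTower ℂ (NCPoly B) V] : B →ₐ[ℂ] Module.End ℂ V :=
  (Algebra.lsmul ℂ ℂ V).comp C

@[simp] theorem coeffAct_apply {V : Type*} [AddCommGroup V] [Module ℂ V] [Module (NCPoly B) V]
    [IsScalarTower ℂ (NCPoly B) V] (b : B) (v : V) : coeffAct V b v = (C b : NCPoly B) • v := rfl

/-- The free difference quotient together with the identity. -/
def delAux : NCPoly B →ₗ[ℂ] NCPoly B × (NCPoly B ⊗[ℂ] NCPoly B) :=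
  leftRec (coeffAct _)
    (Algebra.lsmul ℂ ℂ (NCPoly B × (NCPoly B ⊗[ℂ] NCPoly B)) (X : NCPoly B) +
      (LinearMap.inr ℂ _ _).comp ((TensorProduct.mk ℂ _ _ 1).comp (LinearMap.fst ℂ _ _))) (1, 0)

/-- The free difference quotient: the derivation `B⟨X⟩ → B⟨X⟩ ⊗ B⟨X⟩` that vanishes on `B` and
sends `X` to `1 ⊗ 1`. -/
def del : NCPoly B →ₗ[ℂ] NCPoly B ⊗[ℂ] NCPoly B := (LinearMap.snd ℂ _ _).comp delAux

theorem delAux_fst (p : NCPoly B) : (delAux p).1 = p := by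
  induction p using left_induction with
  | one => simp [delAux]
  | add p q hp hq => simp [hp, hq]
  | coeff_mul b p hp => rw [delAux] at *; simp [hp]
  | X_mul p hp => rw [delAux] at *; simp [hp]

@[simp] theorem del_one : del (1 : NCPoly B) = 0 := by simp [del, delAux]

@[simp] theorem del_coeff_mul (b : B) (p : NCPoly B) : del (C b * p) = (C b : NCPoly B) • del p := by
  simp [del, delAux]

@[simp] theorem del_X_mul (p : NCPoly B) : del (X * p) = (X : NCPoly B) • del p + (1 : NCPoly B) ⊗ₜ[ℂ] p := by
  have h := delAux_fst p
  rw [delAux] at h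
  simp [del, delAux, h]

@[simp] theorem del_C (b : B) : del (C b) = 0 := by
  simpa using del_coeff_mul b 1

@[simp] theorem del_X : del (X : NCPoly B) = (1 : NCPoly B) ⊗ₜ[ℂ] (1 : NCPoly B) := by
  simpa using del_X_mul (1 : NCPoly B)

/-- The Leibniz rule: the occurrence of X at which a product is cut lies in one of the two factors.
-/
theorem del_mul (p q : NCPoly B) :
    del (p * q) = p • del q + LinearMap.lTensor _ (LinearMap.mulRight ℂ q) (del p) := by
  induction p using left_induction with
  | one => simp
  | add p r hp hq => simp only [add_mul, map_add, hp, hq, add_smul]; abel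
  | coeff_mul b p hp =>
    rw [mul_assoc, del_coeff_mul, hp, del_coeff_mul, smul_add, mul_smul]
    congr 1
    induction del p using TensorProduct.induction_on <;> simp_all [TensorProduct.smul_tmul']
  | X_mul p hp =>
    rw [mul_assoc, del_X_mul, hp, del_X_mul, smul_add, mul_smul, map_add, add_assoc]
    congr 1
    simp only [LinearMap.lTensor_tmul, LinearMap.mulRight_apply]
    congr 1
    induction del p using TensorProduct.induction_on <;> simp_all [TensorProduct.smul_tmul']

/-- Induction on the degree: to treat `X * p` one may use the claim for `p` and for all the right
factors of the free difference quotient of `p`. -/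
theorem strong_induction {motive : NCPoly B → Prop} (one : motive 1)
    (add : ∀ p q, motive p → motive q → motive (p + q))
    (coeff_mul : ∀ b p, motive p → motive (C b * p))
    (X_mul : ∀ p, motive p →
      del p ∈ Submodule.span ℂ {y | ∃ a c, motive c ∧ y = a ⊗ₜ[ℂ] c} → motive (X * p))
    (p : NCPoly B) : motive p := by
  have key : ∀ (a : NCPoly B) (y : NCPoly B ⊗[ℂ] NCPoly B),
      y ∈ Submodule.span ℂ {y | ∃ a c, motive c ∧ y = a ⊗ₜ[ℂ] c} →
      a • y ∈ Submodule.span ℂ {y | ∃ a c, motive c ∧ y = a ⊗ₜ[ℂ] c} := by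
    intro a y hy
    induction hy using Submodule.span_induction with
    | mem y hy =>
      obtain ⟨a', c, hc, rfl⟩ := hy
      exact Submodule.subset_span ⟨a * a', c, hc, by simp [TensorProduct.smul_tmul']⟩
    | zero => simp
    | add y z _ _ hy hz => rw [smul_add]; exact add_mem hy hz
    | smul z y _ hy => rw [smul_comm]; exact Submodule.smul_mem _ _ hy
  suffices h : motive p ∧
      del p ∈ Submodule.span ℂ {y | ∃ a c, motive c ∧ y = a ⊗ₜ[ℂ] c} from h.1
  induction p using left_induction with
  | one => simp [one]
  | add p q hp hq =>
    refine ⟨add _ _ hp.1 hq.1, ?_⟩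
    rw [map_add]
    exact add_mem hp.2 hq.2
  | coeff_mul b p hp =>
    refine ⟨coeff_mul _ _ hp.1, ?_⟩
    rw [del_coeff_mul]
    exact key _ _ hp.2
  | X_mul p hp =>
    refine ⟨X_mul _ hp.1 hp.2, ?_⟩
    rw [del_X_mul]
    exact add_mem (key _ _ hp.2) (Submodule.subset_span ⟨_, _, hp.1, rfl⟩)

/-- Linear maps that agree on the right factors of a tensor agree on the tensor. -/
theorem eq_of_mem_span {V : Type*} [AddCommGroup V] [Module ℂ V] {motive : NCPoly B → Prop}
    {f g : NCPoly B ⊗[ℂ] NCPoly B →ₗ[ℂ] V} (h : ∀ a c, motive c → f (a ⊗ₜ c) = g (a ⊗ₜ c))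
    {y : NCPoly B ⊗[ℂ] NCPoly B}
    (hy : y ∈ Submodule.span ℂ {y | ∃ a c, motive c ∧ y = a ⊗ₜ[ℂ] c}) : f y = g y := by
  induction hy using Submodule.span_induction with
  | mem y hy => obtain ⟨a, c, hc, rfl⟩ := hy; exact h a c hc
  | zero => simp
  | add y z _ _ hy hz => rw [map_add, map_add, hy, hz]
  | smul z y _ hy => rw [map_smul, map_smul, hy]

/-- Both sides mark two occurrences of X in a word; the order in which they are cut does not matter.
-/
theorem coassoc_apply (p : NCPoly B) :
    TensorProduct.assoc ℂ _ _ _ (LinearMap.rTensor _ del (del p)) =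
      LinearMap.lTensor _ del (del p) := by
  have h1 : ∀ (b : NCPoly B) (y : NCPoly B ⊗[ℂ] NCPoly B),
      LinearMap.lTensor _ (del (B := B)) (b • y) = b • LinearMap.lTensor _ del y := by
    intro b y
    induction y using TensorProduct.induction_on <;> simp_all [TensorProduct.smul_tmul']
  have h2 : ∀ (b : NCPoly B) (y : (NCPoly B ⊗[ℂ] NCPoly B) ⊗[ℂ] NCPoly B),
      TensorProduct.assoc ℂ _ _ _ (b • y) = b • TensorProduct.assoc ℂ _ _ _ y := by
    intro b y
    induction y using TensorProduct.induction_on with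
    | zero => simp
    | add x y hx hy => simp_all
    | tmul x c =>
      induction x using TensorProduct.induction_on with
      | zero => simp
      | add x y hx hy => simp_all [TensorProduct.add_tmul, TensorProduct.smul_tmul']
      | tmul x y => simp [TensorProduct.smul_tmul']
  have h3 : ∀ (b : B) (y : NCPoly B ⊗[ℂ] NCPoly B),
      LinearMap.rTensor _ (del (B := B)) (C b • y) = (C b : NCPoly B) • LinearMap.rTensor _ del y := by
    intro b y
    induction y using TensorProduct.induction_on <;> simp_all [TensorProduct.smul_tmul']
  have h4 : ∀ (y : NCPoly B ⊗[ℂ] NCPoly B),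
      TensorProduct.assoc ℂ _ _ _ (LinearMap.rTensor _ (del (B := B)) ((X : NCPoly B) • y)) =
        (X : NCPoly B) • TensorProduct.assoc ℂ _ _ _ (LinearMap.rTensor _ del y) +
          (1 : NCPoly B) ⊗ₜ[ℂ] y := by
    intro y
    induction y using TensorProduct.induction_on with
    | zero => simp
    | add x y hx hy => simp only [smul_add, map_add, hx, hy, TensorProduct.tmul_add]; abel
    | tmul x y => simp [TensorProduct.smul_tmul', TensorProduct.add_tmul, ← h2]
  induction p using left_induction with
  | one => simp
  | add p q hp hq => simp [hp, hq]
  | coeff_mul b p hp => simp only [del_coeff_mul, h1, h2, h3, hp]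
  | X_mul p hp =>
    simp only [del_X_mul, map_add, h4, h1, hp]
    simp

/-- The homomorphism that evaluates a polynomial at `X = 0`. -/
def eps : NCPoly B →ₐ[ℂ] B := lift (AlgHom.id ℂ B) 0

@[simp] theorem eps_C (b : B) : eps (C b) = b := by simp [eps]
@[simp] theorem eps_X : eps (X : NCPoly B) = 0 := by simp [eps]

end NCPoly

end Algebra

section Operators

variable {B : Type*} [CStarAlgebra B]

namespace NCPoly

/-! ### Convolution along the free difference quotient -/

section conv

variable {R : Type*} [Ring R] [Algebra ℂ R]

/-- The convolution of linear maps with respect to the free difference quotient. -/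
def conv (f h : NCPoly B →ₗ[ℂ] R) : NCPoly B →ₗ[ℂ] R :=
  (LinearMap.mul' ℂ R).comp ((TensorProduct.map f h).comp del)

theorem conv_apply (f h : NCPoly B →ₗ[ℂ] R) (p : NCPoly B) :
    conv f h p = LinearMap.mul' ℂ R (TensorProduct.map f h (del p)) := rfl

theorem conv_X_mul (f h : NCPoly B →ₗ[ℂ] R) (p : NCPoly B) :
    conv f h (X * p) = conv (f.comp (LinearMap.mulLeft ℂ X)) h p + f 1 * h p := by
  simp only [conv_apply, del_X_mul, map_add, TensorProduct.map_tmul, LinearMap.mul'_apply]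
  congr 1
  induction del p using TensorProduct.induction_on <;> simp_all [TensorProduct.smul_tmul']

theorem conv_coeff_mul (f h : NCPoly B →ₗ[ℂ] R) (b : B) (p : NCPoly B) :
    conv f h (C b * p) = conv (f.comp (LinearMap.mulLeft ℂ (C b))) h p := by
  simp only [conv_apply, del_coeff_mul]
  induction del p using TensorProduct.induction_on <;> simp_all [TensorProduct.smul_tmul']

@[simp] theorem conv_one (f h : NCPoly B →ₗ[ℂ] R) : conv f h 1 = 0 := by simp [conv_apply]

@[simp] theorem conv_C (f h : NCPoly B →ₗ[ℂ] R) (b : B) : conv f h (C b) = 0 := by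
  simp [conv_apply]

theorem conv_mulLeft (r : R) (f h : NCPoly B →ₗ[ℂ] R) (p : NCPoly B) :
    conv ((LinearMap.mulLeft ℂ r).comp f) h p = r * conv f h p := by
  simp only [conv_apply]
  induction del p using TensorProduct.induction_on <;> simp_all [mul_assoc, mul_add]

theorem conv_mulRight (r : R) (f h : NCPoly B →ₗ[ℂ] R) (p : NCPoly B) :
    conv f ((LinearMap.mulRight ℂ r).comp h) p = conv f h p * r := by
  simp only [conv_apply]
  induction del p using TensorProduct.induction_on <;> simp_all [mul_assoc, add_mul]

theorem conv_mul_C (f h : NCPoly B →ₗ[ℂ] R) (p : NCPoly B) (c : B) :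
    conv f h (p * C c) = conv f (h.comp (LinearMap.mulRight ℂ (C c))) p := by
  simp only [conv_apply, del_mul, del_C, smul_zero, zero_add]
  induction del p using TensorProduct.induction_on <;> simp_all

theorem conv_add_left (f f' h : NCPoly B →ₗ[ℂ] R) (p : NCPoly B) :
    conv (f + f') h p = conv f h p + conv f' h p := by
  simp [conv_apply, TensorProduct.map_add_left]

theorem conv_add_right (f h h' : NCPoly B →ₗ[ℂ] R) (p : NCPoly B) :
    conv f (h + h') p = conv f h p + conv f h' p := by
  simp [conv_apply, TensorProduct.map_add_right]

theorem conv_smul_left (z : ℂ) (f h : NCPoly B →ₗ[ℂ] R) (p : NCPoly B) :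
    conv (z • f) h p = z • conv f h p := by
  simp [conv_apply, TensorProduct.map_smul_left]

/-- This feeds the extra hypothesis of `strong_induction` into a recursion: the right-hand map of a
convolution may be replaced by one that agrees with it on the right factors. -/
theorem conv_congr_right (f : NCPoly B →ₗ[ℂ] R) {h h' : NCPoly B →ₗ[ℂ] R} {p : NCPoly B}
    (hp : del p ∈ Submodule.span ℂ {y | ∃ a c, h c = h' c ∧ y = a ⊗ₜ[ℂ] c}) :
    conv f h p = conv f h' p := by
  refine eq_of_mem_span (motive := fun c => h c = h' c)
    (f := (LinearMap.mul' ℂ R).comp (TensorProduct.map f h))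
    (g := (LinearMap.mul' ℂ R).comp (TensorProduct.map f h')) ?_ hp
  intro a c hc
  simp [hc]

theorem algHom_conv {S : Type*} [Ring S] [Algebra ℂ S] (φ : R →ₐ[ℂ] S)
    (f h : NCPoly B →ₗ[ℂ] R) (p : NCPoly B) :
    φ (conv f h p) = conv (φ.toLinearMap.comp f) (φ.toLinearMap.comp h) p := by
  simp only [conv_apply]
  induction del p using TensorProduct.induction_on <;> simp_all

end conv

/-- A `B`-valued linear map, viewed as a map into `B⟨X⟩`. -/
def toPoly (s : NCPoly B →ₗ[ℂ] B) : NCPoly B →ₗ[ℂ] NCPoly B := (C (B := B)).toLinearMap.comp s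

@[simp] theorem toPoly_apply (s : NCPoly B →ₗ[ℂ] B) (p : NCPoly B) : toPoly s p = C (s p) := rfl

/-- Cut at every X and apply `eps` on the left: only the cut at the first X survives. This splits a
polynomial into its constant term and the part with a first X. -/
theorem eq_eps_add_conv (p : NCPoly B) :
    p = C (eps p) + conv (toPoly eps.toLinearMap) (LinearMap.mulLeft ℂ X) p := by
  induction p using left_induction with
  | one => simp
  | add p q hp hq =>
    nth_rewrite 1 [hp, hq]
    simp only [map_add]; abel
  | coeff_mul b p hp =>
    have : (toPoly (eps (B := B)).toLinearMap).comp (LinearMap.mulLeft ℂ (C b)) =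
        (LinearMap.mulLeft ℂ (C b)).comp (toPoly eps.toLinearMap) := by ext; simp
    rw [conv_coeff_mul, this, conv_mulLeft]
    nth_rewrite 1 [hp]
    simp [mul_add]
  | X_mul p hp =>
    have : (toPoly (eps (B := B)).toLinearMap).comp (LinearMap.mulLeft ℂ X) = 0 := by ext; simp
    rw [conv_X_mul, this]
    simp [conv_apply]

/-- The mirror image: `eps` on the right keeps only the cut at the last X. -/
theorem eq_eps_add_conv' (p : NCPoly B) :
    p = C (eps p) + conv (LinearMap.mulRight ℂ X) (toPoly eps.toLinearMap) p := by
  induction p using left_induction with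
  | one => simp
  | add p q hp hq =>
    nth_rewrite 1 [hp, hq]
    simp only [map_add]; abel
  | coeff_mul b p hp =>
    have : (LinearMap.mulRight ℂ (X : NCPoly B)).comp (LinearMap.mulLeft ℂ (C b)) =
        (LinearMap.mulLeft ℂ (C b)).comp (LinearMap.mulRight ℂ X) := by
      ext; simp [mul_assoc]
    rw [conv_coeff_mul, this, conv_mulLeft]
    nth_rewrite 1 [hp]
    simp [mul_add]
  | X_mul p hp =>
    have : (LinearMap.mulRight ℂ (X : NCPoly B)).comp (LinearMap.mulLeft ℂ X) =
        (LinearMap.mulLeft ℂ X).comp (LinearMap.mulRight ℂ X) := by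
      ext; simp [mul_assoc]
    rw [conv_X_mul, this, conv_mulLeft]
    nth_rewrite 1 [hp]
    simp [mul_add, add_comm]

/-! ### The transfer operator -/

section transfer

variable (g : B) (s : NCPoly B →ₗ[ℂ] B)

/-- The transfer operator together with the right-hand part of its coproduct. -/
def transferAux : NCPoly B →ₗ[ℂ] NCPoly B × (NCPoly B ⊗[ℂ] NCPoly B) :=
  leftRec (coeffAct _)
    (Algebra.lsmul ℂ ℂ (NCPoly B × (NCPoly B ⊗[ℂ] NCPoly B)) (X : NCPoly B) +
      (LinearMap.inl ℂ _ _).comp ((LinearMap.mulLeft ℂ (C g)).comp (LinearMap.fst ℂ _ _)) +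
      (LinearMap.inl ℂ _ _).comp (((LinearMap.mul' ℂ _).comp
        (LinearMap.rTensor _ (toPoly s))).comp (LinearMap.snd ℂ _ _)) +
      (LinearMap.inr ℂ _ _).comp ((TensorProduct.mk ℂ _ _ 1).comp (LinearMap.fst ℂ _ _))) (1, 0)

/-- The transfer operator of the pair `(g, s)`: it replaces disjoint factors of a monomial by their
values under the map with Boolean cumulants `(g, s)`. -/
def transfer : NCPoly B →ₗ[ℂ] NCPoly B := (LinearMap.fst ℂ _ _).comp (transferAux g s)

/-- Left recursion only sees the value already computed, while the recursion of the transfer needs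
its values on all right factors. The second component stores these. -/
theorem transferAux_snd (p : NCPoly B) :
    (transferAux g s p).2 = LinearMap.lTensor _ (transfer g s) (del p) := by
  induction p using left_induction with
  | one => simp [transferAux]
  | add p q hp hq => simp [hp, hq]
  | coeff_mul b p hp =>
    have : (transferAux g s (C b * p)).2 = (C b : NCPoly B) • (transferAux g s p).2 := by
      simp [transferAux]
    rw [this, hp, del_coeff_mul]
    induction del p using TensorProduct.induction_on <;> simp_all [TensorProduct.smul_tmul']
  | X_mul p hp =>
    have : (transferAux g s (X * p)).2 = (X : NCPoly B) • (transferAux g s p).2 +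
        1 ⊗ₜ (transfer g s p) := by
      simp [transfer, transferAux]
    rw [this, hp, del_X_mul, map_add, LinearMap.lTensor_tmul]
    congr 1
    induction del p using TensorProduct.induction_on <;> simp_all [TensorProduct.smul_tmul']

@[simp] theorem transfer_one : transfer g s 1 = 1 := by simp [transfer, transferAux]

@[simp] theorem transfer_coeff_mul (b : B) (p : NCPoly B) :
    transfer g s (C b * p) = C b * transfer g s p := by simp [transfer, transferAux]

/-- The first X survives, or is replaced alone by g, or opens a factor X a X that is replaced by
s(a). -/
theorem transfer_X_mul (p : NCPoly B) :
    transfer g s (X * p) =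
      X * transfer g s p + C g * transfer g s p + conv (toPoly s) (transfer g s) p := by
  have : transfer g s (X * p) = X * transfer g s p + C g * transfer g s p +
      LinearMap.mul' ℂ _ (LinearMap.rTensor _ (toPoly s) (transferAux g s p).2) := by
    simp [transfer, transferAux]
  rw [this, transferAux_snd, conv_apply, ← LinearMap.comp_apply (LinearMap.rTensor _ _),
    LinearMap.rTensor_comp_lTensor]

@[simp] theorem transfer_C (b : B) : transfer g s (C b) = C b := by
  simpa using transfer_coeff_mul g s b 1

@[simp] theorem transfer_X : transfer g s X = X + C g := by
  simpa using transfer_X_mul g s 1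

theorem transfer_mul_C (p : NCPoly B) (c : B) :
    transfer g s (p * C c) = transfer g s p * C c := by
  induction p using strong_induction with
  | one => simp
  | add p q hp hq => simp [add_mul, hp, hq]
  | coeff_mul b p hp => rw [mul_assoc, transfer_coeff_mul, hp, transfer_coeff_mul, mul_assoc]
  | X_mul p hp hd =>
    rw [mul_assoc, transfer_X_mul, transfer_X_mul, hp, add_mul, add_mul, ← conv_mulRight,
      conv_mul_C, mul_assoc, mul_assoc]
    congr 1
    exact conv_congr_right _ hd

/-- A replaced factor never contains a surviving X, so a cut at a surviving X separates the
replacements to its left from those to its right. -/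
theorem del_transfer (p : NCPoly B) :
    del (transfer g s p) = TensorProduct.map (transfer g s) (transfer g s) (del p) := by
  induction p using strong_induction with
  | one => simp
  | add p q hp hq => simp [hp, hq]
  | coeff_mul b p hp =>
    rw [transfer_coeff_mul, del_coeff_mul, hp, del_coeff_mul]
    induction del p using TensorProduct.induction_on <;> simp_all [TensorProduct.smul_tmul']
  | X_mul p hp hd =>
    set T := transfer g s with hT
    -- the map `a ⊗ (c ⊗ d) ↦ s(a) T(c) ⊗ T(d)`
    let Φ : NCPoly B ⊗[ℂ] (NCPoly B ⊗[ℂ] NCPoly B) →ₗ[ℂ] NCPoly B ⊗[ℂ] NCPoly B :=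
      (LinearMap.rTensor _ (LinearMap.mul' ℂ _)).comp
        ((TensorProduct.assoc ℂ _ _ _).symm.toLinearMap.comp
          (TensorProduct.map (toPoly s) (TensorProduct.map T T)))
    have h1 : del (conv (toPoly s) T p) = Φ (LinearMap.lTensor _ del (del p)) := by
      refine eq_of_mem_span (motive := fun c => del (T c) = TensorProduct.map T T (del c))
        (f := del.comp ((LinearMap.mul' ℂ _).comp (TensorProduct.map (toPoly s) T)))
        (g := Φ.comp (LinearMap.lTensor _ del)) ?_ hd
      intro a c hc
      simp only [LinearMap.comp_apply, TensorProduct.map_tmul, LinearMap.mul'_apply, toPoly_apply,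
        del_coeff_mul, hc, LinearMap.lTensor_tmul, Φ]
      induction del c using TensorProduct.induction_on with
      | zero => simp
      | add x y hx hy => simp_all [TensorProduct.tmul_add]
      | tmul x y => simp [TensorProduct.smul_tmul']
    have h2 : ∀ y : NCPoly B ⊗[ℂ] NCPoly B, TensorProduct.map T T ((X : NCPoly B) • y) =
        (X : NCPoly B) • TensorProduct.map T T y + (C g : NCPoly B) • TensorProduct.map T T y +
          Φ (TensorProduct.assoc ℂ _ _ _ (LinearMap.rTensor _ del y)) := by
      intro y
      induction y using TensorProduct.induction_on with
      | zero => simp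
      | add x y hx hy => simp only [smul_add, map_add, hx, hy]; abel
      | tmul x y =>
        simp only [TensorProduct.smul_tmul', smul_eq_mul, TensorProduct.map_tmul,
          LinearMap.rTensor_tmul, hT, transfer_X_mul, TensorProduct.add_tmul, conv_apply]
        congr 1
        simp only [← hT]
        induction del x using TensorProduct.induction_on with
        | zero => simp
        | add x y hx hy => simp_all [TensorProduct.add_tmul]
        | tmul x y => simp [Φ]
    rw [transfer_X_mul, ← hT, map_add, map_add, del_X_mul, del_coeff_mul, h1, hp, del_X_mul,
      map_add, h2, coassoc_apply, TensorProduct.map_tmul, hT, transfer_one]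
    abel

theorem del_transfer_pow (n : ℕ) (p : NCPoly B) :
    del ((transfer g s ^ n) p) =
      TensorProduct.map (transfer g s ^ n) (transfer g s ^ n) (del p) := by
  induction n with
  | zero => simp [Module.End.one_eq_id]
  | succ n ih =>
    rw [pow_succ', Module.End.mul_apply, del_transfer, ih, ← LinearMap.comp_apply,
      ← TensorProduct.map_comp]
    rfl

theorem conv_transfer_pow {R : Type*} [Ring R] [Algebra ℂ R] (f h : NCPoly B →ₗ[ℂ] R) (n : ℕ)
    (p : NCPoly B) : conv f h ((transfer g s ^ n) p) =
      conv (f.comp (transfer g s ^ n)) (h.comp (transfer g s ^ n)) p := by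
  rw [conv_apply, del_transfer_pow, conv_apply, TensorProduct.map_comp]
  rfl

@[simp] theorem transfer_pow_coeff_mul (n : ℕ) (b : B) (p : NCPoly B) :
    (transfer g s ^ n) (C b * p) = C b * (transfer g s ^ n) p := by
  induction n with
  | zero => simp
  | succ n ih => rw [pow_succ', Module.End.mul_apply, ih, transfer_coeff_mul]; rfl

@[simp] theorem transfer_pow_one (n : ℕ) : (transfer g s ^ n) 1 = 1 := by
  induction n with
  | zero => simp
  | succ n ih => rw [pow_succ', Module.End.mul_apply, ih, transfer_one]

@[simp] theorem transfer_pow_C (n : ℕ) (b : B) : (transfer g s ^ n) (C b) = C b := by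
  simpa using transfer_pow_coeff_mul g s n b 1

/-- The index m is the number of rounds after which the first X is removed. By then the inside of
the removed factor has undergone m rounds, while the part to its right undergoes all n. -/
theorem transfer_pow_X_mul (n : ℕ) (p : NCPoly B) :
    (transfer g s ^ n) (X * p) = X * (transfer g s ^ n) p +
      ∑ m ∈ Finset.range n, (C g * (transfer g s ^ n) p +
        conv (toPoly (s.comp (transfer g s ^ m))) (transfer g s ^ n) p) := by
  induction n generalizing p with
  | zero => simp
  | succ n ih =>
    have h1 : ∀ q, (transfer g s ^ (n + 1)) q = (transfer g s ^ n) (transfer g s q) := fun q => by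
      rw [pow_succ, Module.End.mul_apply]
    have h2 : ∀ m, conv (toPoly (s.comp (transfer g s ^ m))) (transfer g s ^ n) (transfer g s p) =
        conv (toPoly (s.comp (transfer g s ^ (m + 1)))) (transfer g s ^ (n + 1)) p := by
      intro m
      have := conv_transfer_pow g s (toPoly (s.comp (transfer g s ^ m))) (transfer g s ^ n) 1 p
      rw [pow_one] at this
      rw [this, pow_succ, pow_succ]
      rfl
    have h3 : (transfer g s ^ n) (conv (toPoly s) (transfer g s) p) =
        conv (toPoly (s.comp (transfer g s ^ 0))) (transfer g s ^ (n + 1)) p := by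
      simp only [conv_apply, pow_zero]
      induction del p using TensorProduct.induction_on with
      | zero => simp
      | add x y hx hy => simp only [map_add, hx, hy]
      | tmul x y => simp [h1]
    -- The round applied first supplies the term m = 0 and shifts the others by one.
    rw [h1 (X * p), transfer_X_mul, map_add, map_add, ih, transfer_pow_coeff_mul, h3,
      Finset.sum_range_succ']
    simp only [h2, ← h1]
    abel

end transfer

/-! ### The generator -/

section gen

variable (g : B) (s : NCPoly B →ₗ[ℂ] B)

/-- The generator together with the identity. -/
def genAux : NCPoly B →ₗ[ℂ] NCPoly B × NCPoly B :=
  leftRec (coeffAct _)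
    (Algebra.lsmul ℂ ℂ (NCPoly B × NCPoly B) (X : NCPoly B) +
      (LinearMap.inr ℂ _ _).comp ((LinearMap.mulLeft ℂ (C g) +
        conv (toPoly s) LinearMap.id).comp (LinearMap.fst ℂ _ _))) (1, 0)

/-- The coderivation of `B⟨X⟩` that replaces one factor of a monomial by its value under the
functional with cumulants `(g, s)`. -/
def gen : NCPoly B →ₗ[ℂ] NCPoly B := (LinearMap.snd ℂ _ _).comp (genAux g s)

theorem genAux_fst (p : NCPoly B) : (genAux g s p).1 = p := by
  induction p using left_induction with
  | one => simp [genAux]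
  | add p q hp hq => simp [hp, hq]
  | coeff_mul b p hp => rw [genAux] at *; simp [hp]
  | X_mul p hp => rw [genAux] at *; simp [hp]

@[simp] theorem gen_one : gen g s 1 = 0 := by simp [gen, genAux]

@[simp] theorem gen_coeff_mul (b : B) (p : NCPoly B) :
    gen g s (C b * p) = C b * gen g s p := by simp [gen, genAux]

theorem gen_X_mul (p : NCPoly B) :
    gen g s (X * p) = X * gen g s p + C g * p + conv (toPoly s) LinearMap.id p := by
  have : gen g s (X * p) = X * gen g s p + (C g * (genAux g s p).1 +
      conv (toPoly s) LinearMap.id (genAux g s p).1) := by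
    simp [gen, genAux]
  rw [this, genAux_fst, add_assoc]

@[simp] theorem gen_C (b : B) : gen g s (C b) = 0 := by
  simpa using gen_coeff_mul g s b 1

theorem gen_mul_C (p : NCPoly B) (c : B) : gen g s (p * C c) = gen g s p * C c := by
  induction p using left_induction with
  | one => simp
  | add p q hp hq => simp [add_mul, hp, hq]
  | coeff_mul b p hp => rw [mul_assoc, gen_coeff_mul, hp, gen_coeff_mul, mul_assoc]
  | X_mul p hp =>
    rw [mul_assoc, gen_X_mul, gen_X_mul, hp, add_mul, add_mul, ← conv_mulRight,
      conv_mul_C, mul_assoc, mul_assoc]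
    rfl

/-- The single replaced factor lies entirely to the left or entirely to the right of the cut. -/
theorem del_gen (p : NCPoly B) :
    del (gen g s p) = LinearMap.rTensor _ (gen g s) (del p) +
      LinearMap.lTensor _ (gen g s) (del p) := by
  induction p using left_induction with
  | one => simp
  | add p q hp hq => simp only [map_add, hp, hq]; abel
  | coeff_mul b p hp =>
    rw [gen_coeff_mul, del_coeff_mul, hp, del_coeff_mul, smul_add]
    congr 1 <;>
    induction del p using TensorProduct.induction_on <;> simp_all [TensorProduct.smul_tmul']
  | X_mul p hp =>
    set D := gen g s with hD
    let Φ : NCPoly B ⊗[ℂ] (NCPoly B ⊗[ℂ] NCPoly B) →ₗ[ℂ] NCPoly B ⊗[ℂ] NCPoly B :=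
      (LinearMap.rTensor _ (LinearMap.mul' ℂ _)).comp
        ((TensorProduct.assoc ℂ _ _ _).symm.toLinearMap.comp
          (LinearMap.rTensor _ (toPoly s)))
    have h1 : del (conv (toPoly s) LinearMap.id p) = Φ (LinearMap.lTensor _ del (del p)) := by
      rw [conv_apply]
      induction del p using TensorProduct.induction_on with
      | zero => simp
      | add x y hx hy => simp_all
      | tmul x y =>
        simp only [TensorProduct.map_tmul, LinearMap.mul'_apply, toPoly_apply, LinearMap.id_apply,
          del_coeff_mul, LinearMap.lTensor_tmul, Φ, LinearMap.comp_apply]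
        induction del y using TensorProduct.induction_on with
        | zero => simp
        | add x y hx hy => simp_all [TensorProduct.tmul_add]
        | tmul x y => simp [TensorProduct.smul_tmul']
    have h2 : ∀ y : NCPoly B ⊗[ℂ] NCPoly B, LinearMap.rTensor _ D ((X : NCPoly B) • y) =
        (X : NCPoly B) • LinearMap.rTensor _ D y + (C g : NCPoly B) • y +
          Φ (TensorProduct.assoc ℂ _ _ _ (LinearMap.rTensor _ del y)) := by
      intro y
      induction y using TensorProduct.induction_on with
      | zero => simp
      | add x y hx hy => simp only [smul_add, map_add, hx, hy]; abel
      | tmul x y =>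
        simp only [TensorProduct.smul_tmul', smul_eq_mul,
          LinearMap.rTensor_tmul, hD, gen_X_mul, TensorProduct.add_tmul, conv_apply]
        congr 1
        induction del x using TensorProduct.induction_on with
        | zero => simp
        | add x y hx hy => simp_all [TensorProduct.add_tmul]
        | tmul x y => simp [Φ]
    have h3 : ∀ y : NCPoly B ⊗[ℂ] NCPoly B, LinearMap.lTensor _ D ((X : NCPoly B) • y) =
        (X : NCPoly B) • LinearMap.lTensor _ D y := by
      intro y
      induction y using TensorProduct.induction_on <;> simp_all [TensorProduct.smul_tmul']
    rw [gen_X_mul, ← hD, map_add, map_add, del_X_mul, del_coeff_mul, h1, hp, del_X_mul,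
      map_add, map_add, h2, h3, coassoc_apply, LinearMap.rTensor_tmul, LinearMap.lTensor_tmul, hD,
      gen_one, TensorProduct.zero_tmul, smul_add]
    abel

/-- Evaluation at X = 0 removes the term in which the first X survives. -/
theorem eps_gen_X_mul (p : NCPoly B) :
    eps (gen g s (X * p)) = g * eps p + conv s eps.toLinearMap p := by
  rw [gen_X_mul, map_add, map_add, algHom_conv]
  have : (eps (B := B)).toLinearMap.comp (toPoly s) = s := by ext; simp
  simp [this]

theorem gen_smul (z : ℂ) : gen (z • g) (z • s) = z • gen g s := by
  ext p
  induction p using left_induction with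
  | one => simp
  | add p q hp hq => simp only [map_add, hp, hq]
  | coeff_mul b p hp => simp_all
  | X_mul p hp =>
    have : toPoly (z • s) = z • toPoly s := by ext; simp
    rw [LinearMap.smul_apply] at hp ⊢
    rw [gen_X_mul, gen_X_mul, hp, this, conv_smul_left, smul_add, smul_add]
    simp

end gen

end NCPoly

end Operators

/-! ### Locally nilpotent operators -/

section LocallyNilpotent

variable {V : Type*} [AddCommGroup V] [Module ℂ V]

theorem pow_apply_eq_zero {N : Module.End ℂ V} {v : V} {d k : ℕ} (h : (N ^ d) v = 0) (hk : d ≤ k) :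
    (N ^ k) v = 0 := by
  obtain ⟨e, rfl⟩ := Nat.exists_eq_add_of_le' hk
  rw [pow_add, Module.End.mul_apply, h, map_zero]

theorem finsum_pow_eq {N : Module.End ℂ V} {v : V} {d : ℕ} (h : (N ^ d) v = 0) (c : ℕ → ℂ) :
    ∑ᶠ k, c k • (N ^ k) v = ∑ k ∈ Finset.range d, c k • (N ^ k) v := by
  refine finsum_eq_sum_of_support_subset _ fun k hk => ?_
  rw [Finset.coe_range, Set.mem_Iio]
  by_contra hd
  exact hk (by simp [pow_apply_eq_zero h (not_lt.1 hd)])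

/-- The value `∑ₖ cₖ Nᵏ` of a power series at a locally nilpotent operator. -/
def powerSum (N : Module.End ℂ V) (hN : ∀ v, ∃ d, (N ^ d) v = 0) (c : ℕ → ℂ) :
    Module.End ℂ V where
  toFun v := ∑ᶠ k, c k • (N ^ k) v
  map_add' v w := by
    obtain ⟨d, hd⟩ := hN v
    obtain ⟨e, he⟩ := hN w
    have hd' := pow_apply_eq_zero hd (le_max_left d e)
    have he' := pow_apply_eq_zero he (le_max_right d e)
    rw [finsum_pow_eq hd', finsum_pow_eq he', finsum_pow_eq (d := max d e) (by simp [hd', he'])]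
    simp [Finset.sum_add_distrib]
  map_smul' z v := by
    obtain ⟨d, hd⟩ := hN v
    rw [finsum_pow_eq hd, finsum_pow_eq (d := d) (by simp [hd])]
    simp [Finset.smul_sum, smul_comm z]

theorem powerSum_apply {N : Module.End ℂ V} (hN : ∀ v, ∃ d, (N ^ d) v = 0) (c : ℕ → ℂ) {v : V}
    {d : ℕ} (h : (N ^ d) v = 0) :
    powerSum N hN c v = ∑ k ∈ Finset.range d, c k • (N ^ k) v :=
  finsum_pow_eq h c

theorem powerSum_comm {N : Module.End ℂ V} (hN : ∀ v, ∃ d, (N ^ d) v = 0) (c : ℕ → ℂ)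
    {R : Module.End ℂ V} (hR : ∀ v, N (R v) = R (N v)) (v : V) :
    powerSum N hN c (R v) = R (powerSum N hN c v) := by
  have hk : ∀ k v, (N ^ k) (R v) = R ((N ^ k) v) := by
    intro k
    induction k with
    | zero => simp
    | succ k ih => intro v; rw [pow_succ, Module.End.mul_apply, hR, ih]; rfl
  obtain ⟨d, hd⟩ := hN v
  rw [powerSum_apply hN c hd, powerSum_apply hN c (d := d) (by rw [hk, hd, map_zero])]
  simp [hk]

/-- The range of summation does not depend on n, so the power is polynomial in n. -/
theorem one_add_pow_apply {N : Module.End ℂ V} {v : V} {d : ℕ} (h : (N ^ d) v = 0) (n : ℕ) :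
    ((1 + N) ^ n) v = ∑ k ∈ Finset.range d, (n.choose k : ℂ) • (N ^ k) v := by
  have h1 : ((1 + N) ^ n) v = ∑ k ∈ Finset.range (n + 1), (n.choose k : ℂ) • (N ^ k) v := by
    rw [add_comm, (Commute.one_right N).add_pow]
    simp [LinearMap.sum_apply, Nat.cast_smul_eq_nsmul]
  rw [h1]
  rcases le_total d (n + 1) with hd | hd
  · symm
    refine Finset.sum_subset (Finset.range_mono hd) fun k _ hk => ?_
    rw [pow_apply_eq_zero h (by simpa using hk), smul_zero]
  · refine Finset.sum_subset (Finset.range_mono hd) fun k _ hk => ?_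
    rw [Nat.choose_eq_zero_of_lt (by simpa using hk), Nat.cast_zero, zero_smul]

end LocallyNilpotent

/-! ### Polynomial dependence on a parameter -/

section PolyFamily

variable {ι : Type*} {x : ι → ℂ} {V W : Type*} [AddCommGroup V] [Module ℂ V] [AddCommGroup W]
  [Module ℂ W]

/-- The family `f` depends polynomially on the parameter `x`, with constant coefficient `v`. -/
inductive PolyFamily (x : ι → ℂ) : (ι → V) → V → Prop
  | const (v : V) : PolyFamily x (fun _ => v) v
  | add {f g : ι → V} {v w : V} : PolyFamily x f v → PolyFamily x g w →
      PolyFamily x (fun i => f i + g i) (v + w)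
  | shift {f : ι → V} {v : V} : PolyFamily x f v → PolyFamily x (fun i => x i • f i) 0

theorem PolyFamily.map {f : ι → V} {v : V} (h : PolyFamily x f v) (φ : V →ₗ[ℂ] W) :
    PolyFamily x (fun i => φ (f i)) (φ v) := by
  induction h with
  | const v => exact .const _
  | add _ _ hf hg => simpa using hf.add hg
  | shift _ hf => simpa using hf.shift

theorem PolyFamily.sum {α : Type*} (s : Finset α) {f : α → ι → V} {v : α → V}
    (h : ∀ a ∈ s, PolyFamily x (f a) (v a)) :
    PolyFamily x (fun i => ∑ a ∈ s, f a i) (∑ a ∈ s, v a) := by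
  classical
  induction s using Finset.induction_on with
  | empty => simpa using PolyFamily.const 0
  | insert a s ha ih =>
    simp only [Finset.sum_insert ha]
    exact (h a (by simp)).add (ih fun b hb => h b (by simp [hb]))

theorem PolyFamily.apply {f : ι → V} {v : V} (h : PolyFamily x f v) {E : ι → V →ₗ[ℂ] W}
    {D : V →ₗ[ℂ] W} (hE : ∀ v, PolyFamily x (fun i => E i v) (D v)) :
    PolyFamily x (fun i => E i (f i)) (D v) := by
  induction h with
  | const v => exact hE v
  | add _ _ hf hg => simpa using hf.add hg
  | shift _ hf => simpa using hf.shift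

theorem PolyFamily.pow_apply {E : ι → Module.End ℂ V} {D : Module.End ℂ V}
    (hE : ∀ v, PolyFamily x (fun i => E i v) (D v)) (k : ℕ) (v : V) :
    PolyFamily x (fun i => (E i ^ k) v) ((D ^ k) v) := by
  induction k generalizing v with
  | zero => simpa using PolyFamily.const v
  | succ k ih =>
    simp only [pow_succ', Module.End.mul_apply]
    exact (ih v).apply hE

theorem PolyFamily.pow_smul (k : ℕ) (v : V) : PolyFamily x (fun i => x i ^ (k + 1) • v) 0 := by
  induction k with
  | zero => simpa using (PolyFamily.const v).shift
  | succ k ih => simpa only [pow_succ' _ (k + 1), mul_smul] using ih.shift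

theorem PolyFamily.exists_polynomial {f : ι → ℂ} {v : ℂ} (h : PolyFamily x f v) :
    ∃ p : Polynomial ℂ, p.coeff 0 = v ∧ ∀ i, f i = p.eval (x i) := by
  induction h with
  | const v => exact ⟨Polynomial.C v, by simp, by simp⟩
  | add _ _ hf hg =>
    obtain ⟨p, hp, hp'⟩ := hf
    obtain ⟨q, hq, hq'⟩ := hg
    exact ⟨p + q, by simp [hp, hq], fun i => by simp [hp', hq']⟩
  | shift _ hf =>
    obtain ⟨p, hp, hp'⟩ := hf
    exact ⟨Polynomial.X * p, by simp, fun i => by simp [hp']⟩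

theorem PolyFamily.tendsto [TopologicalSpace V] [ContinuousAdd V] [ContinuousSMul ℂ V] {f : ι → V}
    {v : V} {l : Filter ι} (h : PolyFamily x f v) (hx : Tendsto x l (𝓝 0)) :
    Tendsto f l (𝓝 v) := by
  induction h with
  | const v => exact tendsto_const_nhds
  | add _ _ hf hg => exact hf.add hg
  | shift _ hf => simpa using hx.smul hf

theorem polynomial_eq_of_forall_nat {p q : Polynomial ℂ} (h : ∀ n : ℕ, p.eval (n : ℂ) = q.eval (n : ℂ)) :
    p = q :=
  Polynomial.eq_of_infinite_eval_eq p q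
    ((Set.infinite_range_of_injective (Nat.cast_injective (R := ℂ))).mono (by
      rintro _ ⟨n, rfl⟩; exact h n))

/-- The functionals are algebraic, so no topology on the space is needed. This reduces identities
between vector-valued polynomial families to scalar polynomials. -/
theorem eq_of_forall_dual {v w : V} (h : ∀ φ : V →ₗ[ℂ] ℂ, φ v = φ w) : v = w := by
  rw [← sub_eq_zero, ← Module.forall_dual_apply_eq_zero_iff ℂ]
  intro φ
  rw [map_sub, h, sub_self]

/-- The linear coefficient of a polynomial family is determined by its values at the naturals. -/
theorem PolyFamily.linear_coeff_unique {f g : ℕ → V} {v w c c' : V}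
    (hf : PolyFamily (fun n : ℕ => (n : ℂ)) f v) (hg : PolyFamily (fun n : ℕ => (n : ℂ)) g w)
    (h : ∀ n : ℕ, c + (n : ℂ) • f n = c' + (n : ℂ) • g n) : v = w := by
  refine eq_of_forall_dual fun φ => ?_
  obtain ⟨p, hp, hp'⟩ := (hf.map φ).exists_polynomial
  obtain ⟨q, hq, hq'⟩ := (hg.map φ).exists_polynomial
  have : Polynomial.C (φ c) + Polynomial.X * p = Polynomial.C (φ c') + Polynomial.X * q := by
    refine polynomial_eq_of_forall_nat fun n => ?_
    simpa [← hp', ← hq'] using congrArg φ (h n)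
  have := congrArg (fun r => Polynomial.coeff r 1) this
  simpa [Polynomial.coeff_C, hp, hq] using this

theorem tendsto_choose_mul_inv_pow_real (k : ℕ) :
    Tendsto (fun n : ℕ => (n.choose k : ℝ) * ((n : ℝ)⁻¹) ^ k) atTop
      (𝓝 ((k.factorial : ℝ)⁻¹)) := by
  have h := (isEquivalent_choose k).mul
    (Asymptotics.IsEquivalent.refl (u := fun n : ℕ => ((n : ℝ)⁻¹) ^ k) (l := atTop))
  refine h.symm.tendsto_nhds (tendsto_const_nhds.congr' ?_)
  filter_upwards [eventually_gt_atTop 0] with n hn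
  have : (n : ℝ) ≠ 0 := by positivity
  rw [Pi.mul_apply, inv_pow]
  field_simp

theorem tendsto_choose_mul_inv_pow (k : ℕ) :
    Tendsto (fun n : ℕ => (n.choose k : ℂ) * ((n : ℂ)⁻¹) ^ k) atTop
      (𝓝 ((k.factorial : ℂ)⁻¹)) := by
  have h := (Complex.continuous_ofReal.tendsto _).comp (tendsto_choose_mul_inv_pow_real k)
  simpa [Function.comp_def] using h

end PolyFamily

/-! ### Logarithms of unipotent operators -/

section Log

variable {V : Type*} [AddCommGroup V] [Module ℂ V]

/-- The coefficients of `n ↦ n.choose k` as a polynomial in `n`. -/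
def chooseCoeff (j k : ℕ) : ℂ := ((k.factorial : ℂ)⁻¹) * (descPochhammer ℂ k).coeff j

theorem choose_eq_sum (n : ℕ) {k d : ℕ} (hk : k < d) :
    (n.choose k : ℂ) = ∑ j ∈ Finset.range d, (n : ℂ) ^ j * chooseCoeff j k := by
  have h : (descPochhammer ℂ k).eval (n : ℂ) = (k.factorial : ℂ) * (n.choose k : ℂ) := by
    rw [descPochhammer_eval_eq_descFactorial, Nat.descFactorial_eq_factorial_mul_choose]
    push_cast; rfl
  have hk' : (k.factorial : ℂ) ≠ 0 := by exact_mod_cast k.factorial_ne_zero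
  have h2 : (descPochhammer ℂ k).natDegree < d := by
    rw [descPochhammer_natDegree]; exact hk
  rw [Polynomial.eval_eq_sum_range' h2] at h
  rw [eq_comm, ← mul_right_inj' hk', ← h, Finset.mul_sum]
  refine Finset.sum_congr rfl fun j _ => ?_
  rw [chooseCoeff]
  field_simp

variable (N : Module.End ℂ V) (hN : ∀ v, ∃ d, (N ^ d) v = 0)

/-- The coefficient of `nʲ` in `(1 + N)ⁿ`. -/
def logCoeff (j : ℕ) : Module.End ℂ V := powerSum N hN (chooseCoeff j)

theorem one_add_pow_eq_sum {v : V} {d : ℕ} (h : (N ^ d) v = 0) (n : ℕ) :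
    ((1 + N) ^ n) v = ∑ j ∈ Finset.range d, (n : ℂ) ^ j • logCoeff N hN j v := by
  simp only [one_add_pow_apply h, logCoeff, powerSum_apply hN _ h, Finset.smul_sum]
  rw [Finset.sum_comm]
  refine Finset.sum_congr rfl fun k hk => ?_
  rw [choose_eq_sum n (Finset.mem_range.1 hk), Finset.sum_smul]
  simp [mul_smul]

theorem logCoeff_zero (v : V) : logCoeff N hN 0 v = v := by
  obtain ⟨d, hd⟩ := hN v
  have h := one_add_pow_eq_sum N hN (pow_apply_eq_zero hd (Nat.le_succ d)) 0
  rw [Finset.sum_range_succ'] at h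
  simpa using h.symm

/-- This is the differential equation of n ↦ (1 + N)ⁿ: expand the law of exponents for m + n and
compare the coefficients of m. Evaluations at natural numbers determine the polynomials involved. -/
theorem logCoeff_succ (j : ℕ) (v : V) :
    ((j : ℂ) + 1) • logCoeff N hN (j + 1) v = logCoeff N hN 1 (logCoeff N hN j v) := by
  obtain ⟨d₀, hd₀⟩ := hN v
  obtain ⟨d, hjd, hd⟩ : ∃ d, j + 1 < d ∧ (N ^ d) v = 0 :=
    -- The bound is enlarged so that the coefficient of index j + 1 lies in the range of summation.
    ⟨d₀ + j + 2, by omega, pow_apply_eq_zero hd₀ (by omega)⟩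
  have hdn : ∀ n : ℕ, (N ^ d) (((1 + N) ^ n) v) = 0 := by
    intro n
    have : Commute (N ^ d) ((1 + N) ^ n) :=
      ((Commute.one_right N).add_right (Commute.refl N)).pow_pow d n
    rw [← Module.End.mul_apply, this.eq, Module.End.mul_apply, hd, map_zero]
  refine eq_of_forall_dual fun φ => ?_
  let p : Polynomial ℂ := ∑ k ∈ Finset.range d, Polynomial.C (φ (logCoeff N hN k v)) *
    Polynomial.X ^ k
  let r : ℕ → Polynomial ℂ := fun n => ∑ k ∈ Finset.range d,
    Polynomial.C (φ (logCoeff N hN k (((1 + N) ^ n) v))) * Polynomial.X ^ k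
  have h1 : ∀ n : ℕ, p.comp (Polynomial.X + Polynomial.C (n : ℂ)) = r n := by
    intro n
    refine polynomial_eq_of_forall_nat fun m => ?_
    have e1 := congrArg φ (one_add_pow_eq_sum N hN hd (m + n))
    have e2 := congrArg φ (one_add_pow_eq_sum N hN (hdn n) m)
    rw [← Module.End.mul_apply, ← pow_add, e1] at e2
    simp only [map_sum, map_smul, smul_eq_mul] at e2
    simp only [p, r, Polynomial.eval_comp, Polynomial.eval_finsetSum, Polynomial.eval_mul,
      Polynomial.eval_C, Polynomial.eval_pow, Polynomial.eval_X, Polynomial.eval_add]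
    push_cast at e2
    simpa [mul_comm] using e2
  let q : Polynomial ℂ := ∑ k ∈ Finset.range d,
    Polynomial.C (φ (logCoeff N hN 1 (logCoeff N hN k v))) * Polynomial.X ^ k
  have h2 : p.derivative = q := by
    refine polynomial_eq_of_forall_nat fun n => ?_
    have e := congrArg (fun t => (Polynomial.derivative t).eval 0) (h1 n)
    simp only [Polynomial.derivative_comp] at e
    have e3 : (Polynomial.derivative (r n)).eval 0 = (r n).coeff 1 := by
      rw [← Polynomial.coeff_zero_eq_eval_zero, Polynomial.coeff_derivative]; simp
    rw [e3] at e
    have e4 : (r n).coeff 1 = φ (logCoeff N hN 1 (((1 + N) ^ n) v)) := by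
      simp only [r, Polynomial.finsetSum_coeff, Polynomial.coeff_C_mul_X_pow]
      rw [Finset.sum_ite_eq, if_pos (Finset.mem_range.2 (by omega))]
    rw [e4, one_add_pow_eq_sum N hN hd n] at e
    simp only [Polynomial.derivative_add, Polynomial.derivative_X, Polynomial.derivative_C, add_zero,
      one_mul, Polynomial.eval_comp, Polynomial.eval_add, Polynomial.eval_X, Polynomial.eval_C,
      zero_add, map_sum, map_smul, smul_eq_mul] at e
    rw [e]
    simp only [q, Polynomial.eval_finsetSum, Polynomial.eval_mul, Polynomial.eval_C,
      Polynomial.eval_pow, Polynomial.eval_X]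
    exact Finset.sum_congr rfl fun _ _ => mul_comm _ _
  have h3 := congrArg (fun t => Polynomial.coeff t j) h2
  have h4 : ∀ (c : ℕ → ℂ) (i : ℕ), i < d →
      (∑ k ∈ Finset.range d, Polynomial.C (c k) * Polynomial.X ^ k).coeff i = c i := by
    intro c i hi
    simp only [Polynomial.finsetSum_coeff, Polynomial.coeff_C_mul_X_pow]
    rw [Finset.sum_ite_eq, if_pos (Finset.mem_range.2 hi)]
  rw [Polynomial.coeff_derivative, h4 _ _ hjd, h4 _ _ (by omega)] at h3
  rw [map_smul, smul_eq_mul, ← h3, mul_comm]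

/-- Hence (1 + N)ⁿ = exp(nL), where L, the linear coefficient, is the logarithm of 1 + N. -/
theorem logCoeff_eq (j : ℕ) (v : V) :
    logCoeff N hN j v = ((j.factorial : ℂ)⁻¹) • (logCoeff N hN 1 ^ j) v := by
  induction j generalizing v with
  | zero => simp [logCoeff_zero]
  | succ j ih =>
    have hj : ((j : ℂ) + 1) ≠ 0 := by exact_mod_cast j.succ_ne_zero
    have := logCoeff_succ N hN j v
    rw [ih, map_smul, ← Module.End.mul_apply, ← pow_succ'] at this
    refine smul_right_injective V hj ?_
    change ((j : ℂ) + 1) • _ = ((j : ℂ) + 1) • _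
    rw [this, smul_smul]
    congr 1
    rw [Nat.factorial_succ]
    push_cast
    field_simp

/-- One factor n is divided out so that the logarithm appears as the constant coefficient, the one
that `PolyFamily` records. -/
theorem polyFamily_one_add_pow (v : V) : ∃ f : ℕ → V,
    PolyFamily (fun n : ℕ => (n : ℂ)) f (logCoeff N hN 1 v) ∧
      ∀ n : ℕ, ((1 + N) ^ n) v = v + (n : ℂ) • f n := by
  obtain ⟨d, hd⟩ := hN v
  refine ⟨fun n => ∑ j ∈ Finset.range (d + 1), (n : ℂ) ^ j • logCoeff N hN (j + 1) v, ?_, ?_⟩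
  · simp only [Finset.sum_range_succ']
    have h := PolyFamily.sum (Finset.range d)
      fun j _ => PolyFamily.pow_smul (x := fun n : ℕ => (n : ℂ)) j (logCoeff N hN (j + 1 + 1) v)
    simpa using h.add (PolyFamily.const _)
  · intro n
    rw [one_add_pow_eq_sum N hN (pow_apply_eq_zero hd (by omega : d ≤ d + 2)) n,
      Finset.sum_range_succ', Finset.smul_sum, logCoeff_zero, pow_zero, one_smul, add_comm]
    simp [pow_succ', mul_smul]

end Log

section Degree

variable {B : Type*} [CStarAlgebra B]

namespace NCPoly

/-! ### The degree filtration -/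

/-- The polynomials of degree less than `d`. -/
def degLT : ℕ → Submodule ℂ (NCPoly B)
  | 0 => ⊥
  | d + 1 => Submodule.span ℂ
      (Set.range (C (B := B)) ∪ {p | ∃ (b : B) (q : NCPoly B), q ∈ degLT d ∧ p = C b * (X * q)})

theorem C_mem_degLT (d : ℕ) (b : B) : C b ∈ degLT (d + 1) :=
  Submodule.subset_span (Or.inl ⟨b, rfl⟩)

theorem one_mem_degLT (d : ℕ) : (1 : NCPoly B) ∈ degLT (d + 1) := by
  simpa using C_mem_degLT d (1 : B)

theorem C_mul_X_mul_mem_degLT {d : ℕ} (b : B) {q : NCPoly B} (hq : q ∈ degLT d) :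
    C b * (X * q) ∈ degLT (d + 1) :=
  Submodule.subset_span (Or.inr ⟨b, q, hq, rfl⟩)

theorem X_mul_mem_degLT {d : ℕ} {q : NCPoly B} (hq : q ∈ degLT d) : X * q ∈ degLT (d + 1) := by
  simpa using C_mul_X_mul_mem_degLT 1 hq

theorem degLT_induction {d : ℕ} {motive : NCPoly B → Prop} (coeff : ∀ b, motive (C b))
    (mul : ∀ b, ∀ q ∈ degLT d, motive (C b * (X * q)))
    (add : ∀ p q, motive p → motive q → motive (p + q)) (smul : ∀ (z : ℂ) p, motive p → motive (z • p))
    {p : NCPoly B} (hp : p ∈ degLT (d + 1)) : motive p := by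
  induction hp using Submodule.span_induction with
  | mem p hp =>
    rcases hp with ⟨b, rfl⟩ | ⟨b, q, hq, rfl⟩
    · exact coeff b
    · exact mul b q hq
  | zero => simpa using coeff 0
  | add p q _ _ hp hq => exact add p q hp hq
  | smul z p _ hp => exact smul z p hp

theorem degLT_le_succ (d : ℕ) : degLT (B := B) d ≤ degLT (d + 1) := by
  induction d with
  | zero => simp [degLT]
  | succ d ih =>
    intro p hp
    refine degLT_induction (fun b => C_mem_degLT _ b)
      (fun b q hq => C_mul_X_mul_mem_degLT b (ih hq)) (fun p q => add_mem)
      (fun z p => Submodule.smul_mem _ z) hp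

theorem degLT_mono {d e : ℕ} (h : d ≤ e) : degLT (B := B) d ≤ degLT e :=
  monotone_nat_of_le_succ degLT_le_succ h

theorem C_mul_mem_degLT {d : ℕ} (b : B) {p : NCPoly B} (hp : p ∈ degLT d) :
    C b * p ∈ degLT d := by
  cases d with
  | zero => simp_all [degLT]
  | succ d =>
    refine degLT_induction (motive := fun p => C b * p ∈ degLT (d + 1)) ?_ ?_ ?_ ?_ hp
    · intro c; rw [← map_mul]; exact C_mem_degLT _ _
    · intro c q hq; rw [← mul_assoc, ← map_mul]; exact C_mul_X_mul_mem_degLT _ hq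
    · intro p q hp hq; rw [mul_add]; exact add_mem hp hq
    · intro z p hp; rw [mul_smul_comm]; exact Submodule.smul_mem _ _ hp

theorem exists_mem_degLT (p : NCPoly B) : ∃ d, p ∈ degLT d := by
  induction p using left_induction with
  | one => exact ⟨1, one_mem_degLT 0⟩
  | add p q hp hq =>
    obtain ⟨d, hd⟩ := hp
    obtain ⟨e, he⟩ := hq
    exact ⟨max d e, add_mem (degLT_mono (le_max_left _ _) hd) (degLT_mono (le_max_right _ _) he)⟩
  | coeff_mul b p hp => exact hp.imp fun d => C_mul_mem_degLT b
  | X_mul p hp =>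
    obtain ⟨d, hd⟩ := hp
    exact ⟨d + 1, X_mul_mem_degLT hd⟩

theorem del_mem_of_mem_degLT {d : ℕ} {p : NCPoly B} (hp : p ∈ degLT (d + 1)) :
    del p ∈ Submodule.span ℂ
      {y | ∃ a c, (a ∈ degLT d ∧ c ∈ degLT d) ∧ y = a ⊗ₜ[ℂ] c} := by
  induction d generalizing p with
  | zero =>
    refine degLT_induction (motive := fun p => del p ∈ Submodule.span ℂ
      {y | ∃ a c, (a ∈ degLT 0 ∧ c ∈ degLT 0) ∧ y = a ⊗ₜ[ℂ] c}) ?_ ?_ ?_ ?_ hp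
    · simp
    · intro b q hq; simp_all [degLT]
    · intro p q hp hq; rw [map_add]; exact add_mem hp hq
    · intro z p hp; rw [map_smul]; exact Submodule.smul_mem _ _ hp
  | succ d ih =>
    refine degLT_induction (motive := fun p => del p ∈ Submodule.span ℂ
      {y | ∃ a c, (a ∈ degLT (d + 1) ∧ c ∈ degLT (d + 1)) ∧ y = a ⊗ₜ[ℂ] c}) ?_ ?_ ?_ ?_ hp
    · simp
    · intro b q hq
      have h1 : ∀ y ∈ Submodule.span ℂ {y | ∃ a c : NCPoly B, (a ∈ degLT d ∧ c ∈ degLT d) ∧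
          y = a ⊗ₜ[ℂ] c}, (C b : NCPoly B) • (X : NCPoly B) • y ∈
          Submodule.span ℂ {y | ∃ a c : NCPoly B, (a ∈ degLT (d + 1) ∧ c ∈ degLT (d + 1)) ∧
            y = a ⊗ₜ[ℂ] c} := by
        intro y hy
        induction hy using Submodule.span_induction with
        | mem y hy =>
          obtain ⟨a, c, ⟨ha, hc⟩, rfl⟩ := hy
          exact Submodule.subset_span ⟨C b * (X * a), c,
            ⟨C_mul_X_mul_mem_degLT _ ha, degLT_le_succ _ hc⟩, by simp [TensorProduct.smul_tmul']⟩
        | zero => simp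
        | add y z _ _ hy hz => rw [smul_add, smul_add]; exact add_mem hy hz
        | smul z y _ hy =>
          rw [smul_comm _ z, smul_comm _ z]; exact Submodule.smul_mem _ _ hy
      rw [del_coeff_mul, del_X_mul, smul_add]
      refine add_mem (h1 _ (ih hq)) (Submodule.subset_span ⟨C b, q, ⟨C_mem_degLT _ _, hq⟩, ?_⟩)
      simp [TensorProduct.smul_tmul']
    · intro p q hp hq; rw [map_add]; exact add_mem hp hq
    · intro z p hp; rw [map_smul]; exact Submodule.smul_mem _ _ hp

theorem del_mem_span_right {d : ℕ} {p : NCPoly B} (hp : p ∈ degLT (d + 1)) :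
    del p ∈ Submodule.span ℂ {y | ∃ a c, c ∈ degLT d ∧ y = a ⊗ₜ[ℂ] c} :=
  Submodule.span_mono (by rintro _ ⟨a, c, h, hy⟩; exact ⟨a, c, h.2, hy⟩) (del_mem_of_mem_degLT hp)

theorem conv_toPoly_mem_degLT (s : NCPoly B →ₗ[ℂ] B) {H : Module.End ℂ (NCPoly B)} {d : ℕ}
    (hH : ∀ p ∈ degLT d, H p ∈ degLT d) {p : NCPoly B} (hp : p ∈ degLT (d + 1)) :
    conv (toPoly s) H p ∈ degLT d := by
  rw [conv_apply]
  have h := del_mem_span_right hp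
  generalize del p = y at h ⊢
  induction h using Submodule.span_induction with
  | mem y hy => obtain ⟨a, c, hc, rfl⟩ := hy; simpa using C_mul_mem_degLT _ (hH _ hc)
  | zero => simp
  | add y z _ _ hy hz => rw [map_add, map_add]; exact add_mem hy hz
  | smul z y _ hy => rw [map_smul, map_smul]; exact Submodule.smul_mem _ _ hy

/-- An operator that lowers the degree. -/
def Lowers (N : Module.End ℂ (NCPoly B)) : Prop := ∀ d, ∀ p ∈ degLT (d + 1), N p ∈ degLT d

theorem Lowers.pow_apply {N : Module.End ℂ (NCPoly B)} (hN : Lowers N) {d : ℕ} {p : NCPoly B}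
    (hp : p ∈ degLT d) : (N ^ d) p = 0 := by
  induction d generalizing p with
  | zero => simpa [degLT] using hp
  | succ d ih => rw [pow_succ, Module.End.mul_apply]; exact ih (hN d p hp)

theorem Lowers.locallyNilpotent {N : Module.End ℂ (NCPoly B)} (hN : Lowers N) (p : NCPoly B) :
    ∃ d, (N ^ d) p = 0 :=
  (exists_mem_degLT p).imp fun _ => hN.pow_apply

theorem Lowers.mem {N : Module.End ℂ (NCPoly B)} (hN : Lowers N) {d : ℕ} {p : NCPoly B}
    (hp : p ∈ degLT d) : N p ∈ degLT d := by
  cases d with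
  | zero => simp_all [degLT]
  | succ d => exact degLT_le_succ d (hN d p hp)

/-- Covers both D, with H the identity, and T - 1, with H = T. The last two terms have lost the
leading X, and `del` loses one more, so an H that keeps the degree suffices. -/
theorem lowers_of_recursion {N H : Module.End ℂ (NCPoly B)} (g : B) (s : NCPoly B →ₗ[ℂ] B)
    (hC : ∀ b, N (C b) = 0) (hb : ∀ b p, N (C b * p) = C b * N p)
    (hX : ∀ p, N (X * p) = X * N p + C g * H p + conv (toPoly s) H p)
    (hH : ∀ d, ∀ p ∈ degLT d, H p ∈ degLT d) : Lowers N := by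
  intro d
  induction d with
  | zero =>
    intro p hp
    refine degLT_induction (motive := fun p => N p ∈ degLT 0) ?_ ?_ ?_ ?_ hp
    · simp [hC]
    · intro b q hq; simp_all [degLT]
    · intro p q hp hq; rw [map_add]; exact add_mem hp hq
    · intro z p hp; rw [map_smul]; exact Submodule.smul_mem _ _ hp
  | succ d ih =>
    intro p hp
    refine degLT_induction (motive := fun p => N p ∈ degLT (d + 1)) ?_ ?_ ?_ ?_ hp
    · simp [hC]
    · intro b q hq
      rw [hb, hX]
      exact C_mul_mem_degLT _ (add_mem (add_mem (X_mul_mem_degLT (ih q hq))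
        (C_mul_mem_degLT _ (hH _ _ hq)))
        (conv_toPoly_mem_degLT s (hH _) (degLT_le_succ _ hq)))
    · intro p q hp hq; rw [map_add]; exact add_mem hp hq
    · intro z p hp; rw [map_smul]; exact Submodule.smul_mem _ _ hp

theorem gen_lowers (g : B) (s : NCPoly B →ₗ[ℂ] B) : Lowers (gen g s) :=
  lowers_of_recursion (H := LinearMap.id) g s (gen_C g s) (gen_coeff_mul g s) (gen_X_mul g s)
    (fun _ _ h => h)

theorem transfer_mem_degLT (g : B) (s : NCPoly B →ₗ[ℂ] B) (d : ℕ) :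
    ∀ p ∈ degLT d, transfer g s p ∈ degLT d := by
  induction d with
  | zero => intro p hp; simp_all [degLT]
  | succ d ih =>
    intro p hp
    refine degLT_induction (motive := fun p => transfer g s p ∈ degLT (d + 1)) ?_ ?_ ?_ ?_ hp
    · simpa using C_mem_degLT d
    · intro b q hq
      rw [transfer_coeff_mul, transfer_X_mul]
      exact C_mul_mem_degLT _ (add_mem (add_mem (X_mul_mem_degLT (ih q hq))
        (degLT_le_succ _ (C_mul_mem_degLT _ (ih q hq))))
        (degLT_le_succ _ (conv_toPoly_mem_degLT s ih (degLT_le_succ _ hq))))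
    · intro p q hp hq; rw [map_add]; exact add_mem hp hq
    · intro z p hp; rw [map_smul]; exact Submodule.smul_mem _ _ hp

theorem transfer_sub_one_lowers (g : B) (s : NCPoly B →ₗ[ℂ] B) : Lowers (transfer g s - 1) := by
  refine lowers_of_recursion (H := transfer g s) g s (by simp) (by simp [mul_sub]) ?_
    (transfer_mem_degLT g s)
  intro p
  simp only [LinearMap.sub_apply, Module.End.one_apply, transfer_X_mul, mul_sub]
  abel

/-! ### The exponential of the generator -/

/-- The exponential of the generator. -/
def expGen (g : B) (s : NCPoly B →ₗ[ℂ] B) : Module.End ℂ (NCPoly B) :=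
  powerSum (gen g s) (gen_lowers g s).locallyNilpotent fun k => (k.factorial : ℂ)⁻¹

theorem expGen_apply (g : B) (s : NCPoly B →ₗ[ℂ] B) {d : ℕ} {p : NCPoly B} (hp : p ∈ degLT d) :
    expGen g s p = ∑ k ∈ Finset.range d, (k.factorial : ℂ)⁻¹ • (gen g s ^ k) p :=
  powerSum_apply _ _ ((gen_lowers g s).pow_apply hp)

theorem expGen_coeff_mul (g : B) (s : NCPoly B →ₗ[ℂ] B) (b : B) (p : NCPoly B) :
    expGen g s (C b * p) = C b * expGen g s p :=
  powerSum_comm (R := LinearMap.mulLeft ℂ (C b)) _ _ (gen_coeff_mul g s b) p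

theorem expGen_mul_C (g : B) (s : NCPoly B →ₗ[ℂ] B) (p : NCPoly B) (c : B) :
    expGen g s (p * C c) = expGen g s p * C c :=
  powerSum_comm (R := LinearMap.mulRight ℂ (C c)) _ _ (fun p => gen_mul_C g s p c) p

theorem expGen_C (g : B) (s : NCPoly B →ₗ[ℂ] B) (b : B) : expGen g s (C b) = C b := by
  rw [expGen_apply g s (C_mem_degLT 0 b)]
  simp

theorem eq_C_eps_of_del_eq_zero {p : NCPoly B} (h : del p = 0) : p = C (eps p) := by
  nth_rewrite 1 [eq_eps_add_conv p]
  simp [conv_apply, h]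

/-- Both legs of the coproduct have smaller degree, so agreement there determines the coproduct of
the values. -/
theorem coderivation_eqOn {D E : Module.End ℂ (NCPoly B)}
    (hD : ∀ p, del (D p) = LinearMap.rTensor _ D (del p) + LinearMap.lTensor _ D (del p))
    (hE : ∀ p, del (E p) = LinearMap.rTensor _ E (del p) + LinearMap.lTensor _ E (del p))
    {d : ℕ} (h : ∀ p ∈ degLT d, D p = E p) {p : NCPoly B} (hp : p ∈ degLT (d + 1)) :
    del (D p) = del (E p) := by
  rw [hD, hE]
  have := del_mem_of_mem_degLT hp
  generalize del p = y at this ⊢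
  induction this using Submodule.span_induction with
  | mem y hy =>
    obtain ⟨a, c, ⟨ha, hc⟩, rfl⟩ := hy
    simp [h a ha, h c hc]
  | zero => simp
  | add y z _ _ hy hz =>
    simp only [map_add]
    rw [add_add_add_comm, hy, hz]; abel
  | smul z y _ hy => simp only [map_smul, ← smul_add, hy]

theorem pow_apply_eq_of_eqOn {N M : Module.End ℂ (NCPoly B)} (hN : Lowers N) {d : ℕ}
    (h : ∀ p ∈ degLT d, N p = M p) (k : ℕ) {p : NCPoly B} (hp : p ∈ degLT d) :
    (N ^ k) p = (M ^ k) p := by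
  induction k generalizing p with
  | zero => simp
  | succ k ih =>
    rw [pow_succ, pow_succ, Module.End.mul_apply, Module.End.mul_apply, ← h p hp, ih (hN.mem hp)]

/-- The generator is determined by the scalar part of its exponential. -/
theorem gen_eq_of_eps_expGen_eq {g g' : B} {s s' : NCPoly B →ₗ[ℂ] B}
    (h : ∀ p, eps (expGen g s p) = eps (expGen g' s' p)) : gen g s = gen g' s' := by
  suffices hd : ∀ d, ∀ p ∈ degLT d, gen g s p = gen g' s' p by
    ext p
    obtain ⟨d, hp⟩ := exists_mem_degLT p
    exact hd d p hp
  intro d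
  induction d with
  | zero => intro p hp; simp_all [degLT]
  | succ d ih =>
    intro p hp
    -- By induction the two values can differ only by an element x of B. Generators kill B, so x
    -- does not affect the higher powers and appears only in the linear term of the exponential.
    have h0 : del (gen g s p - gen g' s' p) = 0 := by
      rw [map_sub, sub_eq_zero]
      exact coderivation_eqOn (del_gen g s) (del_gen g' s') ih hp
    have hx := eq_C_eps_of_del_eq_zero h0
    set x := gen g s p - gen g' s' p with hxdef
    have hpow : ∀ k, (gen g s ^ (k + 2)) p = (gen g' s' ^ (k + 2)) p := by
      intro k
      have e : gen g s p = gen g' s' p + x := by rw [hxdef]; abel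
      rw [pow_succ, Module.End.mul_apply, e, map_add, pow_succ _ (k + 1), Module.End.mul_apply,
        pow_apply_eq_of_eqOn (gen_lowers g s) ih _ (gen_lowers g' s' d p hp)]
      have : (gen g s ^ (k + 1)) x = 0 := by
        rw [hx, pow_succ, Module.End.mul_apply, gen_C, map_zero]
      rw [this, add_zero]
    -- One extra term is allowed in the sums so that the terms of index 0 and 1 can always be split
    -- off.
    have hp2 := degLT_le_succ _ hp
    have e := h p
    rw [expGen_apply g s hp2, expGen_apply g' s' hp2, Finset.sum_range_succ',
      Finset.sum_range_succ', Finset.sum_range_succ', Finset.sum_range_succ'] at e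
    simp only [hpow, map_add, zero_add, pow_zero, pow_one, Module.End.one_apply] at e
    have e2 : eps x = 0 := by
      rw [hxdef, map_sub, sub_eq_zero]
      simpa using e
    rw [← sub_eq_zero, ← hxdef, hx, e2, map_zero]

/-! ### Transfer operators with small cumulants -/

section Expansion

variable {ι : Type*} {x : ι → ℂ} (hx : ∀ i, x i ≠ 0) (g : B) (s : NCPoly B →ₗ[ℂ] B)
include hx

/-- With T = 1 + xE, the recursion of T becomes E(Xp) = X E(p) + g T(p) + conv(s, T)(p). At x = 0
this is the recursion of the generator. -/
theorem polyFamily_transfer_sub_one (p : NCPoly B) :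
    PolyFamily x (fun i => ((x i)⁻¹ • (transfer (x i • g) (x i • s) - 1)) p) (gen g s p) := by
  have hT : ∀ i p, transfer (x i • g) (x i • s) p =
      p + x i • ((x i)⁻¹ • (transfer (x i • g) (x i • s) - 1)) p := by
    intro i p
    rw [LinearMap.smul_apply, smul_smul, mul_inv_cancel₀ (hx i)]
    simp
  induction p using strong_induction with
  | one => simpa using PolyFamily.const 0
  | add p q hp hq => simpa only [map_add] using hp.add hq
  | coeff_mul b p hp =>
    have h := hp.map (LinearMap.mulLeft ℂ (C b))
    simpa [mul_sub] using h
  | X_mul p hp hd =>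
    have h1 : PolyFamily x (fun i => transfer (x i • g) (x i • s) p) p := by
      simp only [hT]
      simpa using (PolyFamily.const p).add hp.shift
    have h2 : PolyFamily x (fun i => conv (toPoly s) (transfer (x i • g) (x i • s)) p)
        (conv (toPoly s) LinearMap.id p) := by
      simp only [conv_apply]
      generalize del p = y at hd ⊢
      induction hd using Submodule.span_induction with
      | mem y hy =>
        obtain ⟨a, c, hc, rfl⟩ := hy
        have : PolyFamily x (fun i => transfer (x i • g) (x i • s) c) c := by
          simp only [hT]
          simpa using (PolyFamily.const c).add hc.shift
        simpa using this.map (LinearMap.mulLeft ℂ (C (s a)))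
      | zero => simpa using PolyFamily.const 0
      | add y z _ _ hy hz => simpa only [map_add] using hy.add hz
      | smul z y _ hy =>
        simp only [map_smul]
        exact hy.map (z • LinearMap.id)
    have h3 := ((hp.map (LinearMap.mulLeft ℂ X)).add (h1.map (LinearMap.mulLeft ℂ (C g)))).add h2
    simp only [LinearMap.mulLeft_apply] at h3
    rw [gen_X_mul]
    convert h3 using 2 with i
    have e1 : toPoly (x i • s) = x i • toPoly s := by ext; simp
    rw [LinearMap.smul_apply, LinearMap.sub_apply, transfer_X_mul, Module.End.one_apply, e1,
      conv_smul_left, map_smul, smul_mul_assoc, LinearMap.smul_apply, mul_smul_comm, smul_sub,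
      smul_add, smul_add, smul_smul, smul_smul, inv_mul_cancel₀ (hx i), one_smul, one_smul,
      LinearMap.sub_apply, Module.End.one_apply, mul_sub, smul_sub]
    abel

end Expansion

/-- The formula (1 + x/n)ⁿ → exp x, term by term in a binomial sum of fixed length. `eps` is applied
because the limit is taken in B; the polynomials carry no topology. -/
theorem tendsto_eps_transfer_pow (g : B) (s : NCPoly B →ₗ[ℂ] B) (p : NCPoly B) :
    Tendsto (fun n : ℕ => eps ((transfer ((n : ℂ)⁻¹ • g) ((n : ℂ)⁻¹ • s) ^ n) p)) atTop
      (𝓝 (eps (expGen g s p))) := by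
  -- The shift avoids n = 0, where the inverse is 0 and one cannot divide by it.
  rw [← tendsto_add_atTop_iff_nat 1]
  obtain ⟨d, hp⟩ := exists_mem_degLT p
  let x : ℕ → ℂ := fun n => ((n + 1 : ℕ) : ℂ)⁻¹
  have hx : ∀ n, x n ≠ 0 := fun n => inv_ne_zero (by exact_mod_cast n.succ_ne_zero)
  have hx0 : Tendsto x atTop (𝓝 0) :=
    (tendsto_add_atTop_iff_nat 1).2 (tendsto_inv_atTop_nhds_zero_nat (𝕜 := ℂ))
  let E : ℕ → Module.End ℂ (NCPoly B) := fun n =>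
    (x n)⁻¹ • (transfer (x n • g) (x n • s) - 1)
  have hE : ∀ p, PolyFamily x (fun n => E n p) (gen g s p) :=
    polyFamily_transfer_sub_one hx g s
  have h1 : ∀ n : ℕ, eps ((transfer (x n • g) (x n • s) ^ (n + 1)) p) =
      ∑ k ∈ Finset.range d, (((n + 1).choose k : ℂ) * x n ^ k) • eps ((E n ^ k) p) := by
    intro n
    have e : transfer (x n • g) (x n • s) = 1 + (transfer (x n • g) (x n • s) - 1) := by abel
    have e2 : transfer (x n • g) (x n • s) - 1 = x n • E n := by
      simp only [E, smul_smul, mul_inv_cancel₀ (hx n), one_smul]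
    rw [e, one_add_pow_apply ((transfer_sub_one_lowers _ _).pow_apply hp), map_sum]
    refine Finset.sum_congr rfl fun k _ => ?_
    rw [e2, smul_pow, LinearMap.smul_apply, smul_smul, map_smul]
  have h2 : eps (expGen g s p) =
      ∑ k ∈ Finset.range d, ((k.factorial : ℂ)⁻¹) • eps ((gen g s ^ k) p) := by
    rw [expGen_apply g s hp, map_sum]
    simp
  change Tendsto (fun n => eps ((transfer (x n • g) (x n • s) ^ (n + 1)) p)) _ _
  rw [h2]
  simp only [h1]
  refine tendsto_finsetSum _ fun k _ => Tendsto.smul ?_ ?_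
  · exact (tendsto_add_atTop_iff_nat 1).2 (tendsto_choose_mul_inv_pow k)
  · exact ((PolyFamily.pow_apply hE k p).map eps.toLinearMap).tendsto hx0

/-! ### Logarithms of transfer operators -/

/-- Coderivations are determined by their scalar parts. -/
theorem coderivation_ext {D E : Module.End ℂ (NCPoly B)}
    (hD : ∀ p, del (D p) = LinearMap.rTensor _ D (del p) + LinearMap.lTensor _ D (del p))
    (hE : ∀ p, del (E p) = LinearMap.rTensor _ E (del p) + LinearMap.lTensor _ E (del p))
    (h : ∀ p, eps (D p) = eps (E p)) : D = E := by
  suffices hd : ∀ d, ∀ p ∈ degLT d, D p = E p by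
    ext p
    obtain ⟨d, hp⟩ := exists_mem_degLT p
    exact hd d p hp
  intro d
  induction d with
  | zero => intro p hp; simp_all [degLT]
  | succ d ih =>
    intro p hp
    have h0 := coderivation_eqOn hD hE ih hp
    rw [eq_eps_add_conv (D p), eq_eps_add_conv (E p), conv_apply, conv_apply, h0, h]

/-- Coderivations are determined by their scalar parts. Cutting p at its last X and using linearity
over B reduces the scalar part on Xp to the values at X and at X a X. -/
theorem eq_gen_of_coderivation {L : Module.End ℂ (NCPoly B)} (hC : ∀ b, L (C b) = 0)
    (hl : ∀ b p, L (C b * p) = C b * L p) (hr : ∀ p c, L (p * C c) = L p * C c)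
    (hL : ∀ p, del (L p) = LinearMap.rTensor _ L (del p) + LinearMap.lTensor _ L (del p)) :
    L = gen (eps (L X)) (eps.toLinearMap.comp
      (L.comp ((LinearMap.mulLeft ℂ X).comp (LinearMap.mulRight ℂ X)))) := by
  refine coderivation_ext hL (del_gen _ _) fun p => ?_
  induction p using left_induction with
  | one =>
    have := hC 1
    rw [map_one] at this
    simp [this]
  | add p q hp hq => simp only [map_add, hp, hq]
  | coeff_mul b p hp => simp only [hl, gen_coeff_mul, map_mul, hp]
  | X_mul p hp =>
    rw [eps_gen_X_mul]
    nth_rewrite 1 [eq_eps_add_conv' p]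
    rw [mul_add, map_add, map_add, hr, map_mul, eps_C]
    congr 1
    simp only [conv_apply]
    induction del p using TensorProduct.induction_on with
    | zero => simp
    | add x y hx hy => simp only [map_add, mul_add, hx, hy]
    | tmul a c => simp [← mul_assoc, hr]

/-- The logarithm of a coproduct morphism is a coderivation: take the coefficient of n in the
identity saying that Tⁿ is such a morphism. -/
theorem exists_gen_transfer (g : B) (s : NCPoly B →ₗ[ℂ] B) :
    ∃ (g' : B) (s' : NCPoly B →ₗ[ℂ] B), ∀ (n : ℕ) (p : NCPoly B),
      (transfer g s ^ n) p = expGen ((n : ℂ) • g') ((n : ℂ) • s') p := by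
  set N : Module.End ℂ (NCPoly B) := transfer g s - 1 with hNdef
  have hlow : Lowers N := transfer_sub_one_lowers g s
  have hN := hlow.locallyNilpotent
  have hT : transfer g s = 1 + N := by rw [hNdef]; abel
  set L := logCoeff N hN 1 with hLdef
  have hC : ∀ b, L (C b) = 0 := by
    intro b
    rw [hLdef, logCoeff, powerSum_apply hN _ (d := 1) (by simp [hNdef])]
    simp [chooseCoeff, Polynomial.coeff_one]
  have hl : ∀ b p, L (C b * p) = C b * L p := fun b p =>
    powerSum_comm (R := LinearMap.mulLeft ℂ (C b)) hN _ (fun p => by simp [hNdef, mul_sub]) p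
  have hr : ∀ p c, L (p * C c) = L p * C c := fun p c =>
    powerSum_comm (R := LinearMap.mulRight ℂ (C c)) hN _
      (fun p => by simp [hNdef, transfer_mul_C, sub_mul]) p
  have hL : ∀ p, del (L p) = LinearMap.rTensor _ L (del p) + LinearMap.lTensor _ L (del p) := by
    intro p
    obtain ⟨f, hf, hf'⟩ := polyFamily_one_add_pow N hN p
    have key : ∀ y : NCPoly B ⊗[ℂ] NCPoly B, ∃ F : ℕ → NCPoly B ⊗[ℂ] NCPoly B,
        PolyFamily (fun n : ℕ => (n : ℂ)) F
          (LinearMap.rTensor _ L y + LinearMap.lTensor _ L y) ∧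
        ∀ n : ℕ, TensorProduct.map (transfer g s ^ n) (transfer g s ^ n) y =
          y + (n : ℂ) • F n := by
      intro y
      induction y using TensorProduct.induction_on with
      | zero => exact ⟨fun _ => 0, by simpa using PolyFamily.const 0, by simp⟩
      | add y z hy hz =>
        obtain ⟨F, hF, hF'⟩ := hy
        obtain ⟨G, hG, hG'⟩ := hz
        refine ⟨fun n => F n + G n, ?_, fun n => ?_⟩
        · simp only [map_add]
          rw [add_add_add_comm]
          exact hF.add hG
        · rw [map_add, hF', hG', smul_add]; abel
      | tmul a c =>
        obtain ⟨F, hF, hF'⟩ := polyFamily_one_add_pow N hN a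
        obtain ⟨G, hG, hG'⟩ := polyFamily_one_add_pow N hN c
        -- Expansion of (a + nF) ⊗ (c + nG) with a ⊗ c subtracted and one factor n divided out.
        refine ⟨fun n => F n ⊗ₜ c + a ⊗ₜ G n + (n : ℂ) • (F n ⊗ₜ G n), ?_, fun n => ?_⟩
        · have h1 := hF.map ((TensorProduct.mk ℂ (NCPoly B) (NCPoly B)).flip c)
          have h2 := hG.map (TensorProduct.mk ℂ (NCPoly B) (NCPoly B) a)
          have h3 := hF.apply (E := fun n => (TensorProduct.mk ℂ (NCPoly B) (NCPoly B)).flip (G n))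
            (D := (TensorProduct.mk ℂ (NCPoly B) (NCPoly B)).flip (L c))
            (fun v => hG.map (TensorProduct.mk ℂ (NCPoly B) (NCPoly B) v))
          simpa using (h1.add h2).add h3.shift
        · rw [TensorProduct.map_tmul, hT, hF', hG']
          simp only [TensorProduct.add_tmul, TensorProduct.tmul_add, TensorProduct.smul_tmul',
            TensorProduct.tmul_smul, smul_add]
          abel
    obtain ⟨F, hF, hF'⟩ := key (del p)
    refine PolyFamily.linear_coeff_unique (hf.map del) hF (c := del p) (c' := del p) fun n => ?_
    rw [← hF', ← del_transfer_pow, hT, hf', map_add, map_smul]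
  refine ⟨eps (L X), eps.toLinearMap.comp
      (L.comp ((LinearMap.mulLeft ℂ X).comp (LinearMap.mulRight ℂ X))), fun n p => ?_⟩
  obtain ⟨d, hp⟩ := exists_mem_degLT p
  rw [expGen_apply _ _ hp, gen_smul, ← eq_gen_of_coderivation hC hl hr hL, hT,
    one_add_pow_eq_sum N hN (hlow.pow_apply hp)]
  refine Finset.sum_congr rfl fun k _ => ?_
  rw [logCoeff_eq, smul_pow, LinearMap.smul_apply, smul_comm]

end NCPoly

end Degree

/-! ### Transfer of products -/

section Positivity

variable {B : Type*} [CStarAlgebra B]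

namespace NCPoly

theorem conv_assoc {R : Type*} [Ring R] [Algebra ℂ R] (f g h : NCPoly B →ₗ[ℂ] R) (p : NCPoly B) :
    conv f (conv g h) p = conv (conv f g) h p := by
  let Φ : NCPoly B ⊗[ℂ] (NCPoly B ⊗[ℂ] NCPoly B) →ₗ[ℂ] R :=
    (LinearMap.mul' ℂ R).comp (TensorProduct.map f
      ((LinearMap.mul' ℂ R).comp (TensorProduct.map g h)))
  have h1 : conv f (conv g h) p = Φ (LinearMap.lTensor _ del (del p)) := by
    rw [conv_apply]
    induction del p using TensorProduct.induction_on with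
    | zero => simp
    | add x y hx hy => simp only [map_add, hx, hy]
    | tmul a c => simp [Φ, conv_apply]
  have h2 : ∀ y, LinearMap.mul' ℂ R (TensorProduct.map (conv f g) h y) =
      Φ (TensorProduct.assoc ℂ _ _ _ (LinearMap.rTensor _ del y)) := by
    intro y
    induction y using TensorProduct.induction_on with
    | zero => simp
    | add x y hx hy => simp only [map_add, hx, hy]
    | tmul a c =>
      simp only [TensorProduct.map_tmul, conv_apply, LinearMap.mul'_apply, LinearMap.rTensor_tmul]
      induction del a using TensorProduct.induction_on with
      | zero => simp
      | add x y hx hy => simp only [map_add, add_mul, TensorProduct.add_tmul, hx, hy]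
      | tmul a b => simp [Φ, mul_assoc]
  rw [h1, conv_apply, h2, coassoc_apply]

/-- The contribution to the transfer of `p * q` of the factors that begin in `p` and end in `q`,
after the part in `p` to the left of such a factor has been split off. -/
def transferJoin (g : B) (s : NCPoly B →ₗ[ℂ] B) (q : NCPoly B) : NCPoly B →ₗ[ℂ] NCPoly B :=
  ((LinearMap.mul' ℂ _).comp (TensorProduct.map (toPoly s) (transfer g s))).comp
    ((LinearMap.toSpanSingleton (NCPoly B) (NCPoly B ⊗[ℂ] NCPoly B) (del q)).restrictScalars ℂ)

theorem transferJoin_apply (g : B) (s : NCPoly B →ₗ[ℂ] B) (q p : NCPoly B) :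
    transferJoin g s q p =
      LinearMap.mul' ℂ _ (TensorProduct.map (toPoly s) (transfer g s) (p • del q)) := rfl

/-- At most one replaced factor straddles the border between p and q. If it starts at an X of p and
ends at an X of q, cutting there leaves T on the outer parts and s on what lies between. -/
theorem transfer_mul (g : B) (s : NCPoly B →ₗ[ℂ] B) (p q : NCPoly B) :
    transfer g s (p * q) =
      transfer g s p * transfer g s q + conv (transfer g s) (transferJoin g s q) p := by
  set T := transfer g s with hT
  set Ψ := transferJoin g s q with hΨ
  induction p using strong_induction with
  | one => simp [hT]
  | add p r hp hr => simp only [add_mul, map_add, hp, hr]; abel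
  | coeff_mul b p hp =>
    have : T.comp (LinearMap.mulLeft ℂ (C b)) = (LinearMap.mulLeft ℂ (C b)).comp T := by
      ext; simp [hT]
    rw [conv_coeff_mul, this, conv_mulLeft, mul_assoc, hT, transfer_coeff_mul, ← hT, hp, hT,
      transfer_coeff_mul, mul_add, mul_assoc]
  | X_mul p hp hd =>
    have h1 : conv (toPoly s) T (p * q) = Ψ p + (conv (toPoly s) T p * T q +
        conv (toPoly s) (conv T Ψ) p) := by
      have e1 : conv (toPoly s) T (p * q) =
          Ψ p + conv (toPoly s) (T.comp (LinearMap.mulRight ℂ q)) p := by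
        rw [conv_apply, del_mul, map_add, map_add]
        congr 1
        rw [conv_apply]
        induction del p using TensorProduct.induction_on with
        | zero => simp
        | add x y hx hy => simp only [map_add, hx, hy]
        | tmul a c => simp
      rw [e1, ← conv_mulRight, ← conv_add_right]
      congr 1
      exact conv_congr_right _ hd
    have h2 : T.comp (LinearMap.mulLeft ℂ X) = (LinearMap.mulLeft ℂ X).comp T +
        (LinearMap.mulLeft ℂ (C g)).comp T + conv (toPoly s) T := by
      ext r; simp [hT, transfer_X_mul]
    rw [mul_assoc, hT, transfer_X_mul, transfer_X_mul, ← hT, hp, h1, conv_X_mul, h2,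
      conv_add_left, conv_add_left, conv_mulLeft, conv_mulLeft, ← conv_assoc, hT, transfer_one,
      ← hT]
    simp only [mul_add, add_mul, mul_assoc, one_mul]
    abel

/-! ### Involutions -/

theorem star_smul' (z : ℂ) (p : NCPoly B) : star (z • p) = (starRingEnd ℂ z) • star p := by
  have h : z • p = C (algebraMap ℂ B z) * p := by
    rw [AlgHom.commutes, ← Algebra.smul_def]
  rw [h, star_mul', star_C, ← algebraMap_star_comm, AlgHom.commutes, ← Algebra.commutes,
    ← Algebra.smul_def]
  rfl

theorem eps_star (p : NCPoly B) : eps (star p) = star (eps p) := by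
  induction p using NCPoly.induction with
  | coeff b => simp
  | var => simp
  | add p q hp hq => simp [hp, hq]
  | mul p q hp hq => simp [hp, hq]

/-- The involution reverses words and so exchanges the two legs of a cut. An explicit list of legs
avoids a conjugate-linear flip on the tensor product. -/
theorem exists_del_eq_sum (p : NCPoly B) : ∃ L : List (NCPoly B × NCPoly B),
    del p = (L.map fun x => x.1 ⊗ₜ[ℂ] x.2).sum ∧
      del (star p) = (L.map fun x => star x.2 ⊗ₜ[ℂ] star x.1).sum := by
  induction p using NCPoly.induction with
  | coeff b => exact ⟨[], by simp, by simp⟩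
  | var => exact ⟨[(1, 1)], by simp, by simp⟩
  | add p q hp hq =>
    obtain ⟨L, h1, h2⟩ := hp
    obtain ⟨M, h3, h4⟩ := hq
    exact ⟨L ++ M, by simp [h1, h3], by simp [h2, h4]⟩
  | mul p q hp hq =>
    obtain ⟨L, h1, h2⟩ := hp
    obtain ⟨M, h3, h4⟩ := hq
    refine ⟨M.map (fun x => (p * x.1, x.2)) ++ L.map (fun x => (x.1, x.2 * q)), ?_, ?_⟩
    · rw [del_mul, h1, h3]
      simp [List.smul_sum, map_list_sum, Function.comp_def, TensorProduct.smul_tmul']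
    · rw [star_mul, del_mul, h2, h4]
      simp [List.smul_sum, map_list_sum, Function.comp_def, TensorProduct.smul_tmul', add_comm]

/-- The linear map `p ↦ (f p*)*`. -/
def conjMap (f : NCPoly B →ₗ[ℂ] NCPoly B) : NCPoly B →ₗ[ℂ] NCPoly B where
  toFun p := star (f (star p))
  map_add' p q := by simp
  map_smul' z p := by simp [star_smul']

/-- T is defined by peeling words from the left, so its conjugate peels from the right.
`transfer_mul` with second factor X gives the recursion from the right, and the two recursions
agree. -/
theorem transfer_star {g : B} {s : NCPoly B →ₗ[ℂ] B} (hg : star g = g)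
    (hs : ∀ p, s (star p) = star (s p)) (p : NCPoly B) :
    transfer g s (star p) = star (transfer g s p) := by
  set T := transfer g s with hT
  suffices h : ∀ p, conjMap T p = T p by
    rw [← h p]; simp [conjMap]
  intro p
  induction p using strong_induction with
  | one => simp [conjMap, hT]
  | add p q hp hq => simp only [map_add, hp, hq]
  | coeff_mul b p hp =>
    have : conjMap T (C b * p) = C b * conjMap T p := by
      simp [conjMap, hT, transfer_mul_C]
    rw [this, hp, hT, transfer_coeff_mul]
  | X_mul p hp hd =>
    rw [hT, transfer_X_mul, ← hT, ← conv_congr_right _ hd, ← hp]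
    obtain ⟨L, h1, h2⟩ := exists_del_eq_sum p
    have h3 : conjMap T (X * p) = star (transfer g s (star p * X)) := by simp [conjMap, hT]
    have h4 : transferJoin g s X = toPoly s := by
      ext q; simp [transferJoin_apply, TensorProduct.smul_tmul']
    rw [h3, transfer_mul, h4, conv_apply, conv_apply, h1, h2, transfer_X, ← hT]
    simp only [map_list_sum, List.map_map, Function.comp_def, TensorProduct.map_tmul,
      LinearMap.mul'_apply, toPoly_apply, hs, star_add, star_mul, star_X, star_C, hg, add_mul]
    congr 1
    have h5 : ∀ l : List (NCPoly B), star l.sum = (l.map star).sum := by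
      intro l
      induction l with
      | nil => simp
      | cons a l ih => simp [ih]
    rw [h5]
    simp [conjMap, Function.comp_def]

end NCPoly

/-! ### Positivity of transfer operators -/

/-- The kernel `(p, q) ↦ T (p q*)` is a sum of squares on every finite family. -/
def IsSquareSum (T : NCPoly B →ₗ[ℂ] NCPoly B) : Prop :=
  ∀ (α : Type) [Fintype α] (P : α → NCPoly B), ∃ (κ : Type) (_ : Fintype κ)
    (R : α → κ → NCPoly B), ∀ i j, T (P i * star (P j)) = ∑ k, R i k * star (R j k)

/-- The square sum for S is a sum of kernels R_i R_j*, and T turns each of these into a square sum.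
-/
theorem IsSquareSum.comp {T S : NCPoly B →ₗ[ℂ] NCPoly B} (hT : IsSquareSum T)
    (hS : IsSquareSum S) : IsSquareSum (T.comp S) := by
  intro α _ P
  obtain ⟨κ, _, R, hR⟩ := hS α P
  choose κ' hκ' R' hR' using fun k => hT α (fun i => R i k)
  refine ⟨Σ k, κ' k, inferInstance, fun i k => R' k.1 i k.2, fun i j => ?_⟩
  rw [LinearMap.comp_apply, hR, map_sum, Fintype.sum_sigma]
  exact Finset.sum_congr rfl fun k _ => hR' k i j

theorem IsSquareSum.pow {T : Module.End ℂ (NCPoly B)} (hT : IsSquareSum T) (n : ℕ) :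
    IsSquareSum (T ^ n) := by
  induction n with
  | zero => exact fun α _ P => ⟨Unit, inferInstance, fun i _ => P i, fun i j => by simp⟩
  | succ n ih => rw [pow_succ]; exact ih.comp hT

theorem exists_eq_mul_star_of_nonneg {A : Type*} [CStarAlgebra A] [PartialOrder A]
    [StarOrderedRing A] {a : A} (h : 0 ≤ a) : ∃ b, a = b * star b :=
  CStarAlgebra.nonneg_iff_eq_mul_star_self.1 h

section Order

variable [PartialOrder B] [StarOrderedRing B]

theorem IsCompletelyPositive.exists_factor {σ : NCPoly B →ₗ[ℂ] B} (hσ : IsCompletelyPositive σ)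
    (α : Type) [Fintype α] (P : α → NCPoly B) :
    ∃ c : α → Fin (Fintype.card α) → B,
      ∀ i j, σ (P i * star (P j)) = ∑ k, c i k * star (c j k) := by
  let e := Fintype.equivFin α
  obtain ⟨N, hN⟩ := exists_eq_mul_star_of_nonneg (hσ _ (P ∘ e.symm))
  refine ⟨fun i k => N (e i) k, fun i j => ?_⟩
  have := congrArg (fun M : CStarMatrix _ _ B => M (e i) (e j)) hN
  simpa [CStarMatrix.mul_apply, CStarMatrix.star_apply] using this

/-- Each k gives a matrix N_k whose column 0 is c(·, k) and whose other columns vanish; the matrix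
in question is the sum of the N_k N_k*. -/
theorem isCompletelyPositive_of_factor {μ : NCPoly B →ₗ[ℂ] B}
    (h : ∀ (n : ℕ) (P : Fin n → NCPoly B), ∃ (κ : Type) (_ : Fintype κ) (c : Fin n → κ → B),
      ∀ i j, μ (P i * star (P j)) = ∑ k, c i k * star (c j k)) : IsCompletelyPositive μ := by
  intro n P
  obtain ⟨κ, _, c, hc⟩ := h n P
  let N : κ → CStarMatrix (Fin n) (Fin n) B := fun k =>
    CStarMatrix.ofMatrix (Matrix.of fun i j => if (j : ℕ) = 0 then c i k else 0)
  have : CStarMatrix.ofMatrix (Matrix.of fun i j : Fin n => μ (P i * star (P j))) =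
      ∑ k, N k * star (N k) := by
    ext i j
    have hn : 0 < n := i.pos
    have h0 : ∀ k, (N k * star (N k)) i j = c i k * star (c j k) := by
      intro k
      rw [CStarMatrix.mul_apply, Finset.sum_eq_single (⟨0, hn⟩ : Fin n)]
      · simp [N, CStarMatrix.star_apply]
      · intro l _ hl
        have : (l : ℕ) ≠ 0 := fun h => hl (Fin.ext h)
        simp [N, this]
      · simp
    have h1 : (∑ k, N k * star (N k)) i j = ∑ k, (N k * star (N k)) i j := by
      exact Matrix.sum_apply _ _ _ _
    rw [h1]
    simp [h0, hc]
  rw [this]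
  exact Finset.sum_nonneg fun k _ => mul_star_self_nonneg _

/-- Compare the off-diagonal entries of the positive 2 × 2 matrix of the family (p, 1). -/
theorem IsCompletelyPositive.map_star {σ : NCPoly B →ₗ[ℂ] B} (hσ : IsCompletelyPositive σ)
    (p : NCPoly B) : σ (star p) = star (σ p) := by
  obtain ⟨c, hc⟩ := hσ.exists_factor (Fin 2) ![p, 1]
  have h1 := hc 0 1
  have h2 := hc 1 0
  simp only [Matrix.cons_val_zero, Matrix.cons_val_one, star_one, mul_one, one_mul] at h1 h2
  rw [h1, h2]
  simp

theorem IsCompletelyPositive.smul {σ : NCPoly B →ₗ[ℂ] B} (hσ : IsCompletelyPositive σ) {r : ℝ}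
    (hr : 0 ≤ r) : IsCompletelyPositive ((r : ℂ) • σ) := by
  refine isCompletelyPositive_of_factor fun n P => ?_
  obtain ⟨c, hc⟩ := hσ.exists_factor (Fin n) P
  refine ⟨_, inferInstance, fun i k => ((√r : ℝ) : ℂ) • c i k, fun i j => ?_⟩
  rw [LinearMap.smul_apply, hc, Finset.smul_sum]
  refine Finset.sum_congr rfl fun k _ => ?_
  rw [star_smul, smul_mul_smul_comm]
  congr 1
  simp [← Complex.ofReal_mul, Real.mul_self_sqrt hr]

theorem isSquareSum_transfer {g : B} {σ : NCPoly B →ₗ[ℂ] B} (hg : star g = g)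
    (hσ : IsCompletelyPositive σ) : IsSquareSum (transfer g σ) := by
  intro α _ P
  choose L h1 h2 using fun i => exists_del_eq_sum (P i)
  -- One factorization serves the right legs of the coproducts of all P i at once, since a
  -- straddling factor pairs a leg of P i with a leg of P j.
  obtain ⟨c, hc⟩ := hσ.exists_factor (Σ i, Fin (L i).length) (fun a => ((L a.1)[a.2]).2)
  -- The index `none` carries the term T(P i) T(P j)* without a straddling factor; the other indices
  -- carry the columns of the factorization.
  refine ⟨Option (Fin (Fintype.card (Σ i, Fin (L i).length))), inferInstance,
    fun i k => k.elim (transfer g σ (P i)) fun k =>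
      ∑ a : Fin (L i).length, transfer g σ ((L i)[a]).1 * C (c ⟨i, a⟩ k), fun i j => ?_⟩
  rw [Fintype.sum_option, transfer_mul, transfer_star hg hσ.map_star]
  congr 1
  have e1 : del (P i) = ∑ a : Fin (L i).length, ((L i)[a]).1 ⊗ₜ[ℂ] ((L i)[a]).2 := by
    rw [h1]; exact (Fin.sum_univ_fun_getElem (L i) fun x => x.1 ⊗ₜ[ℂ] x.2).symm
  have e2 : del (star (P j)) =
      ∑ a : Fin (L j).length, star ((L j)[a]).2 ⊗ₜ[ℂ] star ((L j)[a]).1 := by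
    rw [h2]; exact (Fin.sum_univ_fun_getElem (L j) fun x => star x.2 ⊗ₜ[ℂ] star x.1).symm
  simp only [Option.elim, star_sum, Finset.sum_mul_sum, star_mul, star_C]
  rw [conv_apply, e1, Finset.sum_comm]
  simp only [map_sum, TensorProduct.map_tmul, LinearMap.mul'_apply, transferJoin_apply, e2,
    Finset.smul_sum, TensorProduct.smul_tmul', smul_eq_mul, toPoly_apply, Finset.mul_sum]
  refine Finset.sum_congr rfl fun a _ => ?_
  rw [Finset.sum_comm]
  refine Finset.sum_congr rfl fun b _ => ?_
  have := hc ⟨i, a⟩ ⟨j, b⟩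
  simp only at this
  rw [this, transfer_star hg hσ.map_star, map_sum, Finset.sum_mul, Finset.mul_sum]
  refine Finset.sum_congr rfl fun k _ => ?_
  rw [map_mul]
  simp only [mul_assoc]

theorem IsSquareSum.isCompletelyPositive {T : NCPoly B →ₗ[ℂ] NCPoly B} (hT : IsSquareSum T) :
    IsCompletelyPositive (eps.toLinearMap.comp T) := by
  refine isCompletelyPositive_of_factor fun n P => ?_
  obtain ⟨κ, _, R, hR⟩ := hT (Fin n) P
  refine ⟨κ, inferInstance, fun i k => eps (R i k), fun i j => ?_⟩
  rw [LinearMap.comp_apply, hR, map_sum]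
  exact Finset.sum_congr rfl fun k _ => by simp [eps_star]

/-- Matrices over B converge entrywise, and the positive cone is closed. -/
theorem isCompletelyPositive_of_tendsto {ι : Type*} {l : Filter ι} [l.NeBot]
    {μ : ι → NCPoly B →ₗ[ℂ] B} {ν : NCPoly B →ₗ[ℂ] B} (hμ : ∀ᶠ i in l, IsCompletelyPositive (μ i))
    (h : ∀ p, Tendsto (fun i => μ i p) l (𝓝 (ν p))) : IsCompletelyPositive ν := by
  intro n P
  have ht : Tendsto (fun k => CStarMatrix.ofMatrix
      (Matrix.of fun i j : Fin n => μ k (P i * star (P j)))) l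
      (𝓝 (CStarMatrix.ofMatrix (Matrix.of fun i j : Fin n => ν (P i * star (P j))))) := by
    refine tendsto_pi_nhds.2 fun i => tendsto_pi_nhds.2 fun j => ?_
    exact h _
  exact ge_of_tendsto ht (hμ.mono fun k hk => hk n P)

end Order

end Positivity

/-! ### Labelled non-crossing partitions -/

section Labelled

/-- The non-crossing partitions of `{l, …, r - 1}` whose blocks carry labels less than `N` that
decrease strictly from a block to the blocks it covers. The partition is given by the function `p`
that sends an element to the maximum of its block, and the labelling by a function `g` of the
elements. -/
structure IsLabelledNC (N l r : ℕ) (x : (ℕ → ℕ) × (ℕ → ℕ)) : Prop where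
  le : ∀ i, i ≤ x.1 i
  nc : ∀ i j, i ≤ j → j ≤ x.1 i → x.1 j ≤ x.1 i
  supp : ∀ i, x.1 i ≠ i → l ≤ i ∧ x.1 i < r
  label : ∀ i, x.2 (x.1 i) = x.2 i
  strict : ∀ i j, i ≤ j → j ≤ x.1 i → x.1 j = x.1 i ∨ x.2 j < x.2 i
  lt : ∀ i, l ≤ i → i < r → x.2 i < N
  zero : ∀ i, ¬ (l ≤ i ∧ i < r) → x.2 i = 0

/-- Beyond r the functions take the default values i and 0, so their restrictions to `Fin r`, which
are bounded, determine them. -/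
theorem finite_isLabelledNC (N l r : ℕ) : {x | IsLabelledNC N l r x}.Finite := by
  refine Set.Finite.of_injOn
    (f := fun (x : (ℕ → ℕ) × (ℕ → ℕ)) (i : Fin r) => (x.1 i, x.2 i))
    (t := Set.univ.pi fun _ : Fin r => Set.Iic r ×ˢ Set.Iic N) ?_ ?_
    (Set.Finite.pi fun _ => (Set.finite_Iic r).prod (Set.finite_Iic N))
  · intro x hx i _
    have h1 := hx.supp i
    have h2 := hx.lt i
    have h3 := hx.zero i
    have h4 := i.2
    simp only [Set.mem_prod, Set.mem_Iic]
    constructor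
    · by_cases h : x.1 i = i
      · omega
      · have := (h1 h).2; omega
    · by_cases h : l ≤ (i : ℕ)
      · exact (h2 h h4).le
      · rw [h3 (by omega)]; omega
  · intro x hx y hy hxy
    have h : ∀ i (hi : i < r), x.1 i = y.1 i ∧ x.2 i = y.2 i := by
      intro i hi
      simpa using congrFun hxy ⟨i, hi⟩
    have hout : ∀ z, IsLabelledNC N l r z → ∀ i, ¬ i < r → z.1 i = i ∧ z.2 i = 0 := by
      intro z hz i hi
      refine ⟨?_, hz.zero i (by omega)⟩
      by_contra h
      have h1 := hz.supp i h
      have h2 := hz.le i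
      omega
    refine Prod.ext (funext fun i => ?_) (funext fun i => ?_)
    · by_cases hi : i < r
      · exact (h i hi).1
      · rw [(hout x hx i hi).1, (hout y hy i hi).1]
    · by_cases hi : i < r
      · exact (h i hi).2
      · rw [(hout x hx i hi).2, (hout y hy i hi).2]

/-- The finite set of labelled non-crossing partitions. -/
def labelledNC (N l r : ℕ) : Finset ((ℕ → ℕ) × (ℕ → ℕ)) := (finite_isLabelledNC N l r).toFinset

@[simp] theorem mem_labelledNC {N l r : ℕ} {x : (ℕ → ℕ) × (ℕ → ℕ)} :
    x ∈ labelledNC N l r ↔ IsLabelledNC N l r x := by simp [labelledNC]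

/-- The second element of the block of `l` in `{l, …, r - 1}`, or `r` if there is none. -/
def nextIn (p : ℕ → ℕ) (l r : ℕ) : ℕ :=
  open scoped Classical in if h : ∃ u, l < u ∧ u < r ∧ p u = p l then Nat.find h else r

theorem nextIn_cases (p : ℕ → ℕ) {l r : ℕ} (hlr : l < r) :
    l < nextIn p l r ∧ nextIn p l r ≤ r ∧ (nextIn p l r < r → p (nextIn p l r) = p l) ∧
      ∀ v, l < v → v < nextIn p l r → p v ≠ p l := by
  classical
  unfold nextIn
  split_ifs with h
  · have h1 := Nat.find_spec h
    refine ⟨h1.1, h1.2.1.le, fun _ => h1.2.2, fun v hv hv' hp => ?_⟩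
    exact Nat.find_min h hv' ⟨hv, hv'.trans h1.2.1, hp⟩
  · push Not at h
    exact ⟨hlr, le_rfl, fun h => absurd h (lt_irrefl _), h⟩

theorem nextIn_eq {p : ℕ → ℕ} {l r u : ℕ} (hlu : l < u) (hur : u ≤ r)
    (hp : u < r → p u = p l) (h : ∀ v, l < v → v < u → p v ≠ p l) : nextIn p l r = u := by
  obtain ⟨h1, h2, h3, h4⟩ := nextIn_cases p (hlu.trans_le hur)
  rcases lt_trichotomy (nextIn p l r) u with h' | h' | h'
  · exact absurd (h3 (h'.trans_le hur)) (h _ h1 h')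
  · exact h'
  · exact absurd (hp (h'.trans_le h2)) (h4 _ hlu h')

theorem nextIn_congr {p p' : ℕ → ℕ} {l r : ℕ} (hlr : l < r)
    (h : ∀ i, l ≤ i → i < r → (p i = p l ↔ p' i = p' l)) : nextIn p l r = nextIn p' l r := by
  obtain ⟨h1, h2, h3, h4⟩ := nextIn_cases p' hlr
  refine nextIn_eq h1 h2 (fun hu => (h _ h1.le hu).2 (h3 hu)) fun v hv hv' => ?_
  rw [Ne, h v hv.le (hv'.trans_le h2)]
  exact h4 v hv hv'

/-- The restriction of a labelled partition to `{a, …, c - 1}`. -/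
def restrictLNC (a c : ℕ) (x : (ℕ → ℕ) × (ℕ → ℕ)) : (ℕ → ℕ) × (ℕ → ℕ) :=
  (fun i => if a ≤ i ∧ i < c then x.1 i else i, fun i => if a ≤ i ∧ i < c then x.2 i else 0)

/-- The labelled partition in which `l` with the label `m` is added to the block of `u` in `z`, and
with `y` between `l` and `u`. -/
def joinLNC (m l u : ℕ) (y z : (ℕ → ℕ) × (ℕ → ℕ)) : (ℕ → ℕ) × (ℕ → ℕ) :=
  (fun i => if i = l then z.1 u else if i < u then y.1 i else z.1 i,
    fun i => if i = l then m else if i < u then y.2 i else z.2 i)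

/-! ### Cutting and gluing labelled partitions -/

section

variable {N l r m : ℕ} {x : (ℕ → ℕ) × (ℕ → ℕ)}

theorem IsLabelledNC.lt_of_lt (hx : IsLabelledNC N l r x) {i : ℕ} (hi : i < r) : x.1 i < r := by
  by_cases h : x.1 i = i
  · omega
  · exact (hx.supp i h).2

theorem IsLabelledNC.eq_self (hx : IsLabelledNC N l r x) {i : ℕ} (hi : i < l ∨ r ≤ i) :
    x.1 i = i := by
  by_contra h
  have h1 := hx.supp i h
  have h2 := hx.le i
  omega

theorem IsLabelledNC.idem (hx : IsLabelledNC N l r x) (i : ℕ) : x.1 (x.1 i) = x.1 i :=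
  le_antisymm (hx.nc i _ (hx.le i) le_rfl) (hx.le _)

/-- Let u be the successor of l in its block. If the block of i reached u, the nesting condition
would force its maximum to equal that of the block of l, putting i into that block before u. So the
gap is a union of blocks, all covered by the block of l. -/
theorem IsLabelledNC.gap (hx : IsLabelledNC N l r x) (hlr : l < r) {i : ℕ} (hi : l < i)
    (hu : nextIn x.1 l r < r) (hiu : i < nextIn x.1 l r) :
    x.1 i < nextIn x.1 l r ∧ x.2 i < x.2 l := by
  obtain ⟨h1, h2, h3, h4⟩ := nextIn_cases x.1 hlr
  set u := nextIn x.1 l r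
  have hul : u ≤ x.1 l := by rw [← h3 hu]; exact hx.le u
  have h5 := hx.nc l i hi.le (by omega)
  have h6 := hx.strict l i hi.le (by omega)
  have h7 := h4 i hi hiu
  refine ⟨?_, h6.resolve_left h7⟩
  by_contra h
  have h8 := hx.nc i u hiu.le (by omega)
  rw [h3 hu] at h8
  omega

theorem IsLabelledNC.restrict_left (hx : IsLabelledNC N l r x) (hlr : l < r)
    (hu : nextIn x.1 l r < r) :
    IsLabelledNC (x.2 l) (l + 1) (nextIn x.1 l r) (restrictLNC (l + 1) (nextIn x.1 l r) x) := by
  have hg := fun i => hx.gap hlr (i := i)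
  set u := nextIn x.1 l r
  have e := hx.le
  refine ⟨fun i => ?_, fun i j hij hj => ?_, fun i hi => ?_, fun i => ?_, fun i j hij hj => ?_,
    fun i hi hiu => ?_, fun i hi => ?_⟩ <;> simp only [restrictLNC] at *
  · split_ifs <;> simp [e]
  · have h1 := hx.nc i j hij
    have h2 := hg i
    split_ifs at hj ⊢ <;> grind
  · have h2 := hg i
    split_ifs at hi ⊢ <;> grind
  · have h2 := hg i
    have h3 := e i
    have h4 := hx.label i
    split_ifs <;> grind
  · have h1 := hx.strict i j hij
    have h2 := hg i
    split_ifs at hj ⊢ <;> grind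
  · rw [if_pos ⟨hi, hiu⟩]
    exact (hg i (by omega) hu hiu).2
  · rw [if_neg hi]

theorem IsLabelledNC.restrict_right (hx : IsLabelledNC N l r x) {a : ℕ} (ha : l ≤ a) :
    IsLabelledNC N a r (restrictLNC a r x) := by
  have e := hx.le
  have hg := fun i => hx.lt_of_lt (i := i)
  refine ⟨fun i => ?_, fun i j hij hj => ?_, fun i hi => ?_, fun i => ?_, fun i j hij hj => ?_,
    fun i hi hiu => ?_, fun i hi => ?_⟩ <;> simp only [restrictLNC] at *
  · split_ifs <;> simp [e]
  · have h1 := hx.nc i j hij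
    have h2 := hg i
    split_ifs at hj ⊢ <;> grind
  · have h2 := hg i
    split_ifs at hi ⊢ <;> grind
  · have h2 := hg i
    have h3 := e i
    have h4 := hx.label i
    split_ifs <;> grind
  · have h1 := hx.strict i j hij
    have h2 := hg i
    split_ifs at hj ⊢ <;> grind
  · rw [if_pos ⟨hi, hiu⟩]
    exact hx.lt i (by omega) hiu
  · rw [if_neg hi]

/-- The labels between l and u are bounded by m, the label of the block of l. This is exactly
strictness for the blocks in the gap. -/
theorem IsLabelledNC.join {y z : (ℕ → ℕ) × (ℕ → ℕ)} {u : ℕ} (hlu : l < u) (hur : u < r)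
    (hm : m < N) (hy : IsLabelledNC m (l + 1) u y) (hz : IsLabelledNC N u r z) (hzm : z.2 u = m) :
    IsLabelledNC N l r (joinLNC m l u y z) := by
  have hzu := hz.le u
  have hzu' := hz.lt_of_lt hur
  have hyl : y.1 l = l := hy.eq_self (by omega)
  have hyi := fun i => hy.lt_of_lt (i := i)
  have hzi := fun i => hz.lt_of_lt (i := i)
  have hys := fun i => hy.eq_self (i := i)
  refine ⟨fun i => ?_, fun i j hij hj => ?_, fun i hi => ?_, fun i => ?_, fun i j hij hj => ?_,
    fun i hi hiu => ?_, fun i hi => ?_⟩ <;> simp only [joinLNC] at *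
  · have h1 := hy.le i
    have h2 := hz.le i
    split_ifs <;> omega
  · have h1 := hy.nc i j hij
    have h2 := hz.nc i j hij
    have h3 := hz.nc u j
    have h4 := hyi j
    have h5 := hyi i
    have h6 := hys i
    split_ifs at hj ⊢ <;> grind
  · have h1 := hy.supp i
    have h2 := hz.supp i
    have h3 := hyi i
    split_ifs at hi ⊢ <;> grind
  · have h1 := hy.label i
    have h2 := hz.label i
    have h3 := hz.label u
    have h4 := hyi i
    have h5 := hz.le i
    have h6 := hy.le i
    have h7 := hys i
    split_ifs <;> grind
  · have h1 := hy.strict i j hij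
    have h2 := hz.strict i j hij
    have h3 := hz.strict u j
    have h4 := hyi j
    have h5 := hyi i
    have h6 := hys i
    have h7 := hy.lt j
    split_ifs at hj ⊢ <;> grind
  · have h1 := hy.lt i
    have h2 := hz.lt i
    split_ifs <;> grind
  · have h1 := hy.zero i
    have h2 := hz.zero i
    split_ifs <;> grind

theorem nextIn_joinLNC {y z : (ℕ → ℕ) × (ℕ → ℕ)} {u : ℕ} (hlu : l < u) (hur : u < r)
    (hy : IsLabelledNC m (l + 1) u y) (hz : IsLabelledNC N u r z) :
    nextIn (joinLNC m l u y z).1 l r = u := by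
  refine nextIn_eq hlu hur.le (fun _ => ?_) fun v hv hvu => ?_
  · simp only [joinLNC]; split_ifs <;> grind
  · have h1 := hy.lt_of_lt hvu
    have h2 := hz.le u
    simp only [joinLNC]; split_ifs <;> grind

theorem joinLNC_restrictLNC (hx : IsLabelledNC N l r x) (hlr : l < r)
    (hu : nextIn x.1 l r < r) :
    joinLNC (x.2 l) l (nextIn x.1 l r) (restrictLNC (l + 1) (nextIn x.1 l r) x)
      (restrictLNC (nextIn x.1 l r) r x) = x := by
  obtain ⟨h1, h2, h3, h4⟩ := nextIn_cases x.1 hlr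
  have h0 := fun i => hx.eq_self (i := i)
  have h5 := hx.zero
  refine Prod.ext (funext fun i => ?_) (funext fun i => ?_) <;>
    simp only [joinLNC, restrictLNC]
  · have := h0 i
    split_ifs <;> grind
  · have := h5 i
    split_ifs <;> grind

theorem restrictLNC_joinLNC {y z : (ℕ → ℕ) × (ℕ → ℕ)} {u : ℕ} (hlu : l < u)
    (hy : IsLabelledNC m (l + 1) u y) (hz : IsLabelledNC N u r z) :
    restrictLNC (l + 1) u (joinLNC m l u y z) = y ∧ restrictLNC u r (joinLNC m l u y z) = z := by
  have h1 := fun i => hy.eq_self (i := i)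
  have h2 := fun i => hz.eq_self (i := i)
  refine ⟨Prod.ext (funext fun i => ?_) (funext fun i => ?_),
    Prod.ext (funext fun i => ?_) (funext fun i => ?_)⟩ <;> simp only [joinLNC, restrictLNC]
  · have := h1 i
    split_ifs <;> grind
  · have := hy.zero i
    split_ifs <;> grind
  · have := h2 i
    split_ifs <;> grind
  · have := hz.zero i
    split_ifs <;> grind

theorem IsLabelledNC.eq_self_of_nextIn (hx : IsLabelledNC N l r x) (hlr : l < r)
    (hu : nextIn x.1 l r = r) : x.1 l = l := by
  obtain ⟨h1, h2, h3, h4⟩ := nextIn_cases x.1 hlr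
  by_contra h
  have h5 := hx.le l
  exact h4 (x.1 l) (by omega) (by rw [hu]; exact hx.lt_of_lt hlr) (hx.idem l)

theorem IsLabelledNC.update {y : (ℕ → ℕ) × (ℕ → ℕ)} (hlr : l < r) (hm : m < N)
    (hy : IsLabelledNC N (l + 1) r y) : IsLabelledNC N l r (y.1, Function.update y.2 l m) := by
  have hyl : y.1 l = l := hy.eq_self (by omega)
  refine ⟨hy.le, hy.nc, fun i hi => ?_, fun i => ?_, fun i j hij hj => ?_,
    fun i hi hiu => ?_, fun i hi => ?_⟩ <;> simp only [Function.update_apply] at *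
  · have := hy.supp i hi
    omega
  · have h1 := hy.label i
    have h2 := hy.supp i
    have h3 := hy.le i
    split_ifs <;> grind
  · have h1 := hy.strict i j hij hj
    have h2 := hy.supp i
    split_ifs <;> grind
  · have := hy.lt i
    split_ifs <;> grind
  · have := hy.zero i
    split_ifs <;> grind

theorem restrictLNC_update {y : (ℕ → ℕ) × (ℕ → ℕ)} (hy : IsLabelledNC N (l + 1) r y) :
    restrictLNC (l + 1) r (y.1, Function.update y.2 l m) = y := by
  refine Prod.ext (funext fun i => ?_) (funext fun i => ?_) <;>
    simp only [restrictLNC, Function.update_apply]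
  · have := hy.eq_self (i := i)
    split_ifs <;> grind
  · have := hy.zero i
    split_ifs <;> grind

theorem update_restrictLNC (hx : IsLabelledNC N l r x) (hlr : l < r) (hu : nextIn x.1 l r = r) :
    ((restrictLNC (l + 1) r x).1, Function.update (restrictLNC (l + 1) r x).2 l (x.2 l)) = x := by
  have h0 := hx.eq_self_of_nextIn hlr hu
  refine Prod.ext (funext fun i => ?_) (funext fun i => ?_) <;>
    simp only [restrictLNC, Function.update_apply]
  · have := hx.eq_self (i := i)
    split_ifs <;> grind
  · have := hx.zero i
    split_ifs <;> grind

theorem nextIn_update {y : (ℕ → ℕ) × (ℕ → ℕ)} (hlr : l < r) (hy : IsLabelledNC N (l + 1) r y) :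
    nextIn y.1 l r = r := by
  refine nextIn_eq hlr le_rfl (fun h => absurd h (lt_irrefl _)) fun v hv hvr h => ?_
  have h1 := hy.le v
  rw [h, hy.eq_self (i := l) (by omega)] at h1
  omega

end

/-- The decomposition of labelled non-crossing partitions along the second element of the first
block. -/
theorem sum_labelledNC_eq {M : Type*} [AddCommMonoid M] {N l r m : ℕ} (hlr : l < r) (hm : m < N)
    (F : (ℕ → ℕ) × (ℕ → ℕ) → M) (G : (ℕ → ℕ) × (ℕ → ℕ) → M)
    (H : ℕ → (ℕ → ℕ) × (ℕ → ℕ) → (ℕ → ℕ) × (ℕ → ℕ) → M)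
    (hG : ∀ x, IsLabelledNC N l r x → nextIn x.1 l r = r → F x = G (restrictLNC (l + 1) r x))
    (hH : ∀ x, IsLabelledNC N l r x → ∀ u, nextIn x.1 l r = u → u < r →
      F x = H u (restrictLNC (l + 1) u x) (restrictLNC u r x)) :
    ∑ x ∈ (labelledNC N l r).filter (fun x => x.2 l = m), F x =
      ∑ y ∈ labelledNC N (l + 1) r, G y +
      ∑ u ∈ Finset.Ioo l r, ∑ y ∈ labelledNC m (l + 1) u,
        ∑ z ∈ (labelledNC N u r).filter (fun x => x.2 u = m), H u y z := by
  -- Fibres over the second element of the block of l. The value r means that l is alone, in which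
  -- case its label m constrains nothing else.
  rw [← Finset.sum_fiberwise_of_maps_to (g := fun x => nextIn x.1 l r) (t := Finset.Ioc l r)
      (fun x _ => Finset.mem_Ioc.2 ⟨(nextIn_cases x.1 hlr).1, (nextIn_cases x.1 hlr).2.1⟩),
    ← Finset.Ioo_insert_right hlr, Finset.sum_insert (by simp)]
  congr 1
  · refine Finset.sum_nbij' (fun x => restrictLNC (l + 1) r x)
      (fun y => (y.1, Function.update y.2 l m)) ?_ ?_ ?_ ?_ ?_
    · intro x hx
      simp only [Finset.mem_filter, mem_labelledNC] at hx ⊢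
      exact hx.1.1.restrict_right (Nat.le_succ l)
    · intro y hy
      simp only [Finset.mem_filter, mem_labelledNC] at hy ⊢
      exact ⟨⟨hy.update hlr hm, by simp⟩, nextIn_update hlr hy⟩
    · intro x hx
      simp only [Finset.mem_filter, mem_labelledNC] at hx
      obtain ⟨⟨h1, rfl⟩, h3⟩ := hx
      exact update_restrictLNC h1 hlr h3
    · intro y hy
      exact restrictLNC_update (mem_labelledNC.1 hy)
    · intro x hx
      simp only [Finset.mem_filter, mem_labelledNC] at hx
      exact hG x hx.1.1 hx.2
  · refine Finset.sum_congr rfl fun u hu => ?_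
    obtain ⟨hlu, hur⟩ := Finset.mem_Ioo.1 hu
    rw [← Finset.sum_product' (f := fun y z => H u y z)]
    refine Finset.sum_nbij' (fun x => (restrictLNC (l + 1) u x, restrictLNC u r x))
      (fun y => joinLNC m l u y.1 y.2) ?_ ?_ ?_ ?_ ?_
    · intro x hx
      simp only [Finset.mem_filter, mem_labelledNC, Finset.mem_product] at hx ⊢
      obtain ⟨⟨h1, rfl⟩, rfl⟩ := hx
      refine ⟨h1.restrict_left hlr hur, h1.restrict_right hlu.le, ?_⟩
      have h3 := (nextIn_cases x.1 hlr).2.2.1 hur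
      simp only [restrictLNC, hur, le_refl, and_self, if_true]
      rw [← h1.label, h3, h1.label]
    · intro y hy
      simp only [Finset.mem_filter, mem_labelledNC, Finset.mem_product] at hy ⊢
      obtain ⟨h1, h2, h3⟩ := hy
      exact ⟨⟨h1.join hlu hur hm h2 h3, by simp [joinLNC]⟩, nextIn_joinLNC hlu hur h1 h2⟩
    · intro x hx
      simp only [Finset.mem_filter, mem_labelledNC] at hx
      obtain ⟨⟨h1, rfl⟩, rfl⟩ := hx
      exact joinLNC_restrictLNC h1 hlr hur
    · intro y hy
      simp only [Finset.mem_filter, mem_labelledNC, Finset.mem_product] at hy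
      exact Prod.ext (restrictLNC_joinLNC hlu hy.1 hy.2.1).1 (restrictLNC_joinLNC hlu hy.1 hy.2.1).2
    · intro x hx
      simp only [Finset.mem_filter, mem_labelledNC] at hx
      exact hH x hx.1.1 u hx.2 hur

theorem labelledNC_self (N l : ℕ) : labelledNC N l l = {(id, 0)} := by
  ext x
  rw [mem_labelledNC, Finset.mem_singleton]
  constructor
  · intro hx
    refine Prod.ext (funext fun i => hx.eq_self (by omega)) (funext fun i => hx.zero i (by omega))
  · rintro rfl
    refine ⟨?_, ?_, ?_, ?_, ?_, ?_, ?_⟩ <;> simp <;> omega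

end Labelled

/-! ### Nested evaluation along labelled partitions -/

section Evaluation

variable {B : Type*} [CStarAlgebra B]

/-- The factor `X c₁ X c₂ ⋯ X c_k` to which `K` is applied for the block of `l`. -/
def blockPoly (K : NCPoly B →ₗ[ℂ] B) (b : ℕ → B) (p : ℕ → ℕ) (l r : ℕ) : NCPoly B :=
  if h : l < r then
    X * C (if l + 1 < nextIn p l r then
        K (C (b (l + 1)) * blockPoly K b p (l + 1) (nextIn p l r)) else b (l + 1)) *
      (if nextIn p l r < r then blockPoly K b p (nextIn p l r) r else 1)
  else 0
termination_by r - l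
decreasing_by
  all_goals
    have h1 := nextIn_cases p h
    omega

/-- The nested evaluation on `{l, …, r - 1}`. -/
def nestedEval (K : NCPoly B →ₗ[ℂ] B) (b : ℕ → B) (p : ℕ → ℕ) (l r : ℕ) : B :=
  if l < r then K (C (b l) * blockPoly K b p l r) else b l

theorem blockPoly_eq (K : NCPoly B →ₗ[ℂ] B) (b : ℕ → B) (p : ℕ → ℕ) {l r : ℕ} (h : l < r) :
    blockPoly K b p l r = X * C (nestedEval K b p (l + 1) (nextIn p l r)) *
      (if nextIn p l r < r then blockPoly K b p (nextIn p l r) r else 1) := by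
  rw [blockPoly, dif_pos h]
  rfl

theorem blockPoly_congr (K : NCPoly B →ₗ[ℂ] B) (b : ℕ → B) {p p' : ℕ → ℕ} {l r : ℕ}
    (h : ∀ i j, l ≤ i → i < r → l ≤ j → j < r → (p i = p j ↔ p' i = p' j)) :
    blockPoly K b p l r = blockPoly K b p' l r := by
  induction hn : r - l using Nat.strong_induction_on generalizing l r with
  | _ n ih =>
    by_cases hlr : l < r
    · have hu : nextIn p l r = nextIn p' l r :=
        nextIn_congr hlr fun i hi hi' => h i l hi hi' le_rfl hlr
      obtain ⟨h1, h2, h3, h4⟩ := nextIn_cases p' hlr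
      rw [blockPoly_eq K b p hlr, blockPoly_eq K b p' hlr, hu, nestedEval, nestedEval,
        ih _ (by omega) (l := l + 1) (r := nextIn p' l r)
          (fun i j hi hi' hj hj' => h i j (by omega) (by omega) (by omega) (by omega)) rfl,
        ih _ (by omega) (l := nextIn p' l r) (r := r)
          (fun i j hi hi' hj hj' => h i j (by omega) (by omega) (by omega) (by omega)) rfl]
    · have h0 : ∀ q, blockPoly K b q l r = 0 := fun q => by rw [blockPoly, dif_neg hlr]
      rw [h0, h0]

theorem nestedEval_congr (K : NCPoly B →ₗ[ℂ] B) (b : ℕ → B) {p p' : ℕ → ℕ} {l r : ℕ}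
    (h : ∀ i j, l ≤ i → i < r → l ≤ j → j < r → (p i = p j ↔ p' i = p' j)) :
    nestedEval K b p l r = nestedEval K b p' l r := by
  rw [nestedEval, nestedEval, blockPoly_congr K b h]

/-- The product of the weights `t` of the blocks in `{l, …, r - 1}`. -/
def blockWeight (t : ℂ) (p : ℕ → ℕ) (l r : ℕ) : ℂ :=
  ∏ i ∈ Finset.Ico l r, if p i = i then t else 1

theorem blockWeight_congr (t : ℂ) {p p' : ℕ → ℕ} {l r : ℕ}
    (h : ∀ i, l ≤ i → i < r → p i = p' i) : blockWeight t p l r = blockWeight t p' l r := by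
  refine Finset.prod_congr rfl fun i hi => ?_
  obtain ⟨h1, h2⟩ := Finset.mem_Ico.1 hi
  rw [h i h1 h2]

theorem blockWeight_split (t : ℂ) (p : ℕ → ℕ) {l u r : ℕ} (hlu : l < u) (hur : u ≤ r) :
    blockWeight t p l r =
      (if p l = l then t else 1) * blockWeight t p (l + 1) u * blockWeight t p u r := by
  rw [blockWeight, ← Finset.prod_Ico_consecutive _ hlu.le hur,
    Finset.prod_eq_prod_Ico_succ_bot hlu]
  rfl

variable (K : NCPoly B →ₗ[ℂ] B) (b : ℕ → B) (t : ℂ)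

/-- The weighted sum of the nested evaluations over labelled partitions. -/
def nestedSum (N l r : ℕ) : B :=
  ∑ x ∈ labelledNC N l r, blockWeight t x.1 l r • nestedEval K b x.1 l r

/-- The weighted sum of the block polynomials over the labelled partitions in which the first block
has the label `m`. -/
def blockSum (m N l r : ℕ) : NCPoly B :=
  ∑ x ∈ (labelledNC N l r).filter (fun x => x.2 l = m),
    blockWeight t x.1 l r • blockPoly K b x.1 l r

theorem nestedSum_self (N l : ℕ) : nestedSum K b t N l l = b l := by
  simp [nestedSum, labelledNC_self, blockWeight, nestedEval]

theorem nestedSum_eq (N : ℕ) {l r : ℕ} (h : l < r) :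
    nestedSum K b t N l r = K (C (b l) * ∑ m ∈ Finset.range N, blockSum K b t m N l r) := by
  rw [nestedSum, ← Finset.sum_fiberwise_of_maps_to (g := fun x => x.2 l) (t := Finset.range N)
    (fun x hx => Finset.mem_range.2 ((mem_labelledNC.1 hx).lt l le_rfl h)), Finset.mul_sum, map_sum]
  refine Finset.sum_congr rfl fun m _ => ?_
  rw [blockSum, Finset.mul_sum, map_sum]
  refine Finset.sum_congr rfl fun x _ => ?_
  rw [nestedEval, if_pos h, mul_smul_comm, map_smul]

/-- The first block either ends at l, with one weight t and all N labels free on the right, or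
continues at u, with labels below m in the gap. The weight is attached to the maximum of the block.
-/
theorem blockSum_eq {m N l r : ℕ} (hlr : l < r) (hm : m < N) :
    blockSum K b t m N l r = t • (X * C (nestedSum K b t N (l + 1) r)) +
      ∑ u ∈ Finset.Ioo l r, X * C (nestedSum K b t m (l + 1) u) * blockSum K b t m N u r := by
  rw [blockSum, sum_labelledNC_eq hlr hm
    (G := fun y => t • (X * C (blockWeight t y.1 (l + 1) r • nestedEval K b y.1 (l + 1) r)))
    (H := fun u y z => X * C (blockWeight t y.1 (l + 1) u • nestedEval K b y.1 (l + 1) u) *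
      (blockWeight t z.1 u r • blockPoly K b z.1 u r))]
  · congr 1
    · rw [nestedSum, map_sum, Finset.mul_sum, Finset.smul_sum]
    · refine Finset.sum_congr rfl fun u _ => ?_
      rw [nestedSum, map_sum, Finset.mul_sum, blockSum, Finset.sum_mul_sum]
  · intro x hx hu
    have h0 := hx.eq_self_of_nextIn hlr hu
    have h1 : ∀ i, l + 1 ≤ i → i < r → x.1 i = (restrictLNC (l + 1) r x).1 i := by
      intro i hi hi'
      exact (if_pos ⟨hi, hi'⟩).symm
    rw [blockPoly_eq K b _ hlr, hu, if_neg (lt_irrefl r), mul_one,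
      blockWeight_split t x.1 hlr le_rfl, if_pos h0,
      nestedEval_congr K b (p := x.1) (p' := (restrictLNC (l + 1) r x).1)
        (fun i j hi hi' hj hj' => by rw [h1 i hi hi', h1 j hj hj']), blockWeight_congr t h1]
    simp [blockWeight, mul_smul]
  · intro x hx u hu hur
    obtain ⟨h1, h2, h3, h4⟩ := nextIn_cases x.1 hlr
    rw [hu] at h1 h3
    have h0 : x.1 l ≠ l := by
      have := hx.le u
      have := h3 hur
      omega
    have h1' : ∀ i, l + 1 ≤ i → i < u → x.1 i = (restrictLNC (l + 1) u x).1 i := by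
      intro i hi hi'
      exact (if_pos ⟨hi, hi'⟩).symm
    have h2' : ∀ i, u ≤ i → i < r → x.1 i = (restrictLNC u r x).1 i := by
      intro i hi hi'
      exact (if_pos ⟨hi, hi'⟩).symm
    rw [blockPoly_eq K b _ hlr, hu, if_pos hur, blockWeight_split t x.1 h1 hur.le, if_neg h0,
      nestedEval_congr K b (p := x.1) (p' := (restrictLNC (l + 1) u x).1)
        (fun i j hi hi' hj hj' => by rw [h1' i hi hi', h1' j hj hj']),
      blockPoly_congr K b (p := x.1) (p' := (restrictLNC u r x).1)
        (fun i j hi hi' hj hj' => by rw [h2' i hi hi', h2' j hj hj']),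
      blockWeight_congr t h1', blockWeight_congr t h2', one_mul, map_smul, mul_smul_comm _ X,
      smul_mul_smul_comm]

end Evaluation

/-! ### Words -/

section Words

variable {B : Type*} [CStarAlgebra B] (b : ℕ → B)

/-- The monomial `b_l X b_{l+1} ⋯ X b_{l+n}`. -/
def wordAux : ℕ → ℕ → NCPoly B
  | l, 0 => C (b l)
  | l, n + 1 => C (b l) * (X * wordAux (l + 1) n)

/-- The monomial `b_l X b_{l+1} ⋯ X b_r`. -/
def word (l r : ℕ) : NCPoly B := wordAux b l (r - l)

@[simp] theorem word_self (l : ℕ) : word b l l = C (b l) := by simp [word, wordAux]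

theorem word_eq {l r : ℕ} (h : l < r) : word b l r = C (b l) * (X * word b (l + 1) r) := by
  rw [word, word, show r - l = (r - (l + 1)) + 1 by omega, wordAux]

theorem mono_eq_word (n : ℕ) : mono (b 0) (fun i : Fin n => b (i + 1)) = word b 0 n := by
  have h : ∀ l, mono (b l) (fun i : Fin n => b (l + i + 1)) = wordAux b l n := by
    induction n with
    | zero => intro l; simp [mono, wordAux]
    | succ n ih =>
      intro l
      rw [wordAux, ← ih (l + 1), mono, mono, List.ofFn_succ, List.prod_cons]
      simp only [Fin.val_zero, add_zero, Fin.val_succ, mul_assoc]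
      congr 5
      funext i
      congr 3
      omega
  simpa [word] using h 0

theorem del_word {l r : ℕ} (h : l ≤ r) : del (word b l r) =
    ∑ v ∈ Finset.Ico l r, word b l v ⊗ₜ[ℂ] word b (v + 1) r := by
  induction h using Nat.decreasingInduction with
  | self => simp
  | of_succ l hl ih =>
    rw [word_eq b hl, del_coeff_mul, del_X_mul, ih, Finset.sum_eq_sum_Ico_succ_bot hl, smul_add,
      Finset.smul_sum, Finset.smul_sum, add_comm]
    congr 1
    · simp [TensorProduct.smul_tmul']
    · refine Finset.sum_congr rfl fun v hv => ?_
      rw [word_eq b (Finset.mem_Ico.1 hv).1]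
      simp [TensorProduct.smul_tmul']

theorem conv_word {R : Type*} [Ring R] [Algebra ℂ R] (f h : NCPoly B →ₗ[ℂ] R) {l r : ℕ}
    (hlr : l ≤ r) : conv f h (word b l r) =
      ∑ v ∈ Finset.Ico l r, f (word b l v) * h (word b (v + 1) r) := by
  simp [conv_apply, del_word b hlr]

variable (g : B) (s : NCPoly B →ₗ[ℂ] B) (t : ℂ)

theorem eps_gen_X (a c : B) : eps (gen g s (C a * (X * C c))) = a * (g * c) := by
  rw [gen_coeff_mul, map_mul, eps_gen_X_mul]
  simp

/-- The only term in which no X survives replaces the whole word X y X by s(y). -/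
theorem eps_gen_X_mul_X (a : B) (y : NCPoly B) (c : B) :
    eps (gen g s (C a * (X * y * (X * C c)))) = a * (s y * c) := by
  have e : C a * (X * y * (X * C c)) = C a * (X * (y * X)) * C c := by
    simp only [mul_assoc]
  rw [e, gen_mul_C, gen_coeff_mul]
  have e2 : eps (gen g s (X * (y * X))) = s y := by
    rw [eps_gen_X_mul, conv_apply, del_mul]
    have e3 : ∀ z : NCPoly B ⊗[ℂ] NCPoly B, LinearMap.mul' ℂ B
        (TensorProduct.map s (eps (B := B)).toLinearMap
          (LinearMap.lTensor _ (LinearMap.mulRight ℂ X) z)) = 0 := by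
      intro z
      induction z using TensorProduct.induction_on with
      | zero => simp
      | add x y hx hy => simp only [map_add, hx, hy, add_zero]
      | tmul x y => simp
    rw [map_add, map_add, e3]
    simp [TensorProduct.smul_tmul']
  simp [e2, mul_assoc]

/-- The partition formula for the powers of a transfer operator. -/
theorem nestedSum_eq_transfer_pow (N : ℕ) {l r : ℕ} (hlr : l ≤ r) :
    nestedSum (eps.toLinearMap.comp (gen g s)) b t N l r =
      eps ((transfer (t • g) (t • s) ^ N) (word b l r)) := by
  set K := (eps (B := B)).toLinearMap.comp (gen g s) with hK
  set T := transfer (t • g) (t • s) with hT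
  -- In the second formula v is the last element of the first block. The X that survive in T^m are
  -- its inner elements, and the coefficients between them come from gaps with labels below m. To
  -- the right of v all N labels are allowed.
  suffices h : ∀ n l r, l ≤ r → r - l = n →
      (∀ N, nestedSum K b t N l r = eps ((T ^ N) (word b l r))) ∧
      ∀ m N, m < N → l < r → blockSum K b t m N l r =
        t • (X * C (eps ((T ^ N) (word b (l + 1) r))) +
          ∑ v ∈ Finset.Ioo l r, X * (T ^ m) (word b (l + 1) v) *
            (X * C (eps ((T ^ N) (word b (v + 1) r))))) from (h _ l r hlr rfl).1 N
  intro n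
  induction n using Nat.strong_induction_on with
  | _ n ih =>
    intro l r hlr hn
    have hQ : ∀ m N, m < N → l < r → blockSum K b t m N l r =
        t • (X * C (eps ((T ^ N) (word b (l + 1) r))) +
          ∑ v ∈ Finset.Ioo l r, X * (T ^ m) (word b (l + 1) v) *
            (X * C (eps ((T ^ N) (word b (v + 1) r))))) := by
      intro m N hm hlr
      -- Expansion at the first X that survives T^m: u is the next element of the block, and the
      -- coefficient before it is the evaluation of the gap.
      have hrec : ∀ v ∈ Finset.Ioo l r, (T ^ m) (word b (l + 1) v) =
          C (eps ((T ^ m) (word b (l + 1) v))) +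
            ∑ u ∈ Finset.Ico (l + 1) v, C (eps ((T ^ m) (word b (l + 1) u))) *
              (X * (T ^ m) (word b (u + 1) v)) := by
        intro v hv
        have hv' := Finset.mem_Ioo.1 hv
        nth_rewrite 1 [eq_eps_add_conv ((T ^ m) (word b (l + 1) v))]
        rw [hT, conv_transfer_pow, conv_word b _ _ (by omega)]
        rfl
      rw [blockSum_eq K b t hlr hm, (ih _ (by omega) (l + 1) r (by omega) rfl).1, smul_add]
      congr 1
      have h1 : ∀ u ∈ Finset.Ioo l r, X * C (nestedSum K b t m (l + 1) u) * blockSum K b t m N u r =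
          t • (X * C (eps ((T ^ m) (word b (l + 1) u))) *
              (X * C (eps ((T ^ N) (word b (u + 1) r)))) +
            ∑ v ∈ Finset.Ioo u r, X * C (eps ((T ^ m) (word b (l + 1) u))) *
              (X * (T ^ m) (word b (u + 1) v) * (X * C (eps ((T ^ N) (word b (v + 1) r)))))) := by
        intro u hu
        have hu' := Finset.mem_Ioo.1 hu
        rw [(ih _ (by omega) (l + 1) u (by omega) rfl).1,
          (ih _ (by omega) u r (by omega) rfl).2 m N hm hu'.2, mul_smul_comm, mul_add,
          Finset.mul_sum]
      rw [Finset.sum_congr rfl h1, ← Finset.smul_sum, Finset.sum_add_distrib]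
      congr 1
      have h2 : ∀ v ∈ Finset.Ioo l r, X * (T ^ m) (word b (l + 1) v) *
            (X * C (eps ((T ^ N) (word b (v + 1) r)))) =
          X * C (eps ((T ^ m) (word b (l + 1) v))) * (X * C (eps ((T ^ N) (word b (v + 1) r)))) +
            ∑ u ∈ Finset.Ico (l + 1) v, X * C (eps ((T ^ m) (word b (l + 1) u))) *
              (X * (T ^ m) (word b (u + 1) v) * (X * C (eps ((T ^ N) (word b (v + 1) r))))) := by
        intro v hv
        nth_rewrite 1 [hrec v hv]
        rw [mul_add, add_mul, Finset.mul_sum, Finset.sum_mul]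
        simp only [mul_assoc]
      rw [Finset.sum_congr rfl h2, Finset.sum_add_distrib]
      congr 1
      refine Finset.sum_comm' fun u v => ?_
      simp only [Finset.mem_Ioo, Finset.mem_Ico]
      omega
    refine ⟨fun N => ?_, hQ⟩
    rcases hlr.eq_or_lt with rfl | hlr
    · rw [nestedSum_self, word_self, hT, transfer_pow_C, eps_C]
    · have hw : ∀ (y : NCPoly B) (c : B), K (C (b l) * (X * y * (X * C c))) = b l * (s y * c) :=
        fun y c => eps_gen_X_mul_X g s (b l) y c
      have hw0 : ∀ c, K (C (b l) * (X * C c)) = b l * (g * c) := fun c => eps_gen_X g s (b l) c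
      -- The sum over the label m of the first block is matched with the sum over rounds in
      -- `transfer_pow_X_mul`; K turns X T^m(·) X into s(T^m(·)).
      rw [nestedSum_eq K b t N hlr, Finset.sum_congr rfl fun m hm =>
        hQ m N (Finset.mem_range.1 hm) hlr, Finset.mul_sum, map_sum, word_eq b hlr, hT,
        transfer_pow_coeff_mul, transfer_pow_X_mul, ← hT, map_mul, eps_C, map_add, map_mul, eps_X,
        zero_mul, zero_add, map_sum, Finset.mul_sum]
      refine Finset.sum_congr rfl fun m _ => ?_
      rw [map_add, map_mul eps, eps_C, algHom_conv, conv_word b _ _ (by omega), mul_smul_comm, map_smul,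
        mul_add, map_add, hw0, Finset.mul_sum, map_sum, smul_mul_assoc]
      have hI : Finset.Ico (l + 1) r = Finset.Ioo l r := by
        ext; simp
      rw [hI, smul_add, mul_add, Finset.smul_sum, Finset.mul_sum]
      congr 1
      · rw [mul_smul_comm]
      · refine Finset.sum_congr rfl fun v hv => ?_
        rw [hw]
        simp

end Words

/-! ### Finite partitions and their labellings -/

section Finpartition

variable {n : ℕ} (π : Finpartition (Finset.range n))

theorem mem_part_iff {i j : ℕ} : j ∈ π.part i ↔ i < n ∧ j < n ∧ π.part j = π.part i := by
  constructor
  · intro h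
    have hi : i ∈ Finset.range n := π.part_nonempty.1 ⟨j, h⟩
    have hj : j ∈ Finset.range n := π.part_subset i h
    exact ⟨Finset.mem_range.1 hi, Finset.mem_range.1 hj, (π.mem_part_iff_part_eq_part hj hi).1 h⟩
  · rintro ⟨hi, hj, h⟩
    exact (π.mem_part_iff_part_eq_part (Finset.mem_range.2 hj) (Finset.mem_range.2 hi)).2 h

/-- The maximum of the block of `i`. -/
def blockMax (i : ℕ) : ℕ := if i < n then (π.part i).sup id else i

theorem blockMax_mem {i : ℕ} (hi : i < n) : blockMax π i ∈ π.part i := by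
  have h : (π.part i).Nonempty := ⟨i, (mem_part_iff π).2 ⟨hi, hi, rfl⟩⟩
  obtain ⟨j, hj, hj'⟩ := Finset.exists_mem_eq_sup _ h id
  rw [blockMax, if_pos hi, hj']
  exact hj

theorem blockMax_lt {i : ℕ} (hi : i < n) : blockMax π i < n :=
  ((mem_part_iff π).1 (blockMax_mem π hi)).2.1

theorem part_blockMax {i : ℕ} (hi : i < n) : π.part (blockMax π i) = π.part i :=
  ((mem_part_iff π).1 (blockMax_mem π hi)).2.2

theorem blockMax_of_le {i : ℕ} (hi : n ≤ i) : blockMax π i = i := by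
  rw [blockMax, if_neg (by omega)]

theorem le_blockMax_of_mem {i j : ℕ} (h : j ∈ π.part i) : j ≤ blockMax π i := by
  rw [blockMax, if_pos ((mem_part_iff π).1 h).1]
  exact Finset.le_sup (f := id) h

theorem le_blockMax (i : ℕ) : i ≤ blockMax π i := by
  by_cases hi : i < n
  · exact le_blockMax_of_mem π ((mem_part_iff π).2 ⟨hi, hi, rfl⟩)
  · rw [blockMax_of_le π (by omega)]

theorem blockMax_eq_iff {i j : ℕ} (hi : i < n) (hj : j < n) :
    blockMax π i = blockMax π j ↔ π.part i = π.part j := by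
  constructor
  · intro h
    rw [← part_blockMax π hi, h, part_blockMax π hj]
  · intro h
    rw [blockMax, blockMax, if_pos hi, if_pos hj, h]

theorem finpartition_ext {π π' : Finpartition (Finset.range n)}
    (h : ∀ i, i < n → π.part i = π'.part i) : π = π' := by
  have h1 : ∀ ρ ρ' : Finpartition (Finset.range n), (∀ i, i < n → ρ.part i = ρ'.part i) →
      ρ.parts ⊆ ρ'.parts := by
    intro ρ ρ' h U hU
    obtain ⟨i, hi⟩ := ρ.nonempty_of_mem_parts hU
    have hin := ρ.le hU hi
    rw [← ρ.part_eq_of_mem hU hi, h i (Finset.mem_range.1 hin)]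
    exact ρ'.part_mem.2 hin
  exact Finpartition.ext (Finset.Subset.antisymm (h1 _ _ h) (h1 _ _ fun i hi => (h i hi).symm))

theorem blockMax_injective {π π' : Finpartition (Finset.range n)}
    (h : blockMax π = blockMax π') : π = π' := by
  refine finpartition_ext fun i hi => ?_
  ext j
  rw [mem_part_iff, mem_part_iff]
  refine and_congr_right fun _ => and_congr_right fun hj => ?_
  rw [← blockMax_eq_iff π hj hi, ← blockMax_eq_iff π' hj hi, h]

/-- An element of the block of j outside the interval would cross the block containing i and k. -/
theorem IsNonCrossing.between {π : Finpartition (Finset.range n)} (hπ : IsNonCrossing π)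
    {i j k v : ℕ} (hij : i < j) (hjk : j < k) (hk : k < n) (hik : π.part i = π.part k)
    (hne : π.part j ≠ π.part i) (hv : v ∈ π.part j) : i < v ∧ v < k := by
  obtain ⟨_, hvn, hvj⟩ := (mem_part_iff π).1 hv
  constructor
  · rcases lt_trichotomy i v with h | h | h
    · exact h
    · exact absurd (h ▸ hvj).symm hne
    · exact absurd ((hπ v i j k h hij hjk hk hvj hik).symm.trans hvj).symm hne
  · rcases lt_trichotomy v k with h | h | h
    · exact h
    · exact absurd (hvj.symm.trans (h ▸ hik.symm)) hne
    · exact absurd (hπ i j k v hij hjk h hvn hik hvj.symm).symm hne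

theorem IsNonCrossing.covers {π : Finpartition (Finset.range n)} (hπ : IsNonCrossing π)
    {i j k : ℕ} (hij : i < j) (hjk : j < k) (hk : k < n) (hik : π.part i = π.part k)
    (hne : π.part j ≠ π.part i) : Covers (π.part i) (π.part j) :=
  ⟨i, (mem_part_iff π).2 ⟨by omega, by omega, rfl⟩, k,
    (mem_part_iff π).2 ⟨by omega, hk, hik.symm⟩, fun _ hv => hπ.between hij hjk hk hik hne hv⟩

/-- The labellings of the blocks by numbers less than `N` that decrease strictly from a block to
the blocks it covers. -/
abbrev CoverLabelling (N : ℕ) : Type :=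
  {h : π.parts → Fin N // ∀ U V : π.parts, Covers (U : Finset ℕ) (V : Finset ℕ) → h V < h U}

/-- The block of `i`. -/
def partOf {i : ℕ} (hi : i < n) : π.parts := ⟨π.part i, π.part_mem.2 (Finset.mem_range.2 hi)⟩

theorem partOf_sup (U : π.parts) : ∃ hi : (U : Finset ℕ).sup id < n,
    partOf π hi = U ∧ blockMax π ((U : Finset ℕ).sup id) = (U : Finset ℕ).sup id ∧
      (U : Finset ℕ).sup id ∈ (U : Finset ℕ) := by
  have hne := π.nonempty_of_mem_parts U.2
  obtain ⟨j, hj, hj'⟩ := Finset.exists_mem_eq_sup _ hne id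
  have hmem : (U : Finset ℕ).sup id ∈ (U : Finset ℕ) := by rw [hj']; exact hj
  have hi := Finset.mem_range.1 (π.le U.2 hmem)
  have hp := π.part_eq_of_mem U.2 hmem
  refine ⟨hi, Subtype.ext hp, ?_, hmem⟩
  rw [blockMax, if_pos hi, hp]

/-- An element j between i and the maximum of its block either belongs to that block or lies in a
block covered by it. The two cases give nesting and strictness. -/
theorem isLabelledNC_of_coverLabelling {π : Finpartition (Finset.range n)} (hπ : IsNonCrossing π)
    {N : ℕ} (h : CoverLabelling π N) :
    IsLabelledNC N 0 n
      (blockMax π, fun i => if hi : i < n then (h.1 (partOf π hi) : ℕ) else 0) := by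
  have hcase : ∀ i j, i ≤ j → j ≤ blockMax π i → blockMax π j = blockMax π i ∨
      ∃ (_ : i < j) (_ : j < blockMax π i) (hi : i < n) (hj : j < n),
        π.part j ≠ π.part i ∧ Covers (partOf π hi : Finset ℕ) (partOf π hj : Finset ℕ) := by
    intro i j hij hj
    by_cases hi : i < n
    · have hb := blockMax_lt π hi
      by_cases he : π.part j = π.part i
      · exact Or.inl ((blockMax_eq_iff π (by omega) hi).2 he)
      · have h1 : i ≠ j := fun h => he (by rw [h])
        have h2 : j ≠ blockMax π i := fun h => he (by rw [h, part_blockMax π hi])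
        exact Or.inr ⟨by omega, by omega, hi, by omega, he,
          hπ.covers (by omega) (by omega) hb (part_blockMax π hi).symm he⟩
    · rw [blockMax_of_le π (by omega)] at hj
      left
      rw [le_antisymm hij hj]
  refine ⟨le_blockMax π, fun i j hij hj => ?_, fun i hi => ?_, fun i => ?_, fun i j hij hj => ?_,
    fun i _ hi => ?_, fun i hi => ?_⟩
  · rcases hcase i j hij hj with h | ⟨h1, h2, hi, hj', he, -⟩
    · exact h.le
    · exact (hπ.between h1 h2 (blockMax_lt π hi) (part_blockMax π hi).symm he
        (blockMax_mem π hj')).2.le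
  · by_cases hin : i < n
    · exact ⟨Nat.zero_le _, blockMax_lt π hin⟩
    · exact absurd (blockMax_of_le π (by omega)) hi
  · by_cases hi : i < n
    · have : partOf π (blockMax_lt π hi) = partOf π hi := Subtype.ext (part_blockMax π hi)
      simp only [hi, blockMax_lt π hi, dif_pos, this]
    · simp only [blockMax_of_le π (not_lt.1 hi)]
  · rcases hcase i j hij hj with h' | ⟨h1, h2, hi, hj', he, hc⟩
    · exact Or.inl h'
    · right
      simp only [hi, hj', dif_pos]
      exact h.2 _ _ hc
  · simp only [hi, dif_pos]
    exact (h.1 _).2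
  · simp only [dif_neg (show ¬ i < n by omega)]

open scoped Classical in
/-- The labellings of a non-crossing partition, as functions on the elements. -/
theorem card_filter_labelledNC {π : Finpartition (Finset.range n)} (hπ : IsNonCrossing π) (N : ℕ) :
    ((labelledNC N 0 n).filter fun x : (ℕ → ℕ) × (ℕ → ℕ) => x.1 = blockMax π).card = Nat.card (CoverLabelling π N) := by
  classical
  rw [Nat.card_eq_fintype_card, ← Finset.card_univ]
  symm
  refine Finset.card_bij (fun (h : CoverLabelling π N) _ =>
    (blockMax π, fun i => if hi : i < n then (h.1 (partOf π hi) : ℕ) else 0)) ?_ ?_ ?_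
  · intro h _
    simp [isLabelledNC_of_coverLabelling hπ h]
  · intro h _ h' _ he
    refine Subtype.ext (funext fun U => Fin.ext ?_)
    obtain ⟨hi, hU, -⟩ := partOf_sup π U
    have := congrFun (congrArg Prod.snd he) ((U : Finset ℕ).sup id)
    simpa only [hi, dif_pos, hU] using this
  · rintro ⟨p, y⟩ hx
    simp only [Finset.mem_filter, mem_labelledNC] at hx
    obtain ⟨hx, rfl⟩ := hx
    have hlab : ∀ i j, i < n → j < n → π.part i = π.part j → y i = y j := by
      intro i j hi hj hij
      have h1 := hx.label i
      have h2 := hx.label j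
      simp only at h1 h2
      rw [← h1, ← h2, (blockMax_eq_iff π hi hj).2 hij]
    have hsup : ∀ U : π.parts, y ((U : Finset ℕ).sup id) < N := fun U =>
      hx.lt _ (Nat.zero_le _) (partOf_sup π U).1
    refine ⟨⟨fun U => ⟨y ((U : Finset ℕ).sup id), hsup U⟩, fun U V hUV => ?_⟩, Finset.mem_univ _, ?_⟩
    · obtain ⟨i, hi, j, hj, h⟩ := hUV
      obtain ⟨hU, hU', hU2, hU3⟩ := partOf_sup π U
      obtain ⟨hV, hV', hV2, hV3⟩ := partOf_sup π V
      have hin := Finset.mem_range.1 (π.le U.2 hi)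
      have hv := h _ hV3
      have hpi : π.part i = U := π.part_eq_of_mem U.2 hi
      have hjm : j ≤ blockMax π i := le_blockMax_of_mem π (by rw [hpi]; exact hj)
      rw [Fin.lt_def]
      simp only
      have hs := hx.strict i _ hv.1.le (hv.2.le.trans hjm)
      have hpU : π.part ((U : Finset ℕ).sup id) = U := π.part_eq_of_mem U.2 hU3
      rw [hlab _ i hU hin (by rw [hpU, hpi])]
      refine hs.resolve_left fun he => ?_
      have h1 := (blockMax_eq_iff π hV hin).1 he
      rw [hpi, π.part_eq_of_mem V.2 hV3] at h1
      have := h i (by rw [h1]; exact hi)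
      omega
    · refine Prod.ext rfl (funext fun i => ?_)
      simp only
      split_ifs with hi
      · obtain ⟨hU, hU', hU2, hU3⟩ := partOf_sup π (partOf π hi)
        exact hlab _ _ hU hi (congrArg Subtype.val hU')
      · exact (hx.zero i (by omega)).symm

/-- Take the fibres of the first function as blocks. It is idempotent and does not decrease its
argument, so each of its values is the maximum of its fibre. -/
theorem exists_blockMax_eq {N : ℕ} {x : (ℕ → ℕ) × (ℕ → ℕ)} (hx : IsLabelledNC N 0 n x) :
    ∃ π : Finpartition (Finset.range n), IsNonCrossing π ∧ x.1 = blockMax π := by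
  classical
  let π := Finpartition.ofSetSetoid (Setoid.ker x.1) (Finset.range n)
  have hmem : ∀ i j, j ∈ π.part i ↔ i < n ∧ j < n ∧ x.1 i = x.1 j := by
    intro i j
    simp only [π, Finpartition.mem_part_ofSetSetoid_iff_rel, Finset.mem_range]
    rfl
  have hpart : ∀ i j, i < n → j < n → π.part i = π.part j → x.1 i = x.1 j := by
    intro i j hi hj h
    exact ((hmem i j).1 ((mem_part_iff π).2 ⟨hi, hj, h.symm⟩)).2.2
  have hpart' : ∀ i j, i < n → j < n → x.1 i = x.1 j → π.part i = π.part j := by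
    intro i j hi hj h
    exact ((mem_part_iff π).1 ((hmem i j).2 ⟨hi, hj, h⟩)).2.2.symm
  refine ⟨π, ?_, ?_⟩
  · intro i j k l hij hjk hkl hl hik hjl
    have e1 := hpart i k (by omega) (by omega) hik
    have e2 := hpart j l (by omega) (by omega) hjl
    have h1 := hx.le k
    have h2 := hx.le l
    have h3 := hx.nc i j hij.le (by omega)
    have h4 := hx.nc j k hjk.le (by omega)
    exact hpart' i j (by omega) (by omega) (by omega)
  · funext i
    by_cases hi : i < n
    · refine le_antisymm (le_blockMax_of_mem π ?_) ?_
      · rw [hmem]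
        exact ⟨hi, hx.lt_of_lt hi, (hx.idem i).symm⟩
      · have h := (hmem _ _).1 (blockMax_mem π hi)
        rw [h.2.2]
        exact hx.le _
    · rw [blockMax_of_le π (by omega), hx.eq_self (by omega)]

theorem sum_labelledNC {M : Type*} [AddCommMonoid M] (N n : ℕ) (F : (ℕ → ℕ) → M) :
    ∑ x ∈ labelledNC N 0 n, F x.1 =
      ∑ π ∈ ncPartitions n, Nat.card (CoverLabelling π N) • F (blockMax π) := by
  classical
  have h : labelledNC N 0 n =
      (ncPartitions n).biUnion fun π => (labelledNC N 0 n).filter fun x : (ℕ → ℕ) × (ℕ → ℕ) => x.1 = blockMax π := by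
    ext x
    simp only [Finset.mem_biUnion, Finset.mem_filter, ncPartitions, Finset.mem_univ, true_and]
    constructor
    · intro hx
      obtain ⟨π, h1, h2⟩ := exists_blockMax_eq (mem_labelledNC.1 hx)
      exact ⟨π, h1, hx, h2⟩
    · rintro ⟨π, -, hx, -⟩
      exact hx
  rw [h, Finset.sum_biUnion]
  · refine Finset.sum_congr rfl fun π hπ => ?_
    rw [← card_filter_labelledNC (by simpa [ncPartitions] using hπ),
      ← Finset.sum_const (F (blockMax π))]
    exact Finset.sum_congr rfl fun x hx => by rw [(Finset.mem_filter.1 hx).2]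
  · intro π _ π' _ hne
    refine Finset.disjoint_left.2 fun x hx hx' => hne (blockMax_injective ?_)
    rw [← (Finset.mem_filter.1 hx).2, (Finset.mem_filter.1 hx').2]

/-- The fixed points of `blockMax` are the maxima of the blocks, one for each block. -/
theorem blockWeight_blockMax (t : ℂ) : blockWeight t (blockMax π) 0 n = t ^ π.parts.card := by
  classical
  rw [blockWeight, Finset.prod_ite, Finset.prod_const, Finset.prod_const_one, mul_one]
  congr 1
  refine Finset.card_bij' (fun i _ => π.part i) (fun U _ => U.sup id) ?_ ?_ ?_ ?_
  · intro i hi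
    simp only [Finset.mem_filter, Finset.mem_Ico] at hi
    exact π.part_mem.2 (Finset.mem_range.2 hi.1.2)
  · intro U hU
    obtain ⟨h1, -, h2, -⟩ := partOf_sup π ⟨U, hU⟩
    simp only [Finset.mem_filter, Finset.mem_Ico]
    exact ⟨⟨Nat.zero_le _, h1⟩, h2⟩
  · intro i hi
    simp only [Finset.mem_filter, Finset.mem_Ico] at hi
    have := hi.2
    rwa [blockMax, if_pos hi.1.2] at this
  · intro U hU
    obtain ⟨-, -, -, h3⟩ := partOf_sup π ⟨U, hU⟩
    exact π.part_eq_of_mem hU h3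

end Finpartition

/-! ### Nested evaluation along finite partitions -/

section Nested

variable {B : Type*} [CStarAlgebra B] {n : ℕ} (π : Finpartition (Finset.range n))

/-- The product of the factors `X F(a + 1, c)` over the consecutive elements `a`, `c` of a list that
is closed with `r`. -/
def listChain (F : ℕ → ℕ → B) (r : ℕ) : List ℕ → NCPoly B
  | [] => 1
  | [a] => X * C (F (a + 1) r)
  | a :: c :: L => X * C (F (a + 1) c) * listChain F r (c :: L)

theorem listChain_eq (F : ℕ → ℕ → B) (r : ℕ) (L : List ℕ) :
    listChain F r L = (List.ofFn fun i : Fin L.length =>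
      X * C (F (L[i] + 1) (if h : (i : ℕ) + 1 < L.length then L[(i : ℕ) + 1] else r))).prod := by
  induction L with
  | nil => simp [listChain]
  | cons a L ih =>
    cases L with
    | nil => simp [listChain]
    | cons c L =>
      rw [listChain, ih]
      conv_rhs => rw [List.ofFn_succ, List.prod_cons]
      simp

theorem ofFn_blockFrom (F : ℕ → ℕ → B) (l r : ℕ) :
    (List.ofFn fun i : Fin (blockFrom π l r).card =>
      X * C (F (blockElem π l r i + 1) (blockNext π l r i))).prod =
      listChain F r ((blockFrom π l r).sort (· ≤ ·)) := by
  rw [listChain_eq, List.ofFn_congr ((blockFrom π l r).length_sort (· ≤ ·)).symm]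
  congr 2
  funext i
  simp only [blockElem, blockNext, Finset.orderEmbOfFin_apply, Fin.val_cast, Finset.length_sort]
  rfl

/-- Peels off the first element of a block; this turns the enumeration of whole blocks in `nested`
into the recursion of `blockPoly` by successors. -/
theorem listChain_blockFrom (F : ℕ → ℕ → B) {l r : ℕ} (hlr : l < r) (hr : r ≤ n) :
    listChain F r ((blockFrom π l r).sort (· ≤ ·)) =
      X * C (F (l + 1) (nextIn (blockMax π) l r)) *
        (if nextIn (blockMax π) l r < r then
          listChain F r ((blockFrom π (nextIn (blockMax π) l r) r).sort (· ≤ ·)) else 1) := by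
  have key : ∀ l r, l < r → r ≤ n → (blockFrom π l r).sort (· ≤ ·) =
      l :: (if nextIn (blockMax π) l r < r then
        (blockFrom π (nextIn (blockMax π) l r) r).sort (· ≤ ·) else []) := by
    intro l r hlr hr
    obtain ⟨h1, h2, h3, h4⟩ := nextIn_cases (blockMax π) hlr
    set u := nextIn (blockMax π) l r
    have h4' : ∀ v, l < v → v < u → π.part v ≠ π.part l := fun v hv hvu h =>
      h4 v hv hvu ((blockMax_eq_iff π (by omega) (by omega)).2 h)
    split_ifs with hu
    · have h3' := (blockMax_eq_iff π (by omega) (by omega)).1 (h3 hu)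
      have : blockFrom π l r = insert l (blockFrom π u r) := by
        ext v
        simp only [blockFrom, Finset.mem_filter, Finset.mem_Ico, Finset.mem_insert, h3']
        constructor
        · rintro ⟨⟨hv, hv'⟩, hp⟩
          by_cases hvl : v = l
          · exact Or.inl hvl
          · right
            refine ⟨⟨?_, hv'⟩, hp⟩
            by_contra hvu
            exact h4' v (by omega) (by omega) hp
        · rintro (rfl | ⟨⟨hv, hv'⟩, hp⟩)
          · exact ⟨⟨le_rfl, hlr⟩, rfl⟩
          · exact ⟨⟨by omega, hv'⟩, hp⟩
      rw [this, Finset.sort_insert]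
      · intro v hv
        simp only [blockFrom, Finset.mem_filter, Finset.mem_Ico] at hv
        omega
      · simp only [blockFrom, Finset.mem_filter, Finset.mem_Ico]
        omega
    · have : blockFrom π l r = {l} := by
        ext v
        simp only [blockFrom, Finset.mem_filter, Finset.mem_Ico, Finset.mem_singleton]
        constructor
        · rintro ⟨⟨hv, hv'⟩, hp⟩
          by_contra hvl
          exact h4' v (by omega) (by omega) hp
        · rintro rfl
          exact ⟨⟨le_rfl, hlr⟩, rfl⟩
      rw [this, Finset.sort_singleton]
  obtain ⟨h1, h2, h3, h4⟩ := nextIn_cases (blockMax π) hlr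
  rw [key l r hlr hr]
  split_ifs with hu
  · rw [key _ r hu hr, listChain]
  · rw [listChain, mul_one, le_antisymm h2 (not_lt.1 hu)]

theorem listChain_nestedEval (K : NCPoly B →ₗ[ℂ] B) (b : ℕ → B) {l r : ℕ} (hlr : l < r)
    (hr : r ≤ n) :
    listChain (nestedEval K b (blockMax π)) r ((blockFrom π l r).sort (· ≤ ·)) =
      blockPoly K b (blockMax π) l r := by
  induction hk : r - l using Nat.strong_induction_on generalizing l with
  | _ k ih =>
    obtain ⟨h1, h2, h3, h4⟩ := nextIn_cases (blockMax π) hlr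
    rw [listChain_blockFrom π _ hlr hr, blockPoly_eq K b _ hlr]
    congr 1
    split_ifs with hu
    · exact ih _ (by omega) hu rfl
    · rfl

theorem nested_eq_nestedEval {K : NCPoly B →ₗ[ℂ] B} {K₀ : NCPoly₀ B →ₗ[ℂ] B}
    (hK : ∀ p : NCPoly₀ B, K₀ p = K p) (b : ℕ → B) {l r : ℕ} (hr : r ≤ n) :
    nested K₀ π b l r = nestedEval K b (blockMax π) l r := by
  induction hk : r - l using Nat.strong_induction_on generalizing l r with
  | _ k ih =>
    rw [nested]
    split_ifs with hlr
    · have hc : (fun i => nested K₀ π b (blockElem π l r i + 1) (blockNext π l r i)) =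
          fun i => nestedEval K b (blockMax π) (blockElem π l r i + 1) (blockNext π l r i) := by
        funext i
        have h1 := blockElem_mem π l r i
        have h2 := blockNext_le π l r i
        exact ih _ (by omega) (by omega) rfl
      rw [hc, hK, nestedEval, if_pos hlr, ← listChain_nestedEval π K b hlr hr, ← ofFn_blockFrom]
      rfl
    · rw [nestedEval, if_neg hlr]

variable {g : B} {s : NCPoly B →ₗ[ℂ] B}

theorem mono_higher (m : ℕ) (b : ℕ → B) : mono (b 0) (fun i : Fin (m + 2) => b (i + 1)) =
    C (b 0) * (X * mono (b 1) (fun i : Fin m => b (i + 2)) * (X * C (b (m + 2)))) := by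
  rw [mono, mono, List.ofFn_succ, List.prod_cons, List.ofFn_succ']
  simp [mul_assoc, List.concat_eq_append]

theorem mono_one (b c : B) : mono b (fun _ : Fin 1 => c) = C b * (X * C c) := by
  simp [mono]

theorem exists_sequence (b : B) {m : ℕ} (c : Fin m → B) :
    ∃ b' : ℕ → B, b = b' 0 ∧ c = fun i : Fin m => b' (i + 1) := by
  refine ⟨fun i => if i = 0 then b else if h : i - 1 < m then c ⟨i - 1, h⟩ else 0, by simp, ?_⟩
  funext i
  simp

theorem HasCumulantPair.eq_eps_gen {K₀ : NCPoly₀ B →ₗ[ℂ] B} (h : HasCumulantPair g s K₀)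
    (p : NCPoly₀ B) : K₀ p = (eps.toLinearMap.comp (gen g s)) p := by
  obtain ⟨p, hp⟩ := p
  induction hp using Submodule.span_induction with
  | mem p hp =>
    obtain ⟨m, b, c, hm, rfl⟩ := hp
    obtain ⟨b', hb, hc⟩ := exists_sequence b c
    match m, hm, c, hc with
    | 1, hm, c, hc =>
      have := h.first b (c 0)
      have hc' : c = fun _ => c 0 := by funext i; rw [Subsingleton.elim i 0]
      rw [hc']
      refine this.trans ?_
      change _ = eps (gen g s (mono b fun _ : Fin 1 => c 0))
      rw [mono_one, eps_gen_X, mul_assoc]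
    | m + 2, hm, c, hc =>
      have := h.higher m b'
      subst hb hc
      refine this.trans ?_
      change _ = eps (gen g s (mono (b' 0) fun i : Fin (m + 2) => b' (i + 1)))
      rw [mono_higher, eps_gen_X_mul_X, mul_assoc]
  | zero => exact (map_zero K₀).trans (map_zero _).symm
  | add p q hp hq hp' hq' =>
    have := map_add K₀ ⟨p, hp⟩ ⟨q, hq⟩
    rw [hp', hq'] at this
    exact this.trans (map_add _ p q).symm
  | smul z p hp hp' =>
    have := map_smul K₀ z ⟨p, hp⟩
    rw [hp'] at this
    exact this.trans (map_smul (eps.toLinearMap.comp (gen g s)) z p).symm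

theorem hasCumulantPair_iff {K₀ : NCPoly₀ B →ₗ[ℂ] B} :
    HasCumulantPair g s K₀ ↔ K₀ = (eps.toLinearMap.comp (gen g s)).comp (NCPoly₀ B).subtype := by
  refine ⟨fun h => LinearMap.ext fun p => h.eq_eps_gen p, ?_⟩
  rintro rfl
  refine ⟨fun b₀ b₁ => ?_, fun m b => ?_⟩
  · change eps (gen g s (mono b₀ fun _ : Fin 1 => b₁)) = _
    rw [mono_one, eps_gen_X, mul_assoc]
  · change eps (gen g s (mono (b 0) fun i : Fin (m + 2) => b (i + 1))) = _
    rw [mono_higher, eps_gen_X_mul_X, mul_assoc]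

/-- Group the labelled partitions by the underlying partition: neither the nested evaluation nor the
weight depends on the labels. -/
theorem eps_transfer_pow_mono {K₀ : NCPoly₀ B →ₗ[ℂ] B} (h : HasCumulantPair g s K₀) (t : ℂ)
    (N n : ℕ) (b : ℕ → B) :
    eps ((transfer (t • g) (t • s) ^ N) (mono (b 0) fun i : Fin n => b (i + 1))) =
      ∑ π ∈ ncPartitions n, ((Nat.card (CoverLabelling π N) : ℂ) * t ^ π.parts.card) •
        partitioned K₀ π b := by
  rw [mono_eq_word, ← nestedSum_eq_transfer_pow b g s t N (Nat.zero_le n), nestedSum,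
    sum_labelledNC N n fun p => blockWeight t p 0 n • nestedEval _ b p 0 n]
  refine Finset.sum_congr rfl fun π _ => ?_
  rw [partitioned, nested_eq_nestedEval π h.eq_eps_gen b le_rfl, blockWeight_blockMax, mul_smul,
    Nat.cast_smul_eq_nsmul]

end Nested

/-! ### Counting labellings -/

section Counting

/-- With a single label no block may cover another, which for non-crossing partitions means that all
blocks are intervals. -/
theorem card_coverLabelling_one {n : ℕ} {π : Finpartition (Finset.range n)}
    (hπ : IsNonCrossing π) : (IsIntervalPartition π → Nat.card (CoverLabelling π 1) = 1) ∧
      (¬ IsIntervalPartition π → Nat.card (CoverLabelling π 1) = 0) := by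
  constructor
  · intro h
    have hno : ∀ U V : π.parts, ¬ Covers (U : Finset ℕ) (V : Finset ℕ) := by
      rintro U V ⟨i, hi, j, hj, hv⟩
      obtain ⟨v, hvV⟩ := π.nonempty_of_mem_parts V.2
      obtain ⟨h1, h2⟩ := hv v hvV
      have hjn := Finset.mem_range.1 (π.le U.2 hj)
      have hpi := π.part_eq_of_mem U.2 hi
      have hpj := π.part_eq_of_mem U.2 hj
      have := h i v j h1 h2 hjn (hpi.trans hpj.symm)
      rw [π.part_eq_of_mem V.2 hvV, hpi] at this
      have := hv i (by rw [this]; exact hi)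
      omega
    have : Unique (CoverLabelling π 1) :=
      { default := ⟨fun _ => 0, fun U V hUV => absurd hUV (hno U V)⟩
        uniq := fun h => Subtype.ext (funext fun U => Subsingleton.elim _ _) }
    exact Nat.card_unique
  · intro h
    have : IsEmpty (CoverLabelling π 1) := by
      refine ⟨fun f => h fun i j k hij hjk hk hik => ?_⟩
      by_contra hne
      have := f.2 (partOf π (by omega : i < n)) (partOf π (by omega : j < n))
        (hπ.covers hij hjk hk hik hne)
      exact absurd this (by simp [Subsingleton.elim (f.1 _) 0])
    exact Nat.card_of_isEmpty

theorem IsIntervalPartition.isNonCrossing {n : ℕ} {π : Finpartition (Finset.range n)}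
    (h : IsIntervalPartition π) : IsNonCrossing π := by
  intro i j k l hij hjk hkl hl hik _
  exact (h i j k hij hjk (by omega) hik).symm

theorem eps_transfer_mono {B : Type*} [CStarAlgebra B] {g : B} {s : NCPoly B →ₗ[ℂ] B}
    {K₀ : NCPoly₀ B →ₗ[ℂ] B} (h : HasCumulantPair g s K₀) (n : ℕ) (b : ℕ → B) :
    eps (transfer g s (mono (b 0) fun i : Fin n => b (i + 1))) =
      ∑ π ∈ intervalPartitions n, partitioned K₀ π b := by
  have h1 := eps_transfer_pow_mono h 1 1 n b
  rw [one_smul, one_smul, pow_one] at h1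
  rw [h1]
  symm
  have hsub : intervalPartitions n ⊆ ncPartitions n := by
    intro π hπ
    simp only [intervalPartitions, ncPartitions, Finset.mem_filter, Finset.mem_univ,
      true_and] at hπ ⊢
    exact hπ.isNonCrossing
  rw [← Finset.sum_subset hsub]
  · refine Finset.sum_congr rfl fun π hπ => ?_
    simp only [intervalPartitions, Finset.mem_filter, Finset.mem_univ, true_and] at hπ
    rw [(card_coverLabelling_one hπ.isNonCrossing).1 hπ]
    simp
  · intro π hπ hπ'
    simp only [intervalPartitions, ncPartitions, Finset.mem_filter, Finset.mem_univ,
      true_and] at hπ hπ'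
    rw [(card_coverLabelling_one hπ).2 hπ']
    simp

variable {α : Type*} [Fintype α] (R : α → α → Prop)

/-- The injective labellings are given by a linear extension and a set of labels. -/
theorem card_injective_labellings (N : ℕ) :
    Nat.card {h : α → Fin N // Function.Injective h ∧ ∀ a b, R a b → h b < h a} =
      Nat.card {f : α ≃ Fin (Fintype.card α) // ∀ a b, R a b → f a < f b} *
        N.choose (Fintype.card α) := by
  classical
  have hcard : N.choose (Fintype.card α) =
      Nat.card {S : Finset (Fin N) // S.card = Fintype.card α} := by
    rw [Nat.card_eq_fintype_card, Fintype.card_finset_len, Fintype.card_fin]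
  rw [hcard, ← Nat.card_prod]
  symm
  -- The set S of labels used is enumerated backwards: labellings decrease along the relation, while
  -- linear extensions increase.
  refine Nat.card_eq_of_bijective (fun x => ⟨fun a => x.2.1.orderEmbOfFin x.2.2 (Fin.rev (x.1.1 a)),
    fun a b hab => ?_, fun a b hab => ?_⟩) ⟨?_, ?_⟩
  · simpa using hab
  · simpa using x.1.2 a b hab
  · rintro ⟨⟨f, hf⟩, ⟨S, hS⟩⟩ ⟨⟨f', hf'⟩, ⟨S', hS'⟩⟩ h
    have h1 : ∀ a, S.orderEmbOfFin hS (Fin.rev (f a)) = S'.orderEmbOfFin hS' (Fin.rev (f' a)) :=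
      fun a => congrFun (congrArg Subtype.val h) a
    have himg : ∀ (T : Finset (Fin N)) (hT : T.card = Fintype.card α)
        (e : α ≃ Fin (Fintype.card α)), Set.range (fun a => T.orderEmbOfFin hT (Fin.rev (e a))) =
          (T : Set (Fin N)) := by
      intro T hT e
      rw [← Finset.range_orderEmbOfFin T hT]
      exact (e.trans Fin.revPerm).surjective.range_comp (T.orderEmbOfFin hT)
    have hSS : S = S' := by
      apply Finset.coe_injective
      rw [← himg S hS f, ← himg S' hS' f']
      exact congrArg Set.range (funext h1)
    subst hSS
    have hff : f = f' := Equiv.ext fun a => by simpa using h1 a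
    subst hff
    rfl
  · rintro ⟨h, hinj, hR⟩
    let S : Finset (Fin N) := Finset.univ.image h
    have hS : S.card = Fintype.card α := by
      rw [Finset.card_image_of_injective _ hinj, Finset.card_univ]
    have hmem : ∀ a, h a ∈ S := fun a => Finset.mem_image_of_mem h (Finset.mem_univ a)
    let f : α → Fin (Fintype.card α) := fun a => Fin.rev ((S.orderIsoOfFin hS).symm ⟨h a, hmem a⟩)
    have hf : Function.Bijective f := by
      rw [Fintype.bijective_iff_injective_and_card]
      refine ⟨fun a b hab => hinj ?_, by simp⟩
      have := (S.orderIsoOfFin hS).symm.injective (Fin.rev_injective hab)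
      exact congrArg Subtype.val this
    refine ⟨⟨⟨Equiv.ofBijective f hf, fun a b hab => ?_⟩, ⟨S, hS⟩⟩, ?_⟩
    · simp only [Equiv.ofBijective_apply, f, Fin.rev_lt_rev, OrderIso.lt_iff_lt]
      exact hR a b hab
    · refine Subtype.ext (funext fun a => ?_)
      simp only [Equiv.ofBijective_apply, f, Fin.rev_rev]
      rw [← Finset.coe_orderIsoOfFin_apply, OrderIso.apply_symm_apply]

/-- Injective labellings are linear extensions with a choice of k labels, and choose(N, k)/N^k →
1/k!. The other labellings are at most the non-injective functions, whose share of N^k tends to 0.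
-/
theorem tendsto_card_labellings :
    Tendsto (fun N : ℕ => (Nat.card {h : α → Fin N // ∀ a b, R a b → h b < h a} : ℝ) *
        ((N : ℝ)⁻¹) ^ Fintype.card α) atTop
      (𝓝 ((Nat.card {f : α ≃ Fin (Fintype.card α) // ∀ a b, R a b → f a < f b} : ℝ) /
        ((Fintype.card α).factorial : ℝ))) := by
  classical
  set k := Fintype.card α with hk
  set o := Nat.card {f : α ≃ Fin k // ∀ a b, R a b → f a < f b} with ho
  have hlow : ∀ N, o * N.choose k ≤ Nat.card {h : α → Fin N // ∀ a b, R a b → h b < h a} := by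
    intro N
    rw [ho, ← card_injective_labellings R N]
    exact Nat.card_le_card_of_injective (fun h => ⟨h.1, h.2.2⟩) fun h h' e =>
      Subtype.ext (by simpa using congrArg Subtype.val e)
  -- Inclusion and exclusion for the strict labellings and the injective functions, written without
  -- subtraction.
  have hup : ∀ N, Nat.card {h : α → Fin N // ∀ a b, R a b → h b < h a} + k.factorial * N.choose k ≤
      o * N.choose k + N ^ k := by
    intro N
    rw [ho, ← card_injective_labellings R N, ← Nat.descFactorial_eq_factorial_mul_choose]
    have h1 : N.descFactorial k = Fintype.card {h : α → Fin N // Function.Injective h} := by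
      rw [← Fintype.card_congr (Equiv.subtypeInjectiveEquivEmbedding α (Fin N)).symm,
        Fintype.card_embedding_eq, Fintype.card_fin]
    have h2 : N ^ k = Fintype.card (α → Fin N) := by
      rw [Fintype.card_fun, Fintype.card_fin]
    rw [h1, h2, Nat.card_eq_fintype_card, Nat.card_eq_fintype_card, Fintype.card_subtype,
      Fintype.card_subtype, Fintype.card_subtype, ← Finset.card_univ,
      ← Finset.card_union_add_card_inter, add_comm]
    refine add_le_add (Finset.card_le_card fun h hh => ?_) (Finset.card_le_univ _)
    simp only [Finset.mem_inter, Finset.mem_filter, Finset.mem_univ, true_and] at hh ⊢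
    exact ⟨hh.2, hh.1⟩
  have hc := tendsto_choose_mul_inv_pow_real k
  have hk0 : (k.factorial : ℝ) ≠ 0 := by exact_mod_cast k.factorial_ne_zero
  have hl : Tendsto (fun N : ℕ => (o : ℝ) * ((N.choose k : ℝ) * ((N : ℝ)⁻¹) ^ k)) atTop
      (𝓝 ((o : ℝ) / (k.factorial : ℝ))) := by
    simpa [div_eq_mul_inv] using hc.const_mul (o : ℝ)
  have hu : Tendsto (fun N : ℕ => (o : ℝ) * ((N.choose k : ℝ) * ((N : ℝ)⁻¹) ^ k) +
      (1 - (k.factorial : ℝ) * ((N.choose k : ℝ) * ((N : ℝ)⁻¹) ^ k))) atTop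
      (𝓝 ((o : ℝ) / (k.factorial : ℝ))) := by
    have h := hl.add ((hc.const_mul (k.factorial : ℝ)).const_sub 1)
    rw [mul_inv_cancel₀ hk0, sub_self, add_zero] at h
    exact h
  refine tendsto_of_tendsto_of_tendsto_of_le_of_le' hl hu ?_ ?_
  · refine Eventually.of_forall fun N => ?_
    have h : (o : ℝ) * (N.choose k : ℝ) ≤
        (Nat.card {h : α → Fin N // ∀ a b, R a b → h b < h a} : ℝ) := by exact_mod_cast hlow N
    rw [← mul_assoc]
    exact mul_le_mul_of_nonneg_right h (by positivity)
  · filter_upwards [eventually_gt_atTop 0] with N hN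
    have h : (Nat.card {h : α → Fin N // ∀ a b, R a b → h b < h a} : ℝ) +
        (k.factorial : ℝ) * (N.choose k : ℝ) ≤ (o : ℝ) * (N.choose k : ℝ) + (N : ℝ) ^ k := by
      exact_mod_cast hup N
    have hN' : (N : ℝ) ≠ 0 := by positivity
    have h1 : (N : ℝ) ^ k * ((N : ℝ)⁻¹) ^ k = 1 := by
      rw [← mul_pow, mul_inv_cancel₀ hN', one_pow]
    have h2 := mul_le_mul_of_nonneg_right h (show (0 : ℝ) ≤ ((N : ℝ)⁻¹) ^ k by positivity)
    rw [add_mul, add_mul, h1] at h2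
    linarith

theorem tendsto_card_coverLabelling {n : ℕ} (π : Finpartition (Finset.range n)) :
    Tendsto (fun N : ℕ => (Nat.card (CoverLabelling π N) : ℂ) * ((N : ℂ)⁻¹) ^ π.parts.card) atTop
      (𝓝 ((orderCount π : ℂ) / (Nat.factorial π.parts.card : ℂ))) := by
  have h := tendsto_card_labellings
    (R := fun U V : π.parts => Covers (U : Finset ℕ) (V : Finset ℕ))
  have h' := (Complex.continuous_ofReal.tendsto _).comp h
  have hc : Fintype.card π.parts = π.parts.card := Fintype.card_coe _
  rw [hc] at h'
  simp only [Function.comp_def, Complex.ofReal_mul, Complex.ofReal_pow, Complex.ofReal_inv,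
    Complex.ofReal_natCast, Complex.ofReal_div] at h'
  exact h'

/-- The moments of the exponential of the generator. -/
theorem eps_expGen_mono {B : Type*} [CStarAlgebra B] {g : B} {s : NCPoly B →ₗ[ℂ] B}
    {K₀ : NCPoly₀ B →ₗ[ℂ] B} (h : HasCumulantPair g s K₀) (n : ℕ) (b : ℕ → B) :
    eps (expGen g s (mono (b 0) fun i : Fin n => b (i + 1))) =
      ∑ π ∈ ncPartitions n,
        ((orderCount π : ℂ) / (Nat.factorial π.parts.card : ℂ)) • partitioned K₀ π b := by
  -- The moments of Tⁿ for the pair scaled by 1/n are computed once by operators and once by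
  -- partitions, and the limits must agree.
  refine tendsto_nhds_unique (tendsto_eps_transfer_pow g s _) ?_
  simp only [eps_transfer_pow_mono h]
  exact tendsto_finsetSum _ fun π _ => (tendsto_card_coverLabelling π).smul_const _

end Counting

/-! ### Cumulant functionals and generators -/

section Functionals

variable {B : Type*} [CStarAlgebra B]

theorem C_mul_mono (a b : B) {n : ℕ} (c : Fin n → B) : C a * mono b c = mono (a * b) c := by
  rw [mono, mono, map_mul, mul_assoc]

theorem X_mul_mono (b : B) {n : ℕ} (c : Fin n → B) :
    X * mono b c = mono 1 (Fin.cons b c : Fin (n + 1) → B) := by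
  simp [mono, List.ofFn_succ, mul_assoc]

theorem mem_span_mono (p : NCPoly B) :
    p ∈ Submodule.span ℂ {p | ∃ (n : ℕ) (b : B) (c : Fin n → B), p = mono b c} := by
  have hmul : ∀ q : NCPoly B, (∀ (n : ℕ) (b : B) (c : Fin n → B),
      ∃ (n' : ℕ) (b' : B) (c' : Fin n' → B), q * mono b c = mono b' c') →
      ∀ p ∈ Submodule.span ℂ {p | ∃ (n : ℕ) (b : B) (c : Fin n → B), p = mono b c},
        q * p ∈ Submodule.span ℂ {p | ∃ (n : ℕ) (b : B) (c : Fin n → B), p = mono b c} := by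
    intro q hq p hp
    refine (Submodule.span_le (p := (Submodule.span ℂ _).comap (LinearMap.mulLeft ℂ q))).2 ?_ hp
    rintro _ ⟨n, b, c, rfl⟩
    exact Submodule.subset_span (hq n b c)
  induction p using left_induction with
  | one => exact Submodule.subset_span ⟨0, 1, Fin.elim0, by simp [mono]⟩
  | add p q hp hq => exact Submodule.add_mem _ hp hq
  | coeff_mul b p hp => exact hmul _ (fun n b' c => ⟨n, b * b', c, C_mul_mono b b' c⟩) p hp
  | X_mul p hp => exact hmul _ (fun n b c => ⟨n + 1, 1, Fin.cons b c, X_mul_mono b c⟩) p hp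

theorem linearMap_ext_mono {f h : NCPoly B →ₗ[ℂ] B}
    (hfh : ∀ (n : ℕ) (b : ℕ → B), f (mono (b 0) fun i : Fin n => b (i + 1)) =
      h (mono (b 0) fun i : Fin n => b (i + 1))) : f = h := by
  ext p
  refine LinearMap.eqOn_span (f := f) (g := h) ?_ (mem_span_mono p)
  rintro _ ⟨n, b, c, rfl⟩
  obtain ⟨b', rfl, rfl⟩ := exists_sequence b c
  exact hfh n b'

theorem linearMap_ext_mono₀ {K L : NCPoly₀ B →ₗ[ℂ] B}
    (h : ∀ (m : ℕ) (b : ℕ → B), K (mono₀ (b 0) (Nat.succ_pos m) fun i : Fin (m + 1) => b (i + 1)) =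
      L (mono₀ (b 0) (Nat.succ_pos m) fun i : Fin (m + 1) => b (i + 1))) : K = L := by
  ext ⟨p, hp⟩
  induction hp using Submodule.span_induction with
  | mem p hp =>
    obtain ⟨m, b, c, hm, rfl⟩ := hp
    obtain ⟨b', rfl, rfl⟩ := exists_sequence b c
    match m, hm with
    | m + 1, hm => exact h m b'
  | zero => exact (map_zero K).trans (map_zero L).symm
  | add p q hp hq hp' hq' =>
    have h1 := map_add K ⟨p, hp⟩ ⟨q, hq⟩
    rw [hp', hq', ← map_add] at h1
    exact h1
  | smul z p hp hp' =>
    have h1 := map_smul K z ⟨p, hp⟩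
    rw [hp', ← map_smul] at h1
    exact h1

theorem X_mul_mul_X_mem (p : NCPoly B) : X * p * X ∈ NCPoly₀ B := by
  refine (Submodule.span_le (p := (NCPoly₀ B).comap
    ((LinearMap.mulRight ℂ X).comp (LinearMap.mulLeft ℂ X)))).2 ?_ (mem_span_mono p)
  rintro _ ⟨n, b, c, rfl⟩
  refine Submodule.subset_span ⟨n + 2, 1, Fin.cons b (Fin.snoc c 1 : Fin (n + 1) → B),
    by omega, ?_⟩
  rw [← X_mul_mono, LinearMap.comp_apply, LinearMap.mulLeft_apply, LinearMap.mulRight_apply,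
    mul_assoc]
  congr 1
  rw [mono, mono, List.ofFn_succ']
  simp [List.concat_eq_append, mul_assoc]

/-- A bimodule map `K` on `B₀⟨X⟩` is determined by `K[X]` and `p ↦ K[X p X]`. -/
theorem IsBimoduleMap₀.exists_hasCumulantPair {K : NCPoly₀ B →ₗ[ℂ] B} (hK : IsBimoduleMap₀ K) :
    ∃ (g : B) (s : NCPoly B →ₗ[ℂ] B), HasCumulantPair g s K := by
  refine ⟨K (mono₀ 1 Nat.one_pos fun _ : Fin 1 => 1),
    K.comp (LinearMap.codRestrict (NCPoly₀ B)
      ((LinearMap.mulRight ℂ X).comp (LinearMap.mulLeft ℂ X)) X_mul_mul_X_mem), ?_, ?_⟩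
  · intro b₀ b₁
    refine hK b₀ b₁ _ _ ?_
    change mono _ _ = C b₀ * mono 1 (fun _ : Fin 1 => 1) * C b₁
    rw [mono_one, mono_one]
    simp [mul_assoc]
  · intro m b
    refine hK (b 0) (b (m + 2)) _ _ ?_
    change mono _ _ =
      C (b 0) * (X * (mono (b 1) fun i : Fin m => b (i + 2)) * X) * C (b (m + 2))
    rw [mono_higher]
    simp only [mul_assoc]

variable (g : B) (s : NCPoly B →ₗ[ℂ] B)

theorem isBimoduleMap₀_eps_gen :
    IsBimoduleMap₀ ((eps.toLinearMap.comp (gen g s)).comp (NCPoly₀ B).subtype) := by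
  intro b c p q h
  change eps (gen g s q) = b * eps (gen g s p) * c
  rw [h, gen_mul_C, gen_coeff_mul]
  simp

theorem isMonotoneCumulant_eps_expGen :
    IsMonotoneCumulant (eps.toLinearMap.comp (expGen g s))
      ((eps.toLinearMap.comp (gen g s)).comp (NCPoly₀ B).subtype) where
  bimod :=
    { map_coeff := fun b => by simp [expGen_C]
      map_bimod := fun b c p => by simp [expGen_mul_C, expGen_coeff_mul] }
  bimod₀ := isBimoduleMap₀_eps_gen g s
  moment := eps_expGen_mono (hasCumulantPair_iff.2 rfl)

theorem isBooleanCumulant_eps_transfer :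
    IsBooleanCumulant (eps.toLinearMap.comp (transfer g s))
      ((eps.toLinearMap.comp (gen g s)).comp (NCPoly₀ B).subtype) where
  bimod :=
    { map_coeff := fun b => by simp
      map_bimod := fun b c p => by simp [transfer_mul_C] }
  bimod₀ := isBimoduleMap₀_eps_gen g s
  moment := eps_transfer_mono (hasCumulantPair_iff.2 rfl)

variable {g s}

theorem isMonotonePair_iff {ν : NCPoly B →ₗ[ℂ] B} :
    IsMonotonePair g s ν ↔ ν = eps.toLinearMap.comp (expGen g s) := by
  constructor
  · rintro ⟨K, hK, hp⟩
    exact linearMap_ext_mono fun n b => (hK.moment n b).trans (eps_expGen_mono hp n b).symm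
  · rintro rfl
    exact ⟨_, isMonotoneCumulant_eps_expGen g s, hasCumulantPair_iff.2 rfl⟩

theorem isBooleanPair_iff {ν : NCPoly B →ₗ[ℂ] B} :
    IsBooleanPair g s ν ↔ ν = eps.toLinearMap.comp (transfer g s) := by
  constructor
  · rintro ⟨K, hK, hp⟩
    exact linearMap_ext_mono fun n b => (hK.moment n b).trans (eps_transfer_mono hp n b).symm
  · rintro rfl
    exact ⟨_, isBooleanCumulant_eps_transfer g s, hasCumulantPair_iff.2 rfl⟩

/-- The monotone cumulant functional is unique. -/
theorem IsMonotoneCumulant.eq_eps_gen {K : NCPoly₀ B →ₗ[ℂ] B}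
    (hK : IsMonotoneCumulant (eps.toLinearMap.comp (expGen g s)) K) :
    K = (eps.toLinearMap.comp (gen g s)).comp (NCPoly₀ B).subtype := by
  obtain ⟨g', s', h⟩ := hK.bimod₀.exists_hasCumulantPair
  have h1 := isMonotonePair_iff.1 ⟨K, hK, h⟩
  rw [hasCumulantPair_iff.1 h, gen_eq_of_eps_expGen_eq fun p => LinearMap.congr_fun h1 p]

theorem mono_eq_C_mul_mono_snoc_mul_C (m : ℕ) (b : ℕ → B) :
    mono (b 0) (fun i : Fin (m + 1) => b (i + 1)) =
      C (b 0) * mono 1 (Fin.snoc (α := fun _ => B) (fun i : Fin m => b (i + 1)) 1) *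
        C (b (m + 1)) := by
  rw [mono, mono, List.ofFn_succ', List.ofFn_succ']
  simp [List.concat_eq_append, mul_assoc]

/-- Scaling the cumulants scales the generator. Uniqueness of the cumulant functional is needed
because the power refers to an unspecified one. -/
theorem isMonotonePower_iff {z : ℂ} {ρ : NCPoly B →ₗ[ℂ] B} :
    IsMonotonePower (eps.toLinearMap.comp (expGen g s)) (z • LinearMap.id) ρ ↔
      ρ = eps.toLinearMap.comp (expGen (z • g) (z • s)) := by
  have key : ∀ K : NCPoly₀ B →ₗ[ℂ] B, IsBimoduleMap₀ K → ∀ (m : ℕ) (b : ℕ → B),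
      (z • K) (mono₀ (b 0) (Nat.succ_pos m) fun i : Fin (m + 1) => b (i + 1)) =
        b 0 * (z • LinearMap.id (R := ℂ)) (K (mono₀ 1 (Nat.succ_pos m)
          (Fin.snoc (α := fun _ => B) (fun i : Fin m => b (i + 1)) 1))) * b (m + 1) := by
    intro K hK m b
    rw [LinearMap.smul_apply, hK (b 0) (b (m + 1)) (mono₀ 1 (Nat.succ_pos m)
      (Fin.snoc (α := fun _ => B) (fun i : Fin m => b (i + 1)) 1)) _
      (mono_eq_C_mul_mono_snoc_mul_C m b)]
    simp
  have hsmul : z • (eps.toLinearMap.comp (gen g s)).comp (NCPoly₀ B).subtype =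
      (eps.toLinearMap.comp (gen (z • g) (z • s))).comp (NCPoly₀ B).subtype := by
    rw [gen_smul]
    ext p
    simp
  constructor
  · rintro ⟨K, L, hK, hL, h⟩
    have hKg := hK.eq_eps_gen
    have hLK : L = z • K := linearMap_ext_mono₀ fun m b =>
      (h m b).trans (key K hK.bimod₀ m b).symm
    rw [hKg, hsmul] at hLK
    exact isMonotonePair_iff.1 ⟨L, hL, hasCumulantPair_iff.2 hLK⟩
  · rintro rfl
    refine ⟨_, _, isMonotoneCumulant_eps_expGen g s, isMonotoneCumulant_eps_expGen _ _, ?_⟩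
    rw [← hsmul]
    exact key _ (isBimoduleMap₀_eps_gen g s)

end Functionals

end OpValued

end

/-! ### Proof of the theorem -/

theorem mainTheorem8 {B : Type*} [CStarAlgebra B] [PartialOrder B] [StarOrderedRing B]
    (γ : B) (hγ : IsSelfAdjoint γ)
    (σ : OpValued.NCPoly B →ₗ[ℂ] B) (hσ : OpValued.IsCompletelyPositive σ) :
    ∃ ν : OpValued.NCPoly B →ₗ[ℂ] B,
      (OpValued.IsMonotonePair γ σ ν ∧ ∀ ν', OpValued.IsMonotonePair γ σ ν' → ν' = ν) ∧
      OpValued.IsCompletelyPositive ν ∧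
      ∃ μ ρ : ℕ → (OpValued.NCPoly B →ₗ[ℂ] B),
        (∀ i : ℕ, 1 ≤ i →
          (OpValued.IsBooleanPair ((i : ℂ)⁻¹ • γ) ((i : ℂ)⁻¹ • σ) (μ i) ∧
            ∀ μ', OpValued.IsBooleanPair ((i : ℂ)⁻¹ • γ) ((i : ℂ)⁻¹ • σ) μ' → μ' = μ i) ∧
          OpValued.IsCompletelyPositive (μ i) ∧
          (OpValued.IsMonotonePower (μ i) ((i : ℂ) • LinearMap.id) (ρ i) ∧
            ∀ ρ', OpValued.IsMonotonePower (μ i) ((i : ℂ) • LinearMap.id) ρ' → ρ' = ρ i) ∧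
          OpValued.IsCompletelyPositive (ρ i)) ∧
        ∀ P : OpValued.NCPoly B, Tendsto (fun i => ρ i P) atTop (𝓝 (ν P)) := by
  let T : ℕ → Module.End ℂ (OpValued.NCPoly B) := fun i =>
    OpValued.NCPoly.transfer ((i : ℂ)⁻¹ • γ) ((i : ℂ)⁻¹ • σ)
  let μ : ℕ → (OpValued.NCPoly B →ₗ[ℂ] B) := fun i => OpValued.NCPoly.eps.toLinearMap.comp (T i)
  let ρ : ℕ → (OpValued.NCPoly B →ₗ[ℂ] B) := fun i =>
    OpValued.NCPoly.eps.toLinearMap.comp (T i ^ i)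
  have hT : ∀ i, OpValued.IsSquareSum (T i) := by
    intro i
    refine OpValued.isSquareSum_transfer ?_ ?_
    · rw [star_smul, hγ.star_eq, star_inv₀, star_natCast]
    · simpa using hσ.smul (r := (i : ℝ)⁻¹) (by positivity)
  have hlim : ∀ P, Tendsto (fun i => ρ i P) atTop
      (𝓝 (OpValued.NCPoly.eps (OpValued.NCPoly.expGen γ σ P))) :=
    OpValued.NCPoly.tendsto_eps_transfer_pow γ σ
  refine ⟨OpValued.NCPoly.eps.toLinearMap.comp (OpValued.NCPoly.expGen γ σ),
    ⟨OpValued.isMonotonePair_iff.2 rfl, fun ν' h => OpValued.isMonotonePair_iff.1 h⟩,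
    OpValued.isCompletelyPositive_of_tendsto (μ := ρ) (l := atTop)
      (Eventually.of_forall fun i => ((hT i).pow i).isCompletelyPositive) hlim,
    μ, ρ, fun i _ => ⟨⟨OpValued.isBooleanPair_iff.2 rfl,
      fun μ' h => OpValued.isBooleanPair_iff.1 h⟩, (hT i).isCompletelyPositive, ?_,
      ((hT i).pow i).isCompletelyPositive⟩, hlim⟩
  -- Here T_iⁿ = exp(nD') for the generator D' of (g', s'). The case n = 1 identifies the monotone
  -- cumulants of μ i, and n = i shows that ρ i is its i-th monotone power.
  obtain ⟨g', s', h⟩ := OpValued.NCPoly.exists_gen_transfer ((i : ℂ)⁻¹ • γ) ((i : ℂ)⁻¹ • σ)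
  have hμ : μ i = OpValued.NCPoly.eps.toLinearMap.comp (OpValued.NCPoly.expGen g' s') := by
    refine LinearMap.ext fun p => congrArg OpValued.NCPoly.eps ?_
    simpa using h 1 p
  have hρ : ρ i = OpValued.NCPoly.eps.toLinearMap.comp
      (OpValued.NCPoly.expGen ((i : ℂ) • g') ((i : ℂ) • s')) :=
    LinearMap.ext fun p => congrArg OpValued.NCPoly.eps (h i p)
  rw [hμ, hρ]
  exact ⟨OpValued.isMonotonePower_iff.2 rfl, fun ρ' h => OpValued.isMonotonePower_iff.1 h⟩
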